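/- **Setting.** Letters come from a finite alphabet $\Sigma$ (which need not be fixed in advance; letters and variables are named by natural numbers). A span of a string $s=\sigma_1\cdots\sigma_\ell$ is an expression $[i,j\rangle$ with $1\le i\le j\le \ell+1$. For a finite set $V$ of variables, a $(V,s)$-tuple is a function from $V$ to the spans of $s$. A *regex formula* is given by $\alpha ::= \emptyset\mid\epsilon\mid\sigma\mid(\alpha\vee\alpha)\mid(\alpha\cdot\alpha)\mid\alpha^*\mid x\{\alpha\}$, with $\sigma$ a letter and $x$ a variable; $\mathrm{Vars}(\alpha)$ is the set of variables occurring in it. It generates a language $\mathcal R(\alpha)$ of *ref-words* over the letters and the symbols $\vdash_x,\dashv_x$, where $\mathcal R(x\{\beta\})=\vdash_x\mathcal R(\beta)\dashv_x$ and the other cases are as for regular expressions. A ref-word is *valid* for $V$ if for each $x\in V$ it contains $\vdash_x$ exactly once and $\dashv_x$ exactly once, the former before the latter. All regex formulas in queries are *functional*: every $r\in\mathcal R(\alpha)$ is valid for $\mathrm{Vars}(\alpha)$. For a valid $r=r_1\vdash_x r_2\dashv_x r_3$ put $\mu^r(x)=[i,\,i+|\mathrm{clr}(r_2)|\rangle$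 with $i=|\mathrm{clr}(r_1)|+1$, where $\mathrm{clr}$ erases the symbols $\vdash_y,\dashv_y$; then $[\![\alpha]\!](s)=\{\mu^r : r\in\mathcal R(\alpha)\text{ valid},\ \mathrm{clr}(r)=s\}$. A *regex CQ* is $q=\pi_Y(\alpha_1\bowtie\cdots\bowtie\alpha_m)$ with $m\ge1$, functional regex formulas $\alpha_i$ and $Y\subseteq\bigcup_i\mathrm{Vars}(\alpha_i)$, where $\bowtie$ is the natural join (equal spans on shared variables) and $\pi_Y$ restricts tuples to $Y$. A *regex UCQ* is a union $q_1\cup\dots\cup q_l$, $l\ge1$, of regex CQs with the same set $Y$; it is a *regex $k$-UCQ* if each $q_i$ has at most $k$ regex formulas. $[\![q]\!](s)$ is the resulting set of $(Y,s)$-tuples. The machine model is the unit-cost random access machine whose word size is logarithmic in the input. The size $|(q,s)|$ is the number of symbols of the input. **Theorem.** For every fixed $k$, regex $k$-UCQs can be evaluated with polynomial delay. That is, for every $k$ there are a program and a polynomial $p$ such that, for every regex $k$-UCQ $q$ and every string $s$, the program on input $(q,s)$ halts after having output every tuple of $[\![q]\!](s)$ exactly once and nothing else, and the time before the first answer, between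 any two consecutive answers, and from the last answer until halting, is at most $p(|(q,s)|)$. -/

import Mathlib

namespace DocSpanners

/-! ### Strings, spans, tuples and spanners

Letters and variables are named by natural numbers.  A single input mentions only finitely many
letters, so quantifying over all inputs covers every finite alphabet, without fixing one. -/

abbrev Letter : Type := ℕ

abbrev Var : Type := ℕ

/-- The expression `[lo, hi⟩`. -/
@[ext]
structure Span where
  lo : ℕ
  hi : ℕ

/-- `sp` is a span of the string `s`. -/
def Span.IsSpanOf (sp : Span) (s : List Letter) : Prop :=
  1 ≤ sp.lo ∧ sp.lo ≤ sp.hi ∧ sp.hi ≤ s.length + 1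

/-- Finite partial functions from variables to spans; the domain is made explicit in `IsTuple`. -/
abbrev Assignment : Type := Var → Option Span

/-- `μ` is a `(V, s)`-tuple: a function with domain `V` whose values are spans of `s`. -/
def IsTuple (V : Finset Var) (s : List Letter) (μ : Assignment) : Prop :=
  (∀ x ∈ V, ∃ sp : Span, μ x = some sp ∧ sp.IsSpanOf s) ∧ ∀ x, x ∉ V → μ x = none

/-- The restriction of `μ` to `Y`. -/
def Assignment.restrict (μ : Assignment) (Y : Finset Var) : Assignment :=
  fun x => if x ∈ Y then μ x else none

/-- A spanner: a finite set `vars` of variables and a map from strings `s` to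
`(vars, s)`-relations. -/
structure Spanner where
  vars : Finset Var
  rel : List Letter → Set Assignment
  isTuple : ∀ s, ∀ μ ∈ rel s, IsTuple vars s μ

/-- Projection `π_Y P`, for `Y ⊆ P.vars`. -/
def Spanner.proj (P : Spanner) (Y : Finset Var) (hY : Y ⊆ P.vars) : Spanner where
  vars := Y
  rel s := {μ | ∃ ν ∈ P.rel s, μ = ν.restrict Y}
  isTuple := by
    rintro s μ ⟨ν, hν, rfl⟩
    obtain ⟨h1, -⟩ := P.isTuple s ν hν
    refine ⟨fun x hx => ?_, fun x hx => ?_⟩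
    · obtain ⟨sp, h, h'⟩ := h1 x (hY hx)
      exact ⟨sp, by simp [Assignment.restrict, hx, h], h'⟩
    · simp [Assignment.restrict, hx]

/-- Natural join. -/
def Spanner.join (P Q : Spanner) : Spanner where
  vars := P.vars ∪ Q.vars
  rel s := {μ | IsTuple (P.vars ∪ Q.vars) s μ ∧
    μ.restrict P.vars ∈ P.rel s ∧ μ.restrict Q.vars ∈ Q.rel s}
  isTuple := fun _ _ h => h.1

/-- The spanner without variables that is true on every string; it is neutral for the join. -/
def Spanner.unit : Spanner where
  vars := ∅
  rel _ := {fun _ => none}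
  isTuple := by
    rintro s μ rfl
    simp [IsTuple]

/-- Union of a list of spanners that all have the variable set `V`. -/
def Spanner.union (V : Finset Var) (l : List Spanner) (h : ∀ P ∈ l, P.vars = V) : Spanner where
  vars := V
  rel s := {μ | ∃ P ∈ l, μ ∈ P.rel s}
  isTuple := by
    rintro s μ ⟨P, hP, hμ⟩
    exact h P hP ▸ P.isTuple s μ hμ

/-! ### Ref-words -/

/-- Symbols of ref-words: a letter, `x⊢` (open `x`) or `⊣x` (close `x`). -/
inductive RefSym where
  | letter (a : Letter)
  | opn (x : Var)
  | cls (x : Var)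
  deriving DecidableEq

/-- The morphism erasing the variable operations. -/
def clean (r : List RefSym) : List Letter :=
  r.filterMap fun
    | RefSym.letter a => some a
    | RefSym.opn _ => none
    | RefSym.cls _ => none

/-- `r` is valid for `V`: each `x ∈ V` is opened exactly once, closed exactly once, and opened
before it is closed. -/
def ValidRef (V : Finset Var) (r : List RefSym) : Prop :=
  ∀ x ∈ V, r.count (RefSym.opn x) = 1 ∧ r.count (RefSym.cls x) = 1 ∧
    ∃ r₁ r₂ r₃ : List RefSym, r = r₁ ++ [RefSym.opn x] ++ r₂ ++ [RefSym.cls x] ++ r₃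

/-- `r` factors as `r₁ · x⊢ · r₂ · ⊣x · r₃`, and `sp` is the span that this factorization gives
to `x`. -/
def Marks (r : List RefSym) (x : Var) (sp : Span) : Prop :=
  ∃ r₁ r₂ r₃ : List RefSym, r = r₁ ++ [RefSym.opn x] ++ r₂ ++ [RefSym.cls x] ++ r₃ ∧
    sp.lo = (clean r₁).length + 1 ∧ sp.hi = sp.lo + (clean r₂).length

/-- `μ` is the tuple `μ^r` with domain `V` (for `r` valid for `V` there is exactly one). -/
def IsTupleOfRef (V : Finset Var) (r : List RefSym) (μ : Assignment) : Prop :=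
  (∀ x ∈ V, ∃ sp : Span, μ x = some sp ∧ Marks r x sp) ∧ ∀ x, x ∉ V → μ x = none

/-! ### Regex formulas -/

inductive RegexFormula where
  | empty
  | eps
  | letter (a : Letter)
  | alt (α β : RegexFormula)
  | cat (α β : RegexFormula)
  | star (α : RegexFormula)
  | bind (x : Var) (α : RegexFormula)

namespace RegexFormula

/-- The variables that occur in a regex formula. -/
def vars : RegexFormula → Finset Var
  | empty => ∅
  | eps => ∅
  | letter _ => ∅
  | alt α β => α.vars ∪ β.vars
  | cat α β => α.vars ∪ β.vars
  | star α => α.vars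
  | bind x α => insert x α.vars

/-- The ref-word language `R(α)`. -/
def refLang : RegexFormula → Language RefSym
  | empty => 0
  | eps => 1
  | letter a => {[RefSym.letter a]}
  | alt α β => α.refLang + β.refLang
  | cat α β => α.refLang * β.refLang
  | star α => KStar.kstar α.refLang
  | bind x α => {[RefSym.opn x]} * α.refLang * {[RefSym.cls x]}

/-- Every ref-word of `R(α)` is valid. -/
def Functional (α : RegexFormula) : Prop :=
  ∀ r ∈ α.refLang, ValidRef α.vars r

/-- The spanner `⟦α⟧`. -/
def spanner (α : RegexFormula) : Spanner where
  vars := α.vars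
  rel s := {μ | ∃ r ∈ α.refLang, ValidRef α.vars r ∧ clean r = s ∧ IsTupleOfRef α.vars r μ}
  isTuple := by
    rintro s μ ⟨r, -, -, rfl, h, h'⟩
    refine ⟨fun x hx => ?_, h'⟩
    obtain ⟨sp, hsp, r₁, r₂, r₃, rfl, h1, h2⟩ := h x hx
    refine ⟨sp, hsp, by omega, by omega, ?_⟩
    simp only [clean, List.filterMap_append, List.length_append] at *
    omega

end RegexFormula

/-! ### Regex CQs and UCQs -/

/-- A regex CQ `π_Y (α₁ ⋈ ⋯ ⋈ αₘ)`, `m ≥ 1`, with functional regex formulas `αᵢ`. -/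
structure RegexCQ where
  head : Finset Var
  atoms : List RegexFormula
  atoms_ne : atoms ≠ []
  functional : ∀ α ∈ atoms, α.Functional
  head_subset : head ⊆ ((atoms.map RegexFormula.spanner).foldr Spanner.join Spanner.unit).vars

def RegexCQ.spanner (q : RegexCQ) : Spanner :=
  ((q.atoms.map RegexFormula.spanner).foldr Spanner.join Spanner.unit).proj q.head q.head_subset

/-- A regex UCQ `q₁ ∪ ⋯ ∪ qₗ`, `l ≥ 1`, where all `qᵢ` have the same variables. -/
structure RegexUCQ where
  vars : Finset Var
  disjuncts : List RegexCQ
  disjuncts_ne : disjuncts ≠ []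
  same_vars : ∀ q ∈ disjuncts, q.head = vars

def RegexUCQ.spanner (q : RegexUCQ) : Spanner :=
  Spanner.union q.vars (q.disjuncts.map RegexCQ.spanner) (by
    intro P hP
    obtain ⟨c, hc, rfl⟩ := List.mem_map.1 hP
    exact q.same_vars c hc)

/-- A regex `k`-UCQ: every disjunct has at most `k` atoms. -/
def RegexUCQ.IsKUCQ (k : ℕ) (q : RegexUCQ) : Prop :=
  ∀ c ∈ q.disjuncts, c.atoms.length ≤ k

/-! ### Encoding of inputs and answers as sequences of words -/

/-- A regex formula in postfix notation. -/
def RegexFormula.code : RegexFormula → List ℕ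
  | .empty => [0]
  | .eps => [1]
  | .letter a => [2, a]
  | .alt α β => α.code ++ β.code ++ [3]
  | .cat α β => α.code ++ β.code ++ [4]
  | .star α => α.code ++ [5]
  | .bind x α => α.code ++ [6, x]

/-- A list of words, preceded by its length. -/
def sized (l : List ℕ) : List ℕ := l.length :: l

def RegexCQ.code (q : RegexCQ) : List ℕ :=
  sized (q.head.sort (· ≤ ·)) ++ [q.atoms.length] ++ q.atoms.flatMap fun α => sized α.code

def RegexUCQ.code (q : RegexUCQ) : List ℕ :=
  [q.disjuncts.length] ++ q.disjuncts.flatMap RegexCQ.code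

/-- A tuple with domain `V`, as the list of the `x, i, j` with `μ(x) = [i, j⟩`, for `x ∈ V` in
increasing order. -/
def tupleCode (V : Finset Var) (μ : Assignment) : List ℕ :=
  (V.sort (· ≤ ·)).flatMap fun x => (μ x).elim [] fun sp => [x, sp.lo, sp.hi]

/-! ### The machine model: a unit-cost random access machine

A program is a fixed structured program over registers and an indirectly addressed memory, both of
which hold natural numbers that are smaller than the word bound `W`. -/

inductive BinOp where
  | add
  | sub
  | mul
  | div
  | mod
  | eq
  | lt

/-- Subtraction is truncated, division by `0` yields `0`, comparisons yield `1` or `0`. -/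
def BinOp.eval : BinOp → ℕ → ℕ → ℕ
  | add, a, b => a + b
  | sub, a, b => a - b
  | mul, a, b => a * b
  | div, a, b => a / b
  | mod, a, b => a % b
  | eq, a, b => if a = b then 1 else 0
  | lt, a, b => if a < b then 1 else 0

inductive Expr where
  | const (n : ℕ)
  | reg (i : ℕ)
  | load (addr : Expr)
  | op (o : BinOp) (e₁ e₂ : Expr)

structure State where
  reg : ℕ → ℕ
  mem : ℕ → ℕ

def Expr.eval (σ : State) : Expr → ℕ
  | const n => n
  | reg i => σ.reg i
  | load a => σ.mem (a.eval σ)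
  | op o e₁ e₂ => o.eval (e₁.eval σ) (e₂.eval σ)

/-- The number of elementary operations in an expression: the cost of evaluating it. -/
def Expr.cost : Expr → ℕ
  | const _ => 1
  | reg _ => 1
  | load a => a.cost + 1
  | op _ e₁ e₂ => e₁.cost + e₂.cost + 1

inductive Program where
  | skip
  | assign (i : ℕ) (e : Expr)
  | store (addr e : Expr)
  | seq (c₁ c₂ : Program)
  | ite (e : Expr) (c₁ c₂ : Program)
  | loop (e : Expr) (c : Program)
  | print (e : Expr)
  | endAnswer

/-- What can be observed during one unit of time: an internal step, the output of a word, or the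
output of the mark that completes an answer. -/
inductive Event where
  | tick
  | word (v : ℕ)
  | endAnswer

def ticks (n : ℕ) : List Event := List.replicate n Event.tick

/-- `Exec W c σ t σ'`: with word bound `W`, the program `c` started in `σ` halts in `σ'`, producing
the sequence `t` of events (whose length is the running time).  A program that exceeds the word
bound has no execution. -/
inductive Exec (W : ℕ) : Program → State → List Event → State → Prop
  | skip (σ : State) : Exec W .skip σ (ticks 1) σ
  | assign (i : ℕ) (e : Expr) (σ : State) (h : e.eval σ < W) :
      Exec W (.assign i e) σ (ticks (e.cost + 1))
        ⟨Function.update σ.reg i (e.eval σ), σ.mem⟩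
  | store (a e : Expr) (σ : State) (ha : a.eval σ < W) (h : e.eval σ < W) :
      Exec W (.store a e) σ (ticks (a.cost + e.cost + 1))
        ⟨σ.reg, Function.update σ.mem (a.eval σ) (e.eval σ)⟩
  | seq (c₁ c₂ : Program) (σ₁ σ₂ σ₃ : State) (t₁ t₂ : List Event)
      (h₁ : Exec W c₁ σ₁ t₁ σ₂) (h₂ : Exec W c₂ σ₂ t₂ σ₃) :
      Exec W (.seq c₁ c₂) σ₁ (t₁ ++ t₂) σ₃
  | iteTrue (e : Expr) (c₁ c₂ : Program) (σ σ' : State) (t : List Event)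
      (he : e.eval σ ≠ 0) (h : Exec W c₁ σ t σ') :
      Exec W (.ite e c₁ c₂) σ (ticks (e.cost + 1) ++ t) σ'
  | iteFalse (e : Expr) (c₁ c₂ : Program) (σ σ' : State) (t : List Event)
      (he : e.eval σ = 0) (h : Exec W c₂ σ t σ') :
      Exec W (.ite e c₁ c₂) σ (ticks (e.cost + 1) ++ t) σ'
  | loopTrue (e : Expr) (c : Program) (σ₁ σ₂ σ₃ : State) (t₁ t₂ : List Event)
      (he : e.eval σ₁ ≠ 0) (h₁ : Exec W c σ₁ t₁ σ₂) (h₂ : Exec W (.loop e c) σ₂ t₂ σ₃) :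
      Exec W (.loop e c) σ₁ (ticks (e.cost + 1) ++ t₁ ++ t₂) σ₃
  | loopFalse (e : Expr) (c : Program) (σ : State) (he : e.eval σ = 0) :
      Exec W (.loop e c) σ (ticks (e.cost + 1)) σ
  | print (e : Expr) (σ : State) (h : e.eval σ < W) :
      Exec W (.print e) σ (ticks (e.cost + 1) ++ [Event.word (e.eval σ)]) σ
  | endAnswer (σ : State) : Exec W .endAnswer σ [Event.endAnswer] σ

/-- The input stands in the first memory cells, its length in register `0`; everything else
is `0`. -/
def initialState (w : List ℕ) : State where
  reg i := if i = 0 then w.length else 0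
  mem i := w.getD i 0

/-- The words that are output during a sequence of events. -/
def printed (t : List Event) : List ℕ :=
  t.filterMap fun
    | Event.word v => some v
    | Event.tick => none
    | Event.endAnswer => none

/-- The events `t` output exactly the answers `out`, in this order, and at most `D` units of time
pass before the first answer is complete, between any two consecutive answers, and from the last
answer to the end. -/
def OutputsWithDelay (D : ℕ) (t : List Event) (out : List (List ℕ)) : Prop :=
  ∃ (segs : List (List Event)) (last : List Event),
    t = (segs.map fun u => u ++ [Event.endAnswer]).flatten ++ last ∧
    segs.map printed = out ∧ printed last = [] ∧
    (∀ u ∈ segs, Event.endAnswer ∉ u ∧ u.length + 1 ≤ D) ∧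
    Event.endAnswer ∉ last ∧ last.length ≤ D

/-! ### Enumeration problems and polynomial delay -/

structure EnumProblem where
  Input : Type
  Answer : Type
  answers : Input → Set Answer
  inputCode : Input → List ℕ
  answerCode : Input → Answer → List ℕ

/-- One program and one polynomial `p` such that, on each input `x`, the program halts, has output
each answer for `x` exactly once and nothing else, and has delay at most `p(|x|)`.  Here `|x|` is
the number of words of the input; machine words are logarithmic, that is, their values are bounded
by `p` at `|x|` plus the largest number in the input. -/
def EnumProblem.HasPolynomialDelay (E : EnumProblem) : Prop :=
  ∃ (c : Program) (p : Polynomial ℕ), ∀ x : E.Input,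
    ∃ (t : List Event) (σ : State) (out : List E.Answer),
      Exec (p.eval ((E.inputCode x).length + (E.inputCode x).foldr max 0)) c
        (initialState (E.inputCode x)) t σ ∧
      out.Nodup ∧ (∀ a, a ∈ out ↔ a ∈ E.answers x) ∧
      OutputsWithDelay (p.eval (E.inputCode x).length) t (out.map (E.answerCode x))

/-- Evaluation of regex `k`-UCQs: given `q` and `s`, enumerate `⟦q⟧(s)`. -/
def kUCQEvaluation (k : ℕ) : EnumProblem where
  Input := {q : RegexUCQ // q.IsKUCQ k} × List Letter
  Answer := Assignment
  answers x := x.1.1.spanner.rel x.2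
  inputCode x := x.1.1.code ++ sized x.2
  answerCode x := tupleCode x.1.1.vars

end DocSpanners

/-! ### Compiling bounded first-order formulas to programs. -/

namespace DocSpanners

/-! An answer amounts to a list of `2 * |Y|` digits, namely the ends of the spans of the head
variables, decreased by one. Suppose that for every list of digits it can be decided in polynomial
time whether some answer extends it. Then a depth-first search over the prefixes that pass this test
never enters a subtree without answers. Between two consecutive answers it climbs and descends at
most `2 * |Y|` levels, with polynomially many tests at each, so the delay is polynomial
(`mem_search`, `iterates_search`).

The test rests on functionality. Each atom becomes an automaton with linearly many states, whose
accepting paths spell exactly its ref-words (`path_iff`). Let a state lie on an accepting run. Every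
path into this state is completed by the rest of the run to a ref-word of the atom, which is valid
and so contains each variable operation exactly once. Hence the state alone, and not the path,
determines which variables have been opened or closed (`statusOf_of_isRunOf`). As a span is
determined by the positions at which its variable is already open or already closed, joining the
atoms means choosing runs whose states agree, at every position, on the status of shared variables;
prescribed digits are conditions on the status, too (`RegexCQ.exists_answer_iff`). These conditions
are local to a tuple of at most `k` states. For fixed `k` there are only polynomially many such
tuples, and dynamic programming along the string decides the test (`DisjunctAt.runAt_iff`,
`InputAt.extendable_iff`).

On the machine, the test is obtained from logic. Parsing, the edges of the automata, reachability
and the dynamic program are ten relations. Each is defined by a first-order formula, with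
quantifiers below a polynomial bound `B`, from earlier relations and by recursion on its first
argument. A formula compiles to nested loops that run in polynomial time (`Fm.runs_prog`), and the
relations are stored as tables, one after the other (`runs_fill`, `runs_decide`). It remains to see
that each formula is right, and in particular that all witnesses it needs lie below `B`
(`tableF_defines`). -/

/-! ### Polynomially bounded functions -/

/-- `f` is bounded by a polynomial. -/
def PolyBd (f : ℕ → ℕ) : Prop := ∃ p : Polynomial ℕ, ∀ n, f n ≤ p.eval n

theorem eval_polynomial_mono (p : Polynomial ℕ) : Monotone fun n => p.eval n := by
  intro a b h
  simp only [Polynomial.eval_eq_sum, Polynomial.sum]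
  gcongr

theorem PolyBd.const (c : ℕ) : PolyBd fun _ => c := ⟨Polynomial.C c, by simp⟩

theorem PolyBd.id : PolyBd fun n => n := ⟨Polynomial.X, by simp⟩

theorem PolyBd.add {f g : ℕ → ℕ} (hf : PolyBd f) (hg : PolyBd g) : PolyBd fun n => f n + g n := by
  obtain ⟨p, hp⟩ := hf
  obtain ⟨q, hq⟩ := hg
  exact ⟨p + q, fun n => by simpa using add_le_add (hp n) (hq n)⟩

theorem PolyBd.mul {f g : ℕ → ℕ} (hf : PolyBd f) (hg : PolyBd g) : PolyBd fun n => f n * g n := by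
  obtain ⟨p, hp⟩ := hf
  obtain ⟨q, hq⟩ := hg
  exact ⟨p * q, fun n => by simpa using mul_le_mul' (hp n) (hq n)⟩

theorem PolyBd.pow {f : ℕ → ℕ} (hf : PolyBd f) (k : ℕ) : PolyBd fun n => f n ^ k := by
  induction k with
  | zero => simpa using PolyBd.const 1
  | succ k ih => simpa [pow_succ] using ih.mul hf

theorem PolyBd.comp {f g : ℕ → ℕ} (hf : PolyBd f) (hg : PolyBd g) : PolyBd fun n => f (g n) := by
  obtain ⟨p, hp⟩ := hf
  obtain ⟨q, hq⟩ := hg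
  refine ⟨p.comp q, fun n => ?_⟩
  rw [Polynomial.eval_comp]
  exact (hp _).trans (eval_polynomial_mono p (hq n))

/-! ### Silent executions -/

/-- No output occurs in `t`. -/
def Quiet (t : List Event) : Prop := ∀ e ∈ t, e = Event.tick

theorem quiet_ticks (n : ℕ) : Quiet (ticks n) := fun _ he => List.eq_of_mem_replicate he

theorem Quiet.append {t u : List Event} (ht : Quiet t) (hu : Quiet u) : Quiet (t ++ u) := by
  intro e he
  rcases List.mem_append.1 he with h | h
  exacts [ht e h, hu e h]

theorem length_ticks (n : ℕ) : (ticks n).length = n := by simp [ticks]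

/-- Started in `σ`, the program `c` halts in `σ'` within time `T` and without output. -/
def Runs (W : ℕ) (c : Program) (σ : State) (T : ℕ) (σ' : State) : Prop :=
  ∃ t, Exec W c σ t σ' ∧ t.length ≤ T ∧ Quiet t

namespace Runs

variable {W : ℕ} {σ σ₁ σ₂ σ₃ σ' : State} {c c₁ c₂ : Program} {e : Expr} {T T₁ T₂ : ℕ}

theorem mono (h : Runs W c σ T₁ σ') (hT : T₁ ≤ T₂) : Runs W c σ T₂ σ' := by
  obtain ⟨t, h1, h2, h3⟩ := h
  exact ⟨t, h1, h2.trans hT, h3⟩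

theorem skip (σ : State) : Runs W .skip σ 1 σ :=
  ⟨_, .skip σ, by simp [ticks], quiet_ticks _⟩

theorem assign (i : ℕ) (e : Expr) (σ : State) (h : e.eval σ < W) :
    Runs W (.assign i e) σ (e.cost + 1) ⟨Function.update σ.reg i (e.eval σ), σ.mem⟩ :=
  ⟨_, .assign i e σ h, by simp [ticks], quiet_ticks _⟩

theorem store (a e : Expr) (σ : State) (ha : a.eval σ < W) (h : e.eval σ < W) :
    Runs W (.store a e) σ (a.cost + e.cost + 1)
      ⟨σ.reg, Function.update σ.mem (a.eval σ) (e.eval σ)⟩ :=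
  ⟨_, .store a e σ ha h, by simp [ticks], quiet_ticks _⟩

theorem seq (h₁ : Runs W c₁ σ₁ T₁ σ₂) (h₂ : Runs W c₂ σ₂ T₂ σ₃) :
    Runs W (.seq c₁ c₂) σ₁ (T₁ + T₂) σ₃ := by
  obtain ⟨t, h1, h2, h3⟩ := h₁
  obtain ⟨u, k1, k2, k3⟩ := h₂
  exact ⟨_, .seq _ _ _ _ _ _ _ h1 k1, by simp; omega, h3.append k3⟩

theorem ite_true (he : e.eval σ ≠ 0) (h : Runs W c₁ σ T σ') :
    Runs W (.ite e c₁ c₂) σ (e.cost + 1 + T) σ' := by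
  obtain ⟨t, h1, h2, h3⟩ := h
  exact ⟨_, .iteTrue _ _ _ _ _ _ he h1, by simp [ticks]; omega, (quiet_ticks _).append h3⟩

theorem ite_false (he : e.eval σ = 0) (h : Runs W c₂ σ T σ') :
    Runs W (.ite e c₁ c₂) σ (e.cost + 1 + T) σ' := by
  obtain ⟨t, h1, h2, h3⟩ := h
  exact ⟨_, .iteFalse _ _ _ _ _ _ he h1, by simp [ticks]; omega, (quiet_ticks _).append h3⟩

theorem loop_false (he : e.eval σ = 0) : Runs W (.loop e c) σ (e.cost + 1) σ :=
  ⟨_, .loopFalse _ _ _ he, by simp [ticks], quiet_ticks _⟩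

theorem loop_true (he : e.eval σ₁ ≠ 0) (h₁ : Runs W c σ₁ T₁ σ₂)
    (h₂ : Runs W (.loop e c) σ₂ T₂ σ₃) :
    Runs W (.loop e c) σ₁ (e.cost + 1 + T₁ + T₂) σ₃ := by
  obtain ⟨t, h1, h2, h3⟩ := h₁
  obtain ⟨u, k1, k2, k3⟩ := h₂
  exact ⟨_, .loopTrue _ _ _ _ _ _ _ he h1 k1, by simp [ticks]; omega,
    ((quiet_ticks _).append h3).append k3⟩

/-- The rule for loops, with an invariant that bounds the number of remaining iterations. -/
theorem loop (Inv : ℕ → State → Prop)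
    (step : ∀ m σ, Inv m σ → e.eval σ ≠ 0 →
      ∃ σ' m', m' < m ∧ Inv m' σ' ∧ Runs W c σ T σ') :
    ∀ m σ, Inv m σ → ∃ σ' m', m' ≤ m ∧ Inv m' σ' ∧ e.eval σ' = 0 ∧
      Runs W (.loop e c) σ ((m + 1) * (e.cost + 1 + T)) σ' := by
  intro m
  induction m using Nat.strong_induction_on with
  | _ m ih =>
    intro σ hσ
    by_cases he : e.eval σ = 0
    · exact ⟨σ, m, le_rfl, hσ, he, (loop_false he).mono (by nlinarith)⟩
    · obtain ⟨σ₂, m₂, hm, h2, hr⟩ := step m σ hσ he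
      obtain ⟨σ₃, m₃, hm', h3, h0, hr'⟩ := ih m₂ hm σ₂ h2
      refine ⟨σ₃, m₃, by omega, h3, h0, (loop_true he hr hr').mono ?_⟩
      have : (m₂ + 1 + 1) * (e.cost + 1 + T) ≤ (m + 1) * (e.cost + 1 + T) :=
        Nat.mul_le_mul_right _ (by omega)
      nlinarith

end Runs

/-! ### First-order formulas over the input and over tables

Registers `0`, `1`, `2` hold the length of the input, the bound for quantifiers and the truth value
that was computed last.  A formula at level `ℓ` reads registers below `ℓ`; its quantifiers bind the
registers from `ℓ` on. -/

inductive Tm where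
  | var (i : ℕ)
  | const (c : ℕ)
  | inp (t : Tm)
  | op (o : BinOp) (t₁ t₂ : Tm)

namespace Tm

def eval (w ρ : ℕ → ℕ) : Tm → ℕ
  | var i => ρ i
  | const c => c
  | inp t => w (t.eval w ρ)
  | op o t₁ t₂ => o.eval (t₁.eval w ρ) (t₂.eval w ρ)

/-- The term reads only registers below `ℓ`, and not the truth value. -/
def Wf (ℓ : ℕ) : Tm → Prop
  | var i => i < ℓ ∧ i ≠ 2
  | const _ => True
  | inp t => t.Wf ℓ
  | op _ t₁ t₂ => t₁.Wf ℓ ∧ t₂.Wf ℓ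

/-- Loads of addresses beyond the quantifier bound are redirected to address `0`. -/
def expr : Tm → Expr
  | var i => .reg i
  | const c => .const c
  | inp t => .load (.op .mul t.expr (.op .lt t.expr (.reg 1)))
  | op o t₁ t₂ => .op o t₁.expr t₂.expr

end Tm

/-- The input as seen by terms. -/
def inputOf (B : ℕ) (mem : ℕ → ℕ) (t : ℕ) : ℕ := mem (t * if t < B then 1 else 0)

/-- The address of the entry `xs` of the table `j`. -/
def tabAddr (B j : ℕ) : List ℕ → ℕ
  | [] => j + 1
  | x :: xs => x + B * tabAddr B j xs

/-- The tables as seen by formulas. -/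
def tabOf (B : ℕ) (mem : ℕ → ℕ) (j : ℕ) (xs : List ℕ) : Prop := mem (tabAddr B j xs) ≠ 0

inductive Fm where
  | tm (t : Tm)
  | tab (j : ℕ) (ts : List Tm)
  | not (φ : Fm)
  | and (φ ψ : Fm)
  | ex (φ : Fm)

/-- Registers below `ℓ` are equal, except for the truth value. -/
def Agree (ℓ : ℕ) (ρ ρ' : ℕ → ℕ) : Prop := ∀ r < ℓ, r ≠ 2 → ρ r = ρ' r

theorem Agree.refl (ℓ : ℕ) (ρ : ℕ → ℕ) : Agree ℓ ρ ρ := fun _ _ _ => rfl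

theorem Agree.symm {ℓ : ℕ} {ρ ρ' : ℕ → ℕ} (h : Agree ℓ ρ ρ') : Agree ℓ ρ' ρ :=
  fun r h1 h2 => (h r h1 h2).symm

theorem Agree.trans {ℓ : ℕ} {ρ ρ' ρ'' : ℕ → ℕ} (h : Agree ℓ ρ ρ') (h' : Agree ℓ ρ' ρ'') :
    Agree ℓ ρ ρ'' := fun r h1 h2 => (h r h1 h2).trans (h' r h1 h2)

theorem Agree.mono {ℓ ℓ' : ℕ} {ρ ρ' : ℕ → ℕ} (h : Agree ℓ ρ ρ') (hl : ℓ' ≤ ℓ) : Agree ℓ' ρ ρ' :=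
  fun r h1 h2 => h r (h1.trans_le hl) h2

theorem Agree.update {ℓ i : ℕ} (ρ : ℕ → ℕ) (v : ℕ) (hi : ℓ ≤ i ∨ i = 2) :
    Agree ℓ (Function.update ρ i v) ρ := by
  intro r h1 h2
  rw [Function.update_of_ne]
  omega

theorem Agree.update_succ {ℓ : ℕ} {ρ ρ' : ℕ → ℕ} (h : Agree ℓ ρ ρ') (v : ℕ) :
    Agree (ℓ + 1) (Function.update ρ ℓ v) (Function.update ρ' ℓ v) := by
  intro r h1 h2
  by_cases hr : r = ℓ
  · subst hr; simp
  · rw [Function.update_of_ne hr, Function.update_of_ne hr]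
    exact h r (by omega) h2

theorem Tm.eval_congr {ℓ : ℕ} {w ρ ρ' : ℕ → ℕ} (h : Agree ℓ ρ ρ') :
    ∀ t : Tm, t.Wf ℓ → t.eval w ρ = t.eval w ρ'
  | .var _, ht => h _ ht.1 ht.2
  | .const _, _ => rfl
  | .inp t, ht => congrArg w (Tm.eval_congr h t ht)
  | .op o t₁ t₂, ht => congrArg₂ o.eval (Tm.eval_congr h t₁ ht.1) (Tm.eval_congr h t₂ ht.2)

theorem Tm.eval_expr {B : ℕ} {σ : State} (hB : σ.reg 1 = B) :
    ∀ t : Tm, t.expr.eval σ = t.eval (inputOf B σ.mem) σ.reg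
  | .var _ => rfl
  | .const _ => rfl
  | .inp t => by
    simp [expr, Expr.eval, Tm.eval, inputOf, BinOp.eval, Tm.eval_expr hB t, hB]
  | .op o t₁ t₂ => congrArg₂ o.eval (Tm.eval_expr hB t₁) (Tm.eval_expr hB t₂)

namespace Fm

/-- A table atom with an argument beyond the bound is false by decree: addresses are expansions in
base `B`, which identify entries only for digits below `B`. -/
def Sat (B : ℕ) (w : ℕ → ℕ) (I : ℕ → List ℕ → Prop) : ℕ → Fm → (ℕ → ℕ) → Prop
  | _, tm t, ρ => t.eval w ρ ≠ 0
  | _, tab j ts, ρ => (∀ x ∈ ts.map (·.eval w ρ), x < B) ∧ I j (ts.map (·.eval w ρ))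
  | ℓ, not φ, ρ => ¬ Sat B w I ℓ φ ρ
  | ℓ, and φ ψ, ρ => Sat B w I ℓ φ ρ ∧ Sat B w I ℓ ψ ρ
  | ℓ, ex φ, ρ => ∃ v < B, Sat B w I (ℓ + 1) φ (Function.update ρ ℓ v)

def Wf : ℕ → Fm → Prop
  | ℓ, tm t => t.Wf ℓ
  | ℓ, tab _ ts => ∀ t ∈ ts, t.Wf ℓ
  | ℓ, not φ => Wf ℓ φ
  | ℓ, and φ ψ => Wf ℓ φ ∧ Wf ℓ ψ
  | ℓ, ex φ => Wf (ℓ + 1) φ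

def addrExpr (j : ℕ) : List Expr → Expr
  | [] => .const (j + 1)
  | x :: xs => .op .add x (.op .mul (.reg 1) (addrExpr j xs))

/-- The guard enters as a factor and not as a branch, so that an atom is a single expression. The
load under a failed guard does no harm, since memory is total and the word bound applies only to the
value that is finally assigned. -/
def guardExpr : List Expr → Expr
  | [] => .const 1
  | x :: xs => .op .mul (.op .lt x (.reg 1)) (guardExpr xs)

/-- The program that evaluates a formula into register `2`. -/
def prog : ℕ → Fm → Program
  | _, tm t => .assign 2 (.op .lt (.const 0) t.expr)
  | _, tab j ts => .assign 2 (.op .lt (.const 0)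
      (.op .mul (guardExpr (ts.map Tm.expr)) (.load (addrExpr j (ts.map Tm.expr)))))
  | ℓ, not φ => .seq (prog ℓ φ) (.assign 2 (.op .eq (.reg 2) (.const 0)))
  | ℓ, and φ ψ => .seq (prog ℓ φ) (.ite (.reg 2) (prog ℓ ψ) .skip)
  | ℓ, ex φ => .seq (.assign ℓ (.const 0)) (.seq (.assign 2 (.const 0))
      (.loop (.op .mul (.op .lt (.reg ℓ) (.reg 1)) (.op .eq (.reg 2) (.const 0)))
        (.seq (prog (ℓ + 1) φ) (.assign ℓ (.op .add (.reg ℓ) (.const 1))))))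

theorem sat_congr {B : ℕ} {w : ℕ → ℕ} {I : ℕ → List ℕ → Prop} :
    ∀ (φ : Fm) {ℓ : ℕ} {ρ ρ' : ℕ → ℕ}, φ.Wf ℓ → Agree ℓ ρ ρ' →
      (Sat B w I ℓ φ ρ ↔ Sat B w I ℓ φ ρ')
  | tm t, ℓ, ρ, ρ', hw, h => by simp only [Sat, Tm.eval_congr h t hw]
  | tab j ts, ℓ, ρ, ρ', hw, h => by
    have : ts.map (·.eval w ρ) = ts.map (·.eval w ρ') :=
      List.map_congr_left fun t ht => Tm.eval_congr h t (hw t ht)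
    simp only [Sat, this]
  | not φ, ℓ, ρ, ρ', hw, h => not_congr (sat_congr φ hw h)
  | and φ ψ, ℓ, ρ, ρ', hw, h => and_congr (sat_congr φ hw.1 h) (sat_congr ψ hw.2 h)
  | ex φ, ℓ, ρ, ρ', hw, h => by
    simp only [Sat]
    exact exists_congr fun v => and_congr_right fun _ => sat_congr φ hw (h.update_succ v)

theorem addrExpr_eval {B : ℕ} {σ : State} (hB : σ.reg 1 = B) (j : ℕ) :
    ∀ es : List Expr, (addrExpr j es).eval σ = tabAddr B j (es.map (·.eval σ))
  | [] => rfl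
  | x :: xs => by simp [addrExpr, Expr.eval, BinOp.eval, tabAddr, hB, addrExpr_eval hB j xs]

theorem guardExpr_eval {B : ℕ} {σ : State} (hB : σ.reg 1 = B) :
    ∀ es : List Expr, (guardExpr es).eval σ ≠ 0 ↔ ∀ x ∈ es.map (·.eval σ), x < B
  | [] => by simp [guardExpr, Expr.eval]
  | x :: xs => by
    have := guardExpr_eval hB xs
    simp only [guardExpr, Expr.eval, BinOp.eval, hB, List.map_cons, List.forall_mem_cons, ← this]
    simp

theorem map_expr_eval {B : ℕ} {σ : State} (hB : σ.reg 1 = B) (ts : List Tm) :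
    (ts.map Tm.expr).map (·.eval σ) = ts.map (·.eval (inputOf B σ.mem) σ.reg) := by
  simp [Tm.eval_expr hB]

/-- The register `2` of `σ` tells whether `P` holds. -/
def _root_.DocSpanners.Flag (σ : State) (P : Prop) : Prop :=
  (σ.reg 2 = 1 ∧ P) ∨ (σ.reg 2 = 0 ∧ ¬ P)

theorem _root_.DocSpanners.Flag.congr {σ : State} {P Q : Prop} (h : Flag σ P) (hPQ : P ↔ Q) :
    Flag σ Q := by
  unfold Flag at *
  rwa [← hPQ]

theorem runs_flag_assign {W : ℕ} {σ : State} {e : Expr} {ℓ : ℕ} (hW : 1 < W) :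
    ∃ σ', Runs W (.assign 2 (.op .lt (.const 0) e)) σ (e.cost + 3) σ' ∧ Agree ℓ σ'.reg σ.reg ∧
      σ'.mem = σ.mem ∧ Flag σ' (e.eval σ ≠ 0) := by
  have key : (Expr.op .lt (.const 0) e).eval σ = if 0 < e.eval σ then 1 else 0 := rfl
  refine ⟨_, (Runs.assign _ _ _ ?_).mono (by simp [Expr.cost]; omega), Agree.update _ _ (.inr rfl),
    rfl, ?_⟩
  · rw [key]; split <;> omega
  · unfold Flag
    simp only [key, Function.update_self]
    split <;> omega

/-- Formulas are evaluated in polynomial time. -/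
theorem runs_prog : ∀ (φ : Fm) (ℓ : ℕ), φ.Wf ℓ → 2 < ℓ →
    ∃ T : ℕ → ℕ, PolyBd T ∧ ∀ (B W : ℕ) (σ : State), σ.reg 1 = B → B < W → 1 < W →
      ∃ σ', Runs W (φ.prog ℓ) σ (T B) σ' ∧ Agree ℓ σ'.reg σ.reg ∧ σ'.mem = σ.mem ∧
        Flag σ' (φ.Sat B (inputOf B σ.mem) (tabOf B σ.mem) ℓ σ.reg)
  | tm t, ℓ, hw, hl => by
    refine ⟨fun _ => t.expr.cost + 3, .const _, fun B W σ hB hBW hW => ?_⟩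
    obtain ⟨σ', h1, h2, h3, h4⟩ := runs_flag_assign (σ := σ) (e := t.expr) (ℓ := ℓ) hW
    exact ⟨σ', h1, h2, h3, h4.congr (by rw [Tm.eval_expr hB]; rfl)⟩
  | tab j ts, ℓ, hw, hl => by
    refine ⟨fun _ => (Expr.op .mul (guardExpr (ts.map Tm.expr))
      (.load (addrExpr j (ts.map Tm.expr)))).cost + 3, .const _, fun B W σ hB hBW hW => ?_⟩
    obtain ⟨σ', h1, h2, h3, h4⟩ := runs_flag_assign (σ := σ)
      (e := .op .mul (guardExpr (ts.map Tm.expr)) (.load (addrExpr j (ts.map Tm.expr))))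
      (ℓ := ℓ) hW
    refine ⟨σ', h1, h2, h3, h4.congr ?_⟩
    have hg := guardExpr_eval hB (ts.map Tm.expr)
    have ha := addrExpr_eval hB j (ts.map Tm.expr)
    rw [map_expr_eval hB] at hg ha
    simp only [Sat, tabOf, ← hg, ← ha, Expr.eval, BinOp.eval]
    exact mul_ne_zero_iff
  | not φ, ℓ, hw, hl => by
    obtain ⟨T, hT, h⟩ := runs_prog φ ℓ hw hl
    refine ⟨fun B => T B + 4, hT.add (.const 4), fun B W σ hB hBW hW => ?_⟩
    obtain ⟨σ', h1, h2, h3, h4⟩ := h B W σ hB hBW hW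
    have key : (Expr.op .eq (.reg 2) (.const 0)).eval σ' = if σ'.reg 2 = 0 then 1 else 0 := rfl
    refine ⟨_, h1.seq (Runs.assign _ _ _ ?_), (Agree.update _ _ (.inr rfl)).trans h2, h3, ?_⟩
    · rw [key]; split <;> omega
    · unfold Flag at *
      simp only [key, Function.update_self, Sat]
      rcases h4 with ⟨h, h'⟩ | ⟨h, h'⟩ <;> simp [h, h']
  | and φ ψ, ℓ, hw, hl => by
    obtain ⟨T, hT, h⟩ := runs_prog φ ℓ hw.1 hl
    obtain ⟨T', hT', h'⟩ := runs_prog ψ ℓ hw.2 hl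
    refine ⟨fun B => T B + (2 + (T' B + 1)), hT.add ((PolyBd.const 2).add (hT'.add (.const 1))),
      fun B W σ hB hBW hW => ?_⟩
    obtain ⟨σ', h1, h2, h3, h4⟩ := h B W σ hB hBW hW
    rcases h4 with ⟨hf, hs⟩ | ⟨hf, hs⟩
    · obtain ⟨σ'', k1, k2, k3, k4⟩ := h' B W σ' ((h2 1 (by omega) (by omega)).trans hB) hBW hW
      refine ⟨σ'', h1.seq ((k1.ite_true (by simp [Expr.eval, hf])).mono (by simp [Expr.cost])),
        k2.trans h2, k3.trans h3, k4.congr ?_⟩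
      rw [h3, sat_congr ψ hw.2 h2]
      simp [Sat, hs]
    · refine ⟨σ', h1.seq (((Runs.skip σ').ite_false (by simp [Expr.eval, hf])).mono
        (by simp [Expr.cost]; omega)), h2, h3, .inr ⟨hf, fun hh => hs hh.1⟩⟩
  | ex φ, ℓ, hw, hl => by
    obtain ⟨T, hT, h⟩ := runs_prog φ (ℓ + 1) hw (by omega)
    -- Each of the two initial assignments costs `2`, the loop test with its tick `8`, the increment
    -- of the counter `4`.
    refine ⟨fun B => 2 + (2 + (B + 1) * (8 + (T B + 4))),
      (PolyBd.const 2).add ((PolyBd.const 2).add ((PolyBd.id.add (.const 1)).mul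
        ((PolyBd.const 8).add (hT.add (.const 4))))), fun B W σ hB hBW hW => ?_⟩
    set S : ℕ → Prop := fun v =>
      Sat B (inputOf B σ.mem) (tabOf B σ.mem) (ℓ + 1) φ (Function.update σ.reg ℓ v) with hS
    -- `m` counts the values that are still to be tried. The loop stops at the first witness, so
    -- flag `0` carries the information that no smaller value is one.
    let Inv : ℕ → State → Prop := fun m τ => τ.reg ℓ + m = B ∧ Agree ℓ τ.reg σ.reg ∧
      τ.mem = σ.mem ∧ ((τ.reg 2 = 1 ∧ ∃ v < B, S v) ∨ (τ.reg 2 = 0 ∧ ∀ v < τ.reg ℓ, ¬ S v))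
    have step : ∀ m τ, Inv m τ →
        (Expr.op .mul (.op .lt (.reg ℓ) (.reg 1)) (.op .eq (.reg 2) (.const 0))).eval τ ≠ 0 →
        ∃ τ' m', m' < m ∧ Inv m' τ' ∧ Runs W
          (.seq (prog (ℓ + 1) φ) (.assign ℓ (.op .add (.reg ℓ) (.const 1)))) τ (T B + 4) τ' := by
      rintro m τ ⟨hm, ha, hmem, hv⟩ he
      have h1τ : τ.reg 1 = B := (ha 1 (by omega) (by omega)).trans hB
      have he1 : τ.reg ℓ < B := by
        by_contra hh
        exact he (by simp [Expr.eval, BinOp.eval, h1τ, hh])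
      have he2 : τ.reg 2 = 0 := by
        by_contra hh
        exact he (by simp [Expr.eval, BinOp.eval, hh])
      obtain ⟨τ', k1, k2, k3, k4⟩ := h B W τ h1τ hBW hW
      have hl' : τ'.reg ℓ = τ.reg ℓ := k2 ℓ (by omega) (by omega)
      -- The counter is the value of the quantified variable; all other registers that `φ` reads are
      -- as at the start.
      have hagr : Agree (ℓ + 1) τ.reg (Function.update σ.reg ℓ (τ.reg ℓ)) := by
        have := ha.update_succ (τ.reg ℓ)
        rwa [Function.update_eq_self] at this
      rw [hmem, sat_congr φ hw hagr] at k4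
      have hnot : ∀ v < τ.reg ℓ, ¬ S v := by
        rcases hv with hv | hv
        · omega
        · exact hv.2
      have hev : (Expr.op .add (.reg ℓ) (.const 1)).eval τ' = τ.reg ℓ + 1 := by
        simp [Expr.eval, BinOp.eval, hl']
      refine ⟨_, m - 1, by omega, ?_, k1.seq ((Runs.assign _ _ _ (by rw [hev]; omega)).mono
        (by simp [Expr.cost]))⟩
      rw [hev]
      refine ⟨by simp; omega, ((Agree.update _ _ (.inl le_rfl)).trans (k2.mono (by omega))).trans ha,
        k3.trans hmem, ?_⟩
      have h2l : (2 : ℕ) ≠ ℓ := by omega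
      simp only [Function.update_self, Function.update_of_ne h2l]
      rcases k4 with ⟨hf, hs⟩ | ⟨hf, hs⟩
      · exact .inl ⟨hf, _, he1, hs⟩
      · refine .inr ⟨hf, fun v hv => ?_⟩
        rcases Nat.lt_succ_iff_lt_or_eq.1 hv with hv | rfl
        exacts [hnot v hv, hs]
    let σ₁ : State := ⟨Function.update σ.reg ℓ 0, σ.mem⟩
    let σ₂ : State := ⟨Function.update σ₁.reg 2 0, σ.mem⟩
    have h2l : ℓ ≠ 2 := by omega
    have hinit : Inv B σ₂ := by
      refine ⟨by simp [σ₂, σ₁, Function.update_of_ne h2l],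
        (Agree.update _ _ (.inr rfl)).trans (Agree.update _ _ (.inl le_rfl)), rfl,
        .inr ⟨by simp [σ₂], fun v hv => ?_⟩⟩
      simp [σ₂, σ₁, Function.update_of_ne h2l] at hv
    obtain ⟨τ, m', hm', ⟨hi1, hi2, hi3, hi4⟩, he, hr⟩ := Runs.loop Inv step B σ₂ hinit
    refine ⟨τ, (Runs.assign ℓ (.const 0) σ (by simp [Expr.eval]; omega)).seq
      ((Runs.assign 2 (.const 0) σ₁ (by simp [Expr.eval]; omega)).seq
        (hr.mono (by simp [Expr.cost]))), hi2, hi3, ?_⟩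
    rcases hi4 with ⟨hf, hs⟩ | ⟨hf, hs⟩
    · exact .inl ⟨hf, hs⟩
    · refine .inr ⟨hf, ?_⟩
      rintro ⟨v, hv, hv'⟩
      have h1τ : τ.reg 1 = B := (hi2 1 (by omega) (by omega)).trans hB
      -- With flag `0` the loop test can fail only because the counter has reached `B`, so every
      -- value has been tried.
      simp only [Expr.eval, BinOp.eval, h1τ, hf, if_true, mul_one, ite_eq_right_iff,
        Nat.one_ne_zero, imp_false] at he
      exact hs v (by omega) hv'

end Fm

end DocSpanners

/-! ### Relations as tables in memory, filled by recursion on the first argument. -/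

namespace DocSpanners

/-! ### Tables -/

theorem tabAddr_eq_ofDigits (B j : ℕ) :
    ∀ xs : List ℕ, tabAddr B j xs = Nat.ofDigits B (xs ++ [j + 1])
  | [] => by simp [tabAddr]
  | x :: xs => by simp [tabAddr, Nat.ofDigits_cons, tabAddr_eq_ofDigits B j xs]

/-- An address is a number in base `B` with low digits `xs` and leading digit `j + 1`. As the
leading digit is not zero, `Nat.digits` recovers the whole list, including its length. -/
theorem tabAddr_inj {B j j' : ℕ} {xs ys : List ℕ} (hj : j + 1 < B) (hj' : j' + 1 < B)
    (hx : ∀ x ∈ xs, x < B) (hy : ∀ y ∈ ys, y < B) (h : tabAddr B j xs = tabAddr B j' ys) :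
    j = j' ∧ xs = ys := by
  have aux : ∀ (i : ℕ) (zs : List ℕ), i + 1 < B → (∀ z ∈ zs, z < B) →
      Nat.digits B (tabAddr B i zs) = zs ++ [i + 1] := by
    intro i zs hi hz
    rw [tabAddr_eq_ofDigits]
    refine Nat.digits_ofDigits B (by omega) _ (fun l hl => ?_) (by simp)
    rcases List.mem_append.1 hl with hl | hl
    · exact hz l hl
    · simp only [List.mem_singleton] at hl; omega
  have := aux j xs hj hx
  rw [h, aux j' ys hj' hy] at this
  obtain ⟨h1, h2⟩ := List.append_inj' this rfl
  simp at h2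
  exact ⟨h2.symm, h1.symm⟩

/-- Since all arities are positive, tables stay clear of the first `B` cells, where the input and
the digits of the search are kept. -/
theorem le_tabAddr {B j : ℕ} : ∀ {xs : List ℕ}, xs ≠ [] → B ≤ tabAddr B j xs
  | [x], _ => by simp only [tabAddr]; nlinarith
  | x :: y :: ys, _ => by
    have := le_tabAddr (B := B) (j := j) (xs := y :: ys) (by simp)
    rw [tabAddr]
    rcases Nat.eq_zero_or_pos B with h | h
    · omega
    · nlinarith

theorem tabAddr_lt {B j : ℕ} (hj : j + 1 < B) :
    ∀ {xs : List ℕ}, (∀ x ∈ xs, x < B) → tabAddr B j xs < B ^ (xs.length + 1)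
  | [], _ => by simpa [tabAddr] using hj
  | x :: xs, h => by
    have h1 := tabAddr_lt hj (xs := xs) fun y hy => h y (by simp [hy])
    have h2 := h x (by simp)
    rw [tabAddr, List.length_cons, pow_succ' B (xs.length + 1)]
    nlinarith

/-- The arguments of a table are passed in the registers from `10` on. -/
def argsOf (ρ : ℕ → ℕ) (r : ℕ) : List ℕ := (List.range r).map fun i => ρ (10 + i)

theorem argsOf_succ (ρ : ℕ → ℕ) (r : ℕ) : argsOf ρ (r + 1) = argsOf ρ r ++ [ρ (10 + r)] := by
  simp [argsOf, List.range_succ]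

theorem argsOf_congr {ρ ρ' : ℕ → ℕ} {r : ℕ} (h : Agree (10 + r) ρ ρ') :
    argsOf ρ r = argsOf ρ' r := by
  refine List.map_congr_left fun i hi => h _ ?_ (by omega)
  have := List.mem_range.1 hi
  omega

/-- The memory cell `a` tells whether `P` holds. -/
def Cell (mem : ℕ → ℕ) (a : ℕ) (P : Prop) : Prop := (mem a = 1 ∧ P) ∨ (mem a = 0 ∧ ¬ P)

theorem Cell.iff {mem : ℕ → ℕ} {a : ℕ} {P : Prop} (h : Cell mem a P) : mem a ≠ 0 ↔ P := by
  rcases h with ⟨h1, h2⟩ | ⟨h1, h2⟩ <;> simp [h1, h2]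

/-- Run `body` with all values below the bound in register `ℓ`. -/
def forProg (ℓ : ℕ) (body : Program) : Program :=
  .seq (.assign ℓ (.const 0)) (.loop (.op .lt (.reg ℓ) (.reg 1))
    (.seq body (.assign ℓ (.op .add (.reg ℓ) (.const 1)))))

/-- The invariant concerns memory only, indexed by the number of values treated. The body may spoil
the registers above `ℓ` and the truth value, but nothing else. -/
theorem runs_forProg {W B ℓ T : ℕ} {body : Program} {ρ₀ : ℕ → ℕ} (hl : 2 < ℓ) (hBW : B < W)
    (hB : ρ₀ 1 = B) (Inv : ℕ → (ℕ → ℕ) → Prop)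
    (step : ∀ i < B, ∀ τ : State, Agree ℓ τ.reg ρ₀ → τ.reg ℓ = i → Inv i τ.mem →
      ∃ τ', Runs W body τ T τ' ∧ Agree (ℓ + 1) τ'.reg τ.reg ∧ Inv (i + 1) τ'.mem)
    (σ : State) (hσ : Agree ℓ σ.reg ρ₀) (h0 : Inv 0 σ.mem) :
    ∃ σ', Runs W (forProg ℓ body) σ (2 + (B + 1) * (8 + T)) σ' ∧ Agree ℓ σ'.reg ρ₀ ∧
      Inv B σ'.mem := by
  let J : ℕ → State → Prop := fun m τ => τ.reg ℓ + m = B ∧ Agree ℓ τ.reg ρ₀ ∧ Inv (τ.reg ℓ) τ.mem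
  have cond : ∀ τ : State, Agree ℓ τ.reg ρ₀ →
      (Expr.op .lt (.reg ℓ) (.reg 1)).eval τ = if τ.reg ℓ < B then 1 else 0 := by
    intro τ hτ
    simp [Expr.eval, BinOp.eval, (hτ 1 (by omega) (by omega)).trans hB]
  have hstep : ∀ m τ, J m τ → (Expr.op .lt (.reg ℓ) (.reg 1)).eval τ ≠ 0 →
      ∃ τ' m', m' < m ∧ J m' τ' ∧
        Runs W (.seq body (.assign ℓ (.op .add (.reg ℓ) (.const 1)))) τ (T + 4) τ' := by
    rintro m τ ⟨hm, ha, hi⟩ he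
    rw [cond τ ha] at he
    have hlt : τ.reg ℓ < B := by
      by_contra hh
      simp [hh] at he
    obtain ⟨τ', k1, k2, k3⟩ := step _ hlt τ ha rfl hi
    have hl' : τ'.reg ℓ = τ.reg ℓ := k2 ℓ (by omega) (by omega)
    have hev : (Expr.op .add (.reg ℓ) (.const 1)).eval τ' = τ.reg ℓ + 1 := by
      simp [Expr.eval, BinOp.eval, hl']
    refine ⟨_, m - 1, by omega, ?_, k1.seq ((Runs.assign _ _ _ (by rw [hev]; omega)).mono
      (by simp [Expr.cost]))⟩
    rw [hev]
    exact ⟨by simp; omega, ((Agree.update _ _ (.inl le_rfl)).trans (k2.mono (by omega))).trans ha,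
      by simpa using k3⟩
  obtain ⟨τ, m', hm', ⟨h1, h2, h3⟩, he, hr⟩ := Runs.loop J hstep B
    ⟨Function.update σ.reg ℓ 0, σ.mem⟩
    ⟨by simp, (Agree.update _ _ (.inl le_rfl)).trans hσ, by simpa using h0⟩
  rw [cond τ h2] at he
  have hlt : ¬ τ.reg ℓ < B := by
    intro hh
    simp [hh] at he
  have : τ.reg ℓ = B := by omega
  refine ⟨τ, ((Runs.assign ℓ (.const 0) σ (by simp [Expr.eval]; omega)).seq hr).mono ?_, h2,
    this ▸ h3⟩
  simp only [Expr.cost]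
  nlinarith

/-- Fill the table `j` of arity `r`, the last `m` arguments of which are not yet fixed. -/
def fillLoop (j r : ℕ) (φ : Fm) : ℕ → ℕ → Program
  | 0, ℓ => .seq (φ.prog ℓ)
      (.store (Fm.addrExpr j ((List.range r).map fun i => .reg (10 + i))) (.reg 2))
  | m + 1, ℓ => forProg ℓ (fillLoop j r φ m (ℓ + 1))

/-- `Pre` abstracts what the formula relies on: it survives writes to the entries being filled, and
in every memory where it holds the formula has the truth value given by `Rel`. So these entries may
be written in any order while the formula is still being evaluated for the others. The induction is
on the number of arguments that remain to be looped over. -/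
theorem runs_fillLoop {j r : ℕ} {φ : Fm} (hφ : φ.Wf (10 + r)) : ∀ m : ℕ,
    ∃ T : ℕ → ℕ, PolyBd T ∧ ∀ (B W : ℕ) (ρ₀ : ℕ → ℕ) (Rel : List ℕ → Prop)
      (Pre : (ℕ → ℕ) → Prop) (ys : List ℕ) (σ : State), ys.length + m = r → j + 1 < B → B < W →
      B ^ (r + 1) ≤ W → (∀ y ∈ ys, y < B) → ρ₀ 1 = B → Agree 10 σ.reg ρ₀ →
      argsOf σ.reg ys.length = ys → Pre σ.mem →
      (∀ mem zs b, zs.length = m → (∀ z ∈ zs, z < B) → Pre mem →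
        Pre (Function.update mem (tabAddr B j (ys ++ zs)) b)) →
      (∀ mem ρ zs, zs.length = m → (∀ z ∈ zs, z < B) → Pre mem → Agree 10 ρ ρ₀ →
        argsOf ρ r = ys ++ zs →
        (φ.Sat B (inputOf B mem) (tabOf B mem) (10 + r) ρ ↔ Rel (ys ++ zs))) →
      ∃ σ', Runs W (fillLoop j r φ m (10 + ys.length)) σ (T B) σ' ∧
        Agree (10 + ys.length) σ'.reg σ.reg ∧ Pre σ'.mem ∧
        (∀ zs, zs.length = m → (∀ z ∈ zs, z < B) →
          Cell σ'.mem (tabAddr B j (ys ++ zs)) (Rel (ys ++ zs))) ∧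
        ∀ a, (∀ zs, zs.length = m → (∀ z ∈ zs, z < B) → a ≠ tabAddr B j (ys ++ zs)) →
          σ'.mem a = σ.mem a := by
  intro m
  induction m with
  | zero =>
    obtain ⟨T, hT, h⟩ := φ.runs_prog (10 + r) hφ (by omega)
    refine ⟨fun B => T B + ((Fm.addrExpr j ((List.range r).map fun i => .reg (10 + i))).cost + 2),
      hT.add (.const _), ?_⟩
    intro B W ρ₀ Rel Pre ys σ hr hj hBW hW hys hB hσ hargs hP hPu hS
    have hr' : ys.length = r := by omega
    have h1 : σ.reg 1 = B := (hσ 1 (by omega) (by omega)).trans hB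
    obtain ⟨σ', k1, k2, k3, k4⟩ := h B W σ h1 hBW (by omega)
    have hS' := hS σ.mem σ.reg [] rfl (by simp) hP hσ (by simpa [hr'] using hargs)
    rw [List.append_nil] at hS'
    have k4 := k4.congr hS'
    have h1' : σ'.reg 1 = B := (k2 1 (by omega) (by omega)).trans h1
    have haddr : (Fm.addrExpr j ((List.range r).map fun i => .reg (10 + i))).eval σ'
        = tabAddr B j ys := by
      rw [Fm.addrExpr_eval h1', List.map_map]
      congr 1
      have := argsOf_congr k2
      rw [← hr', hargs] at this
      rw [← this, hr']
      rfl
    have hlt : tabAddr B j ys < W := (tabAddr_lt hj hys).trans_le (by rw [hr']; exact hW)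
    have hst := Runs.store (W := W)
      (Fm.addrExpr j ((List.range r).map fun i => .reg (10 + i))) (.reg 2) σ'
      (by rw [haddr]; exact hlt)
      (by rcases k4 with ⟨h, -⟩ | ⟨h, -⟩ <;> simp only [Expr.eval, h] <;> omega)
    refine ⟨_, k1.seq (hst.mono (T₂ := (Fm.addrExpr j
      ((List.range r).map fun i => .reg (10 + i))).cost + 2) (by simp [Expr.cost])) |>
      (by rw [hr']; exact ·), by rw [hr']; exact k2, ?_, ?_, ?_⟩
    · simp only [haddr, k3]
      simpa using hPu σ.mem [] (Expr.eval σ' (.reg 2)) rfl (by simp) hP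
    · intro zs hz _
      obtain rfl := List.length_eq_zero_iff.1 hz
      simp only [haddr, k3, Cell, List.append_nil, Function.update_self]
      exact k4
    · intro a ha
      have := ha [] rfl (by simp)
      rw [List.append_nil] at this
      simp [haddr, k3, Function.update_of_ne this]
  | succ m ih =>
    obtain ⟨T, hT, h⟩ := ih
    refine ⟨fun B => 2 + (B + 1) * (8 + T B), (PolyBd.const 2).add
      ((PolyBd.id.add (.const 1)).mul ((PolyBd.const 8).add hT)), ?_⟩
    intro B W ρ₀ Rel Pre ys σ hr hj hBW hW hys hB hσ hargs hP hPu hS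
    let Inv : ℕ → (ℕ → ℕ) → Prop := fun i mem => Pre mem ∧
      (∀ x < i, ∀ zs, zs.length = m → (∀ z ∈ zs, z < B) →
        Cell mem (tabAddr B j (ys ++ x :: zs)) (Rel (ys ++ x :: zs))) ∧
      ∀ a, (∀ zs, zs.length = m + 1 → (∀ z ∈ zs, z < B) → a ≠ tabAddr B j (ys ++ zs)) →
        mem a = σ.mem a
    have hall : ∀ i < B, ∀ zs : List ℕ, (∀ z ∈ zs, z < B) → ∀ z ∈ i :: zs, z < B := by
      intro i hi zs hz
      simpa using ⟨hi, hz⟩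
    have hall' : ∀ zs : List ℕ, (∀ z ∈ zs, z < B) → ∀ z ∈ ys ++ zs, z < B := by
      intro zs hz z hz'
      rcases List.mem_append.1 hz' with h | h
      exacts [hys z h, hz z h]
    obtain ⟨σ', h1, h2, h3, h4, h5⟩ := runs_forProg (W := W) (B := B) (ℓ := 10 + ys.length)
      (T := T B) (body := fillLoop j r φ m (10 + ys.length + 1)) (ρ₀ := σ.reg) (by omega) hBW
      ((hσ 1 (by omega) (by omega)).trans hB) Inv (by
        rintro i hi τ ha hτ ⟨i1, i2, i3⟩
        obtain ⟨τ', k1, k2, k3, k4, k5⟩ := h B W ρ₀ Rel Pre (ys ++ [i]) τ (by simp; omega) hj hBW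
          hW (by simpa using fun y hy => hy.elim (hys y) (fun h => h ▸ hi)) hB
          ((ha.mono (by omega)).trans hσ)
          (by rw [List.length_append, List.length_singleton, argsOf_succ, hτ, argsOf_congr ha,
            hargs]) i1
          (fun mem zs b hz hz' hp => by
            simpa using hPu mem (i :: zs) b (by simpa using hz) (hall i hi zs hz') hp)
          (fun mem ρ zs hz hz' hp hρ hargs' => by
            simpa using hS mem ρ (i :: zs) (by simpa using hz) (hall i hi zs hz') hp hρ
              (by simpa using hargs'))
        simp only [List.append_assoc, List.singleton_append, List.length_append,
          List.length_singleton, ← Nat.add_assoc] at k1 k2 k4 k5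
        refine ⟨τ', k1, k2, k3, ?_, ?_⟩
        · intro x hx zs hz hz'
          rcases Nat.lt_succ_iff_lt_or_eq.1 hx with hx | rfl
          -- Entries for a smaller `x` have other addresses, so this round has not touched them.
          · have := k5 (tabAddr B j (ys ++ x :: zs)) (by
              intro zs' _ hz2 heq
              have := (tabAddr_inj hj hj (hall' _ (hall x (hx.trans hi) zs hz'))
                (hall' _ (hall i hi zs' hz2)) heq).2
              simp at this
              omega)
            unfold Cell
            rw [this]
            exact i2 x hx zs hz hz'
          · exact k4 zs hz hz'
        · intro a hna
          rw [k5 a fun zs hz hz' => by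
            simpa using hna (i :: zs) (by simpa using hz) (hall i hi zs hz')]
          exact i3 a hna) σ (Agree.refl _ _) ⟨hP, fun x hx => absurd hx (by omega), fun _ _ => rfl⟩
    refine ⟨σ', h1, h2, h3, ?_, h5⟩
    intro zs hz hz'
    obtain ⟨x, zs, rfl⟩ : ∃ x zs', zs = x :: zs' := by
      cases zs with
      | nil => simp at hz
      | cons x zs => exact ⟨x, zs, rfl⟩
    exact h4 x (hz' x (by simp)) zs (by simpa using hz) fun z h => hz' z (by simp [h])

/-- The formula `φ` defines the relation `Rel j`, by recursion on the first argument and in terms of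
the relations `Rel j'` for `j' < j`. -/
def Defines (B : ℕ) (w ρ₀ : ℕ → ℕ) (ar : ℕ → ℕ) (Rel : ℕ → List ℕ → Prop) (j : ℕ) (φ : Fm) :
    Prop :=
  ∀ (I : ℕ → List ℕ → Prop) (ρ : ℕ → ℕ), Agree 10 ρ ρ₀ → (∀ i < ar j, ρ (10 + i) < B) →
    (∀ j' < j, ∀ xs, xs.length = ar j' → (∀ x ∈ xs, x < B) → (I j' xs ↔ Rel j' xs)) →
    (∀ x < ρ 10, ∀ xs, xs.length + 1 = ar j → (∀ x ∈ xs, x < B) →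
      (I j (x :: xs) ↔ Rel j (x :: xs))) →
    (φ.Sat B w I (10 + ar j) ρ ↔ Rel j (argsOf ρ (ar j)))

/-- The table `j` holds the relation `Rel j`. -/
def TableOK (B : ℕ) (ar : ℕ → ℕ) (Rel : ℕ → List ℕ → Prop) (mem : ℕ → ℕ) (j : ℕ) : Prop :=
  ∀ xs, xs.length = ar j → (∀ x ∈ xs, x < B) → Cell mem (tabAddr B j xs) (Rel j xs)

/-- Loads beyond the bound are redirected to address `0`, itself below `B`. Terms are thus blind to
the tables, and filling these does not change what a formula sees as its input. -/
theorem inputOf_congr {B : ℕ} {mem mem' : ℕ → ℕ} (hB : 0 < B) (h : ∀ a < B, mem a = mem' a) :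
    inputOf B mem = inputOf B mem' := by
  funext t
  unfold inputOf
  split
  · exact h _ (by simpa)
  · exact h _ (by simpa)

/-- The outermost loop runs over the first argument. What is kept at stage `i` is that the first `B`
cells are unchanged, the earlier tables are complete and the entries with first argument below `i`
are correct. This is all that `Defines` asks for, and it does not mention the entries with first
argument `i`, which are being written. -/
theorem runs_fill {ar : ℕ → ℕ} {j : ℕ} {φ : Fm} (hφ : φ.Wf (10 + ar j)) (har : ∀ i, 0 < ar i) :
    ∃ T : ℕ → ℕ, PolyBd T ∧ ∀ (B W : ℕ) (Rel : ℕ → List ℕ → Prop) (σ : State),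
      j + 1 < B → B < W → B ^ (ar j + 1) ≤ W → σ.reg 1 = B →
      Defines B (inputOf B σ.mem) σ.reg ar Rel j φ → (∀ i < j, TableOK B ar Rel σ.mem i) →
      ∃ σ', Runs W (fillLoop j (ar j) φ (ar j) 10) σ (T B) σ' ∧ Agree 10 σ'.reg σ.reg ∧
        (∀ a < B, σ'.mem a = σ.mem a) ∧ ∀ i < j + 1, TableOK B ar Rel σ'.mem i := by
  obtain ⟨r, hr⟩ : ∃ r, ar j = r + 1 := ⟨ar j - 1, by have := har j; omega⟩
  rw [hr] at hφ
  obtain ⟨T, hT, h⟩ := runs_fillLoop (j := j) hφ r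
  refine ⟨fun B => 2 + (B + 1) * (8 + T B), (PolyBd.const 2).add
    ((PolyBd.id.add (.const 1)).mul ((PolyBd.const 8).add hT)), ?_⟩
  intro B W Rel σ hj hBW hW hB hdef htab
  rw [hr] at hW ⊢
  let Inv : ℕ → (ℕ → ℕ) → Prop := fun i mem => (∀ a < B, mem a = σ.mem a) ∧
    (∀ i < j, TableOK B ar Rel mem i) ∧
    ∀ x < i, ∀ zs, zs.length = r → (∀ z ∈ zs, z < B) →
        Cell mem (tabAddr B j (x :: zs)) (Rel j (x :: zs))
  have hall : ∀ i < B, ∀ zs : List ℕ, (∀ z ∈ zs, z < B) → ∀ z ∈ i :: zs, z < B := by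
    intro i hi zs hz
    simpa using ⟨hi, hz⟩
  obtain ⟨σ', h1, h2, h3, h4, h5⟩ := runs_forProg (W := W) (B := B) (ℓ := 10) (T := T B)
    (body := fillLoop j (r + 1) φ r 11) (ρ₀ := σ.reg) (by omega) hBW hB Inv (by
      rintro i hi τ ha hτ hinv
      obtain ⟨τ', k1, k2, k3, k4, k5⟩ := h B W σ.reg (Rel j) (Inv i) [i] τ (by simp; omega) hj hBW
        hW (by simpa using hi) hB ha (by simp [argsOf, hτ]) hinv
        (fun mem zs b hz hz' ⟨p1, p2, p3⟩ => by
          refine ⟨fun a haB => ?_, fun i' hi' xs hx hx' => ?_, fun x hx xs hxs hx' => ?_⟩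
          · rw [Function.update_of_ne]
            · exact p1 a haB
            · have := le_tabAddr (B := B) (j := j) (xs := [i] ++ zs) (by simp)
              omega
          · unfold Cell
            rw [Function.update_of_ne]
            · exact p2 i' hi' xs hx hx'
            · intro heq
              have := (tabAddr_inj (by omega) hj hx' (hall i hi zs hz') heq).1
              omega
          · unfold Cell
            rw [Function.update_of_ne]
            · exact p3 x hx xs hxs hx'
            · intro heq
              have := (tabAddr_inj hj hj (hall x (hx.trans hi) xs hx') (hall i hi zs hz') heq).2
              simp at this
              omega)
        (fun mem ρ zs hz hz' ⟨p1, p2, p3⟩ hρ hargs => by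
          -- Register `10` holds the first argument, so the stage in `Defines` is the value `i` of
          -- the loop.
          have h10 : ρ 10 = i := by
            have := congrArg (·.head?) hargs
            simpa [argsOf, List.range_succ_eq_map] using this
          have := hdef (tabOf B mem) ρ hρ (by
              intro i' hi'
              rw [hr] at hi'
              have : ρ (10 + i') ∈ argsOf ρ (r + 1) :=
                List.mem_map.2 ⟨i', List.mem_range.2 hi', rfl⟩
              rw [hargs] at this
              exact hall i hi zs hz' _ this)
            (fun j' hj' xs hx hx' => (p2 j' hj' xs hx hx').iff)
            (fun x hx xs hxs hx' => (p3 x (h10 ▸ hx) xs (by omega) hx').iff)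
          rw [hr, hargs] at this
          rw [← this, inputOf_congr (by omega) p1])
      refine ⟨τ', k1, k2, k3.1, k3.2.1, fun x hx zs hz hz' => ?_⟩
      rcases Nat.lt_succ_iff_lt_or_eq.1 hx with hx | rfl
      · exact k3.2.2 x hx zs hz hz'
      · exact k4 zs hz hz') σ (Agree.refl _ _)
    ⟨fun _ _ => rfl, htab, fun x hx => absurd hx (by omega)⟩
  refine ⟨σ', h1, h2, h3, fun i hi => ?_⟩
  rcases Nat.lt_succ_iff_lt_or_eq.1 hi with hi | rfl
  · exact h4 i hi
  · intro xs hx hx'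
    obtain ⟨x, xs, rfl⟩ : ∃ x xs', xs = x :: xs' := by
      cases xs with
      | nil => simp [hr] at hx
      | cons x zs => exact ⟨x, zs, rfl⟩
    exact h5 x (hx' x (by simp)) xs (by simpa [hr] using hx) fun z h => hx' z (by simp [h])

/-- Fill the first tables. -/
def fills (ar : ℕ → ℕ) (fm : ℕ → Fm) : ℕ → Program
  | 0 => .skip
  | m + 1 => .seq (fills ar fm m) (fillLoop m (ar m) (fm m) (ar m) 10)

theorem Agree.defines {B : ℕ} {w ρ ρ' : ℕ → ℕ} {ar : ℕ → ℕ} {Rel : ℕ → List ℕ → Prop} {j : ℕ}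
    {φ : Fm} (h : Agree 10 ρ ρ') (hd : Defines B w ρ ar Rel j φ) : Defines B w ρ' ar Rel j φ :=
  fun I ρ₁ h₁ => hd I ρ₁ (h₁.trans h.symm)

theorem runs_fills {ar : ℕ → ℕ} {fm : ℕ → Fm} (har : ∀ i, 0 < ar i) {R : ℕ} : ∀ m : ℕ,
    (∀ j < m, (fm j).Wf (10 + ar j) ∧ ar j ≤ R) →
    ∃ T : ℕ → ℕ, PolyBd T ∧ ∀ (B W : ℕ) (Rel : ℕ → List ℕ → Prop) (σ : State),
      m + 1 < B → B < W → B ^ (R + 1) ≤ W → σ.reg 1 = B →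
      (∀ j < m, Defines B (inputOf B σ.mem) σ.reg ar Rel j (fm j)) →
      ∃ σ', Runs W (fills ar fm m) σ (T B) σ' ∧ Agree 10 σ'.reg σ.reg ∧
        (∀ a < B, σ'.mem a = σ.mem a) ∧ ∀ i < m, TableOK B ar Rel σ'.mem i := by
  intro m
  induction m with
  | zero =>
    exact fun _ => ⟨fun _ => 1, .const 1, fun B W Rel σ _ _ _ _ _ =>
      ⟨σ, Runs.skip σ, Agree.refl _ _, fun _ _ => rfl, fun i hi => absurd hi (by omega)⟩⟩
  | succ m ih =>
    intro hw
    obtain ⟨T, hT, h⟩ := ih fun j hj => hw j (by omega)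
    obtain ⟨T', hT', h'⟩ := runs_fill (j := m) (hw m (by omega)).1 har
    refine ⟨fun B => T B + T' B, hT.add hT', fun B W Rel σ hm hBW hW hB hd => ?_⟩
    obtain ⟨σ', k1, k2, k3, k4⟩ := h B W Rel σ (by omega) hBW hW hB fun j hj => hd j (by omega)
    obtain ⟨σ'', l1, l2, l3, l4⟩ := h' B W Rel σ' (by omega) hBW
      ((Nat.pow_le_pow_right (by omega) (by have := (hw m (by omega)).2; omega)).trans hW)
      ((k2 1 (by omega) (by omega)).trans hB)
      (by
        rw [inputOf_congr (by omega) k3]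
        exact k2.symm.defines (hd m (by omega))) k4
    exact ⟨σ'', k1.seq l1, l2.trans k2, fun a ha => (l3 a ha).trans (k3 a ha), l4⟩

/-- Fill all tables, then evaluate `ψ`. -/
theorem runs_decide {ar : ℕ → ℕ} {fm : ℕ → Fm} (har : ∀ i, 0 < ar i) {R : ℕ} (m : ℕ)
    (hw : ∀ j < m, (fm j).Wf (10 + ar j) ∧ ar j ≤ R) {ψ : Fm} (hψ : ψ.Wf 10) :
    ∃ T : ℕ → ℕ, PolyBd T ∧ ∀ (B W : ℕ) (Rel : ℕ → List ℕ → Prop) (P : Prop) (σ : State),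
      m + 1 < B → B < W → B ^ (R + 1) ≤ W → σ.reg 1 = B →
      (∀ j < m, Defines B (inputOf B σ.mem) σ.reg ar Rel j (fm j)) →
      (∀ I : ℕ → List ℕ → Prop,
        (∀ j < m, ∀ xs, xs.length = ar j → (∀ x ∈ xs, x < B) → (I j xs ↔ Rel j xs)) →
        (ψ.Sat B (inputOf B σ.mem) I 10 σ.reg ↔ P)) →
      ∃ σ', Runs W (.seq (fills ar fm m) (ψ.prog 10)) σ (T B) σ' ∧ Agree 10 σ'.reg σ.reg ∧
        (∀ a < B, σ'.mem a = σ.mem a) ∧ Flag σ' P := by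
  obtain ⟨T, hT, h⟩ := runs_fills har m hw
  obtain ⟨T', hT', h'⟩ := ψ.runs_prog 10 hψ (by omega)
  refine ⟨fun B => T B + T' B, hT.add hT', fun B W Rel P σ hm hBW hW hB hd hP => ?_⟩
  obtain ⟨σ', k1, k2, k3, k4⟩ := h B W Rel σ hm hBW hW hB hd
  obtain ⟨σ'', l1, l2, l3, l4⟩ := h' B W σ' ((k2 1 (by omega) (by omega)).trans hB) hBW (by omega)
  refine ⟨σ'', k1.seq l1, l2.trans k2, fun a ha => by rw [l3]; exact k3 a ha, l4.congr ?_⟩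
  rw [inputOf_congr (by omega) k3, Fm.sat_congr ψ hψ k2]
  exact hP _ fun j hj xs hx hx' => (k4 j hj xs hx hx').iff

end DocSpanners

/-! ### Regex formulas in postfix code and their automata. -/

namespace DocSpanners

/-! ### Codes of regex formulas -/

/-- The words at the addresses `i, …, i + l - 1`. -/
def slice (w : ℕ → ℕ) (i l : ℕ) : List ℕ := (List.range l).map fun t => w (i + t)

@[simp] theorem length_slice (w : ℕ → ℕ) (i l : ℕ) : (slice w i l).length = l := by simp [slice]

theorem slice_add (w : ℕ → ℕ) (i l l' : ℕ) :
    slice w i (l + l') = slice w i l ++ slice w (i + l) l' := by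
  simp [slice, List.range_add, Nat.add_assoc, Function.comp_def]

theorem slice_one (w : ℕ → ℕ) (i : ℕ) : slice w i 1 = [w i] := rfl

theorem slice_two (w : ℕ → ℕ) (i : ℕ) : slice w i 2 = [w i, w (i + 1)] := rfl

namespace RegexFormula

/-- Evaluation of postfix notation with a stack. -/
def decode : List RegexFormula → List ℕ → List RegexFormula
  | st, 0 :: r => decode (empty :: st) r
  | st, 1 :: r => decode (eps :: st) r
  | st, 2 :: a :: r => decode (letter a :: st) r
  | β :: α :: st, 3 :: r => decode (alt α β :: st) r
  | β :: α :: st, 4 :: r => decode (cat α β :: st) r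
  | α :: st, 5 :: r => decode (star α :: st) r
  | α :: st, 6 :: x :: r => decode (bind x α :: st) r
  | st, _ => st

/-- The arbitrary stack and rest carry the induction through the binary operations; with both empty
this is unique readability. -/
theorem decode_code (α : RegexFormula) (st : List RegexFormula) (r : List ℕ) :
    decode st (α.code ++ r) = decode (α :: st) r := by
  induction α generalizing st r with
  | empty => simp [code, decode]
  | eps => simp [code, decode]
  | letter a => simp [code, decode]
  | alt α β ihα ihβ => simp [code, ihα, ihβ, decode]
  | cat α β ihα ihβ => simp [code, ihα, ihβ, decode]
  | star α ih => simp [code, ih, decode]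
  | bind x α ih => simp [code, ih, decode]

theorem code_injective : Function.Injective code := by
  intro α β h
  have h1 := decode_code α [] []
  rw [h, decode_code β [] []] at h1
  simpa [decode] using h1.symm

theorem code_length_pos (α : RegexFormula) : 0 < α.code.length := by
  cases α <;> simp [code]

/-- The code of `α` stands at the address `i`. -/
def CodeAt (w : ℕ → ℕ) (i : ℕ) (α : RegexFormula) : Prop := slice w i α.code.length = α.code

section CodeAt

variable {w : ℕ → ℕ} {i : ℕ} {α β : RegexFormula} {a x : ℕ}

theorem codeAt_empty : CodeAt w i empty ↔ w i = 0 := by simp [CodeAt, code, slice_one]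

theorem codeAt_eps : CodeAt w i eps ↔ w i = 1 := by simp [CodeAt, code, slice_one]

theorem codeAt_letter : CodeAt w i (letter a) ↔ w i = 2 ∧ w (i + 1) = a := by
  simp [CodeAt, code, slice_two]

theorem slice_eq_append_iff {u v : List ℕ} :
    slice w i (u.length + v.length) = u ++ v ↔
      slice w i u.length = u ∧ slice w (i + u.length) v.length = v := by
  rw [slice_add]
  constructor
  · exact fun h => List.append_inj h (by simp)
  · rintro ⟨h1, h2⟩
    rw [h1, h2]

theorem codeAt_alt : CodeAt w i (alt α β) ↔ CodeAt w i α ∧ CodeAt w (i + α.code.length) β ∧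
    w (i + α.code.length + β.code.length) = 3 := by
  simp only [CodeAt, code, List.length_append]
  rw [← List.length_append, slice_eq_append_iff, List.length_append, slice_eq_append_iff]
  simp [slice_one, and_assoc, Nat.add_assoc]

theorem codeAt_cat : CodeAt w i (cat α β) ↔ CodeAt w i α ∧ CodeAt w (i + α.code.length) β ∧
    w (i + α.code.length + β.code.length) = 4 := by
  simp only [CodeAt, code, List.length_append]
  rw [← List.length_append, slice_eq_append_iff, List.length_append, slice_eq_append_iff]
  simp [slice_one, and_assoc, Nat.add_assoc]

theorem codeAt_star : CodeAt w i (star α) ↔ CodeAt w i α ∧ w (i + α.code.length) = 5 := by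
  simp only [CodeAt, code, List.length_append]
  rw [slice_eq_append_iff]
  simp [slice_one]

theorem codeAt_bind : CodeAt w i (bind x α) ↔ CodeAt w i α ∧ w (i + α.code.length) = 6 ∧
    w (i + α.code.length + 1) = x := by
  simp only [CodeAt, code, List.length_append]
  rw [slice_eq_append_iff]
  simp [slice_two]

/-- Injectivity of the code: a subformula can be named by its address and length, two numbers, so
relations between subformulas become relations between numbers. -/
theorem CodeAt.eq_of_length (hα : CodeAt w i α) (hβ : CodeAt w i β)
    (h : α.code.length = β.code.length) : α = β := by
  apply code_injective
  rw [← hα, ← hβ, h]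

end CodeAt

/-! ### The automaton of a regex formula

The subformula whose code ends before the address `j` has the state `2 * j`, in which it is about to
be matched; a binding has the state `2 * j + 1` in addition, in which it is about to be closed.  The
state that follows after the whole formula is `nx`. -/

/-- The edges from `q` to `q'`.  Their label is empty (kind `0`), or a letter, an opening or a
closing (kinds `1`, `2`, `3`), named by the word at address `ad`. -/
def Edge : RegexFormula → (i nx q kd ad q' : ℕ) → Prop
  | empty, _, _, _, _, _, _ => False
  | eps, i, nx, q, kd, ad, q' => q = 2 * (i + 1) ∧ kd = 0 ∧ ad = 0 ∧ q' = nx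
  | letter _, i, nx, q, kd, ad, q' => q = 2 * (i + 2) ∧ kd = 1 ∧ ad = i + 1 ∧ q' = nx
  | alt α β, i, nx, q, kd, ad, q' =>
    (q = 2 * (i + α.code.length + β.code.length + 1) ∧ kd = 0 ∧ ad = 0 ∧
      (q' = 2 * (i + α.code.length) ∨ q' = 2 * (i + α.code.length + β.code.length))) ∨
    α.Edge i nx q kd ad q' ∨ β.Edge (i + α.code.length) nx q kd ad q'
  | cat α β, i, nx, q, kd, ad, q' =>
    (q = 2 * (i + α.code.length + β.code.length + 1) ∧ kd = 0 ∧ ad = 0 ∧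
      q' = 2 * (i + α.code.length)) ∨
    α.Edge i (2 * (i + α.code.length + β.code.length)) q kd ad q' ∨
    β.Edge (i + α.code.length) nx q kd ad q'
  | star α, i, nx, q, kd, ad, q' =>
    (q = 2 * (i + α.code.length + 1) ∧ kd = 0 ∧ ad = 0 ∧
      (q' = nx ∨ q' = 2 * (i + α.code.length))) ∨
    α.Edge i (2 * (i + α.code.length + 1)) q kd ad q'
  | bind _ α, i, nx, q, kd, ad, q' =>
    (q = 2 * (i + α.code.length + 2) ∧ kd = 2 ∧ ad = i + α.code.length + 1 ∧
      q' = 2 * (i + α.code.length)) ∨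
    (q = 2 * (i + α.code.length + 2) + 1 ∧ kd = 3 ∧ ad = i + α.code.length + 1 ∧ q' = nx) ∨
    α.Edge i (2 * (i + α.code.length + 2) + 1) q kd ad q'

end RegexFormula

/-- The label of an edge. -/
def label (w : ℕ → ℕ) (kd ad : ℕ) : List RefSym :=
  if kd = 1 then [.letter (w ad)] else if kd = 2 then [.opn (w ad)]
  else if kd = 3 then [.cls (w ad)] else []

/-- Paths of a labelled graph, with the words that they spell. -/
inductive Path (S : ℕ → List RefSym → ℕ → Prop) : ℕ → List RefSym → ℕ → Prop
  | nil (q : ℕ) : Path S q [] q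
  | cons {q q' q'' : ℕ} {u v : List RefSym} : S q u q' → Path S q' v q'' → Path S q (u ++ v) q''

namespace Path

variable {S : ℕ → List RefSym → ℕ → Prop} {q q' q'' : ℕ} {u v : List RefSym}

theorem single (h : S q u q') : Path S q u q' := by
  simpa using Path.cons h (.nil q')

theorem append (h : Path S q u q') (h' : Path S q' v q'') : Path S q (u ++ v) q'' := by
  induction h with
  | nil q => simpa
  | cons h1 _ ih => simpa using Path.cons h1 (ih h')

theorem mono {S' : ℕ → List RefSym → ℕ → Prop} (hS : ∀ q u q', S q u q' → S' q u q')
    (h : Path S q u q') : Path S' q u q' := by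
  induction h with
  | nil q => exact .nil q
  | cons h1 _ ih => exact .cons (hS _ _ _ h1) ih

end Path

namespace RegexFormula

/-- The labelled graph of `α`. -/
def Step (α : RegexFormula) (w : ℕ → ℕ) (i nx q : ℕ) (u : List RefSym) (q' : ℕ) : Prop :=
  ∃ kd ad, α.Edge i nx q kd ad q' ∧ u = label w kd ad

/-- `S` is any graph that contains the edges of `α`. The induction hypotheses for subformulas then
speak of paths in one and the same graph, which can be concatenated at once. -/
theorem path_of_mem {w : ℕ → ℕ} {S : ℕ → List RefSym → ℕ → Prop} (α : RegexFormula) :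
    ∀ {i nx : ℕ} {u : List RefSym}, CodeAt w i α →
      (∀ q v q', α.Step w i nx q v q' → S q v q') → u ∈ α.refLang →
      Path S (2 * (i + α.code.length)) u nx := by
  induction α with
  | empty =>
    intro i nx u _ _ hu
    exact absurd hu (Set.notMem_empty u)
  | eps =>
    intro i nx u _ hS hu
    obtain rfl : u = [] := hu
    exact .single (hS _ _ _ ⟨0, 0, by simp [Edge, code], by simp [label]⟩)
  | letter a =>
    intro i nx u hc hS hu
    obtain rfl : u = [.letter a] := hu
    rw [codeAt_letter] at hc
    exact .single (hS _ _ _ ⟨1, i + 1, by simp [Edge, code], by simp [label, hc]⟩)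
  | alt α β ihα ihβ =>
    intro i nx u hc hS hu
    rw [codeAt_alt] at hc
    have e1 : (alt α β).code.length = α.code.length + β.code.length + 1 := by simp [code]; omega
    rw [e1, ← Nat.add_assoc, ← Nat.add_assoc]
    rcases hu with hu | hu
    · have := ihα (nx := nx) hc.1 (fun q v q' ⟨kd, ad, h, h'⟩ =>
        hS q v q' ⟨kd, ad, .inr (.inl h), h'⟩) hu
      exact Path.cons (u := []) (hS _ _ _ ⟨0, 0, .inl ⟨rfl, rfl, rfl, .inl rfl⟩, by simp [label]⟩)
        this
    · have := ihβ (nx := nx) hc.2.1 (fun q v q' ⟨kd, ad, h, h'⟩ =>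
        hS q v q' ⟨kd, ad, .inr (.inr h), h'⟩) hu
      exact Path.cons (u := []) (hS _ _ _ ⟨0, 0, .inl ⟨rfl, rfl, rfl, .inr rfl⟩, by simp [label]⟩)
        this
  | cat α β ihα ihβ =>
    intro i nx u hc hS hu
    rw [codeAt_cat] at hc
    have e1 : (cat α β).code.length = α.code.length + β.code.length + 1 := by simp [code]; omega
    rw [e1, ← Nat.add_assoc, ← Nat.add_assoc]
    obtain ⟨u, hu', v, hv, rfl⟩ := Language.mem_mul.1 hu
    have h1 := ihα (nx := 2 * (i + α.code.length + β.code.length)) hc.1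
      (fun q v q' ⟨kd, ad, h, h'⟩ => hS q v q' ⟨kd, ad, .inr (.inl h), h'⟩) hu'
    have h2 := ihβ (nx := nx) hc.2.1 (fun q v q' ⟨kd, ad, h, h'⟩ =>
        hS q v q' ⟨kd, ad, .inr (.inr h), h'⟩) hv
    exact Path.cons (u := []) (hS _ _ _ ⟨0, 0, .inl ⟨rfl, rfl, rfl, rfl⟩, by simp [label]⟩)
        (h1.append h2)
  | star α ih =>
    intro i nx u hc hS hu
    rw [codeAt_star] at hc
    have e1 : (star α).code.length = α.code.length + 1 := by simp [code]
    rw [e1, ← Nat.add_assoc]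
    -- The state of the star is the follow-up state of its body, so every factor of the word is a
    -- cycle through it.
    obtain ⟨L, rfl, hL⟩ := Language.mem_kstar.1 hu
    clear hu
    induction L with
    | nil => exact .single (hS _ _ _ ⟨0, 0, .inl ⟨rfl, rfl, rfl, .inl rfl⟩, by simp [label]⟩)
    | cons v L ihL =>
      have h1 := ih (nx := 2 * (i + α.code.length + 1)) hc.1
        (fun q v q' ⟨kd, ad, h, h'⟩ => hS q v q' ⟨kd, ad, .inr h, h'⟩) (hL v (by simp))
      have hL' : ∀ y ∈ L, y ∈ α.refLang := fun y hy => hL y (by simp [hy])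
      have h2 := ihL hL'
      exact Path.cons (u := [])
        (hS _ _ _ ⟨0, 0, .inl ⟨rfl, rfl, rfl, .inr rfl⟩, by simp [label]⟩) (h1.append h2)
  | bind x α ih =>
    intro i nx u hc hS hu
    rw [codeAt_bind] at hc
    have e1 : (bind x α).code.length = α.code.length + 2 := by simp [code]
    rw [e1, ← Nat.add_assoc]
    obtain ⟨u₁, hu₁, v, rfl, rfl⟩ := Language.mem_mul.1 hu
    obtain ⟨u₂, rfl, u, hu₂, rfl⟩ := Language.mem_mul.1 hu₁
    have h1 := ih (nx := 2 * (i + α.code.length + 2) + 1) hc.1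
      (fun q v q' ⟨kd, ad, h, h'⟩ => hS q v q' ⟨kd, ad, .inr (.inr h), h'⟩) hu₂
    have h2 : Path S (2 * (i + α.code.length + 2) + 1) [RefSym.cls x] nx := .single
      (hS _ _ _ ⟨3, i + α.code.length + 1, .inr (.inl ⟨rfl, rfl, rfl, rfl⟩),
        by simp [label, hc.2.2]⟩)
    rw [List.append_assoc]
    exact Path.cons (hS _ _ _ ⟨2, i + α.code.length + 1, .inl ⟨rfl, rfl, rfl, rfl⟩,
      by simp [label, hc.2.2]⟩) (h1.append h2)

/-- Every subformula has its own interval of states, which its edges leave only towards `nx`. The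
same bounds later show that all data of an edge lie in the range of the quantifiers. -/
theorem Edge.range {α : RegexFormula} : ∀ {i nx q kd ad q' : ℕ}, α.Edge i nx q kd ad q' →
    2 * i + 1 < q ∧ q ≤ 2 * (i + α.code.length) + 1 ∧
      (q' = nx ∨ 2 * i + 1 < q' ∧ q' ≤ 2 * (i + α.code.length) + 1) ∧
      ad < i + α.code.length ∧ kd < 4 := by
  induction α with
  | empty => exact fun h => h.elim
  | eps =>
    rintro i nx q kd ad q' ⟨rfl, rfl, rfl, rfl⟩
    simp [code]; omega
  | letter a =>
    rintro i nx q kd ad q' ⟨rfl, rfl, rfl, rfl⟩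
    simp [code]; omega
  | alt α β ihα ihβ =>
    have := α.code_length_pos
    have := β.code_length_pos
    rintro i nx q kd ad q' (⟨rfl, rfl, rfl, rfl | rfl⟩ | h | h) <;>
      simp only [code, List.length_append, List.length_singleton, true_or, true_and]
    · omega
    · omega
    · have := ihα h; omega
    · have := ihβ h; omega
  | cat α β ihα ihβ =>
    have := α.code_length_pos
    have := β.code_length_pos
    rintro i nx q kd ad q' (⟨rfl, rfl, rfl, rfl⟩ | h | h) <;>
      simp only [code, List.length_append, List.length_singleton, true_or, true_and]
    · omega
    · have := ihα h; omega
    · have := ihβ h; omega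
  | star α ih =>
    have := α.code_length_pos
    rintro i nx q kd ad q' (⟨rfl, rfl, rfl, rfl | rfl⟩ | h) <;>
      simp only [code, List.length_append, List.length_singleton, true_or, true_and]
    · omega
    · omega
    · have := ih h; omega
  | bind x α ih =>
    have := α.code_length_pos
    rintro i nx q kd ad q' (⟨rfl, rfl, rfl, rfl⟩ | ⟨rfl, rfl, rfl, rfl⟩ | h) <;>
      simp only [code, List.length_append, List.length_cons, List.length_nil, true_or, true_and]
    · omega
    · omega
    · have := ih h; omega

/-- The language of a state; the one of the state that follows after the formula is `K`. -/
def stateLang : RegexFormula → ℕ → Language RefSym → ℕ → Language RefSym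
  | empty, _, _, _ => 0
  | eps, _, K, _ => K
  | letter a, _, K, _ => {[RefSym.letter a]} * K
  | alt α β, i, K, q =>
    if q ≤ 2 * (i + α.code.length) + 1 then α.stateLang i K q
    else if q ≤ 2 * (i + α.code.length + β.code.length) + 1 then
      β.stateLang (i + α.code.length) K q
    else (alt α β).refLang * K
  | cat α β, i, K, q =>
    if q ≤ 2 * (i + α.code.length) + 1 then α.stateLang i (β.refLang * K) q
    else if q ≤ 2 * (i + α.code.length + β.code.length) + 1 then
      β.stateLang (i + α.code.length) K q
    else (cat α β).refLang * K
  | star α, i, K, q =>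
    if q ≤ 2 * (i + α.code.length) + 1 then α.stateLang i ((star α).refLang * K) q
    else (star α).refLang * K
  | bind x α, i, K, q =>
    if q ≤ 2 * (i + α.code.length) + 1 then α.stateLang i ({[RefSym.cls x]} * K) q
    else if q = 2 * (i + α.code.length + 2) then (bind x α).refLang * K
    else {[RefSym.cls x]} * K

theorem stateLang_start (α : RegexFormula) (i : ℕ) (K : Language RefSym) :
    α.stateLang i K (2 * (i + α.code.length)) = α.refLang * K := by
  cases α with
  | empty => simp [stateLang, refLang]
  | eps => simp [stateLang, refLang]
  | letter a => rfl
  | alt α β =>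
    have : (alt α β).code.length = α.code.length + β.code.length + 1 := by simp [code]; omega
    rw [this, stateLang, if_neg (by omega), if_neg (by omega)]
  | cat α β =>
    have : (cat α β).code.length = α.code.length + β.code.length + 1 := by simp [code]; omega
    rw [this, stateLang, if_neg (by omega), if_neg (by omega)]
  | star α =>
    have : (star α).code.length = α.code.length + 1 := by simp [code]
    rw [this, stateLang, if_neg (by omega)]
  | bind x α =>
    have : (bind x α).code.length = α.code.length + 2 := by simp [code]
    rw [this, stateLang, if_neg (by omega), if_pos (by omega)]

theorem label_zero (w : ℕ → ℕ) (ad : ℕ) : ({label w 0 ad} : Language RefSym) = 1 := rfl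

/-- The automaton is a system of inequations between the languages of its states. `L` solves it,
hence contains all that is spelled on the way to the end. `L` is prescribed only on the states of
`α`, relative to its own value at `nx`; so the same `L` serves for the subformulas with their
different follow-up states. -/
theorem Edge.sound {w : ℕ → ℕ} {α : RegexFormula} : ∀ {i nx : ℕ} {L : ℕ → Language RefSym},
    CodeAt w i α → (∀ q, 2 * i + 1 < q → q ≤ 2 * (i + α.code.length) + 1 →
      L q = α.stateLang i (L nx) q) →
    ∀ {q kd ad q' : ℕ}, α.Edge i nx q kd ad q' → {label w kd ad} * L q' ≤ L q := by
  induction α with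
  | empty => exact fun _ _ _ _ _ _ h => h.elim
  | eps =>
    rintro i nx L hc hL q kd ad q' ⟨rfl, rfl, rfl, rfl⟩
    rw [label_zero, one_mul, hL (2 * (i + 1)) (by omega) (by simp [code])]
    exact le_rfl
  | letter a =>
    rintro i nx L hc hL q kd ad q' ⟨rfl, rfl, rfl, rfl⟩
    rw [codeAt_letter] at hc
    rw [hL (2 * (i + 2)) (by omega) (by simp [code])]
    simp [label, stateLang, hc]
  | alt α β ihα ihβ =>
    intro i nx L hc hL q kd ad q' h
    rw [codeAt_alt] at hc
    have e1 : (alt α β).code.length = α.code.length + β.code.length + 1 := by simp [code]; omega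
    have hpα := α.code_length_pos
    have hpβ := β.code_length_pos
    have hs := hL (2 * (i + (alt α β).code.length)) (by omega) (by omega)
    rw [stateLang_start, refLang, add_mul, e1] at hs
    rw [e1] at hL
    have hα : ∀ q, 2 * i + 1 < q → q ≤ 2 * (i + α.code.length) + 1 →
        L q = α.stateLang i (L nx) q := by
      intro q h1 h2
      rw [hL q h1 (by omega), stateLang, if_pos h2]
    have hβ : ∀ q, 2 * (i + α.code.length) + 1 < q →
        q ≤ 2 * (i + α.code.length + β.code.length) + 1 →
        L q = β.stateLang (i + α.code.length) (L nx) q := by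
      intro q h1 h2
      rw [hL q (by omega) (by omega), stateLang, if_neg (by omega), if_pos h2]
    have hsα := hα (2 * (i + α.code.length)) (by omega) (by omega)
    have hsβ := hβ (2 * (i + α.code.length + β.code.length)) (by omega) (by omega)
    rw [stateLang_start] at hsα hsβ
    rcases h with ⟨rfl, rfl, rfl, rfl | rfl⟩ | h | h
    · rw [label_zero, one_mul, hsα, Nat.add_assoc i, Nat.add_assoc i, hs]
      exact le_self_add
    · rw [label_zero, one_mul, hsβ, Nat.add_assoc i, Nat.add_assoc i, hs]
      exact le_add_self
    · exact ihα hc.1 hα h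
    · exact ihβ hc.2.1 hβ h
  | cat α β ihα ihβ =>
    intro i nx L hc hL q kd ad q' h
    rw [codeAt_cat] at hc
    have e1 : (cat α β).code.length = α.code.length + β.code.length + 1 := by simp [code]; omega
    have hpα := α.code_length_pos
    have hpβ := β.code_length_pos
    have hs := hL (2 * (i + (cat α β).code.length)) (by omega) (by omega)
    rw [stateLang_start, refLang, mul_assoc, e1] at hs
    rw [e1] at hL
    have hβ : ∀ q, 2 * (i + α.code.length) + 1 < q →
        q ≤ 2 * (i + α.code.length + β.code.length) + 1 →
        L q = β.stateLang (i + α.code.length) (L nx) q := by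
      intro q h1 h2
      rw [hL q (by omega) (by omega), stateLang, if_neg (by omega), if_pos h2]
    have hsβ := hβ (2 * (i + α.code.length + β.code.length)) (by omega) (by omega)
    rw [stateLang_start] at hsβ
    have hα : ∀ q, 2 * i + 1 < q → q ≤ 2 * (i + α.code.length) + 1 →
        L q = α.stateLang i (L (2 * (i + α.code.length + β.code.length))) q := by
      intro q h1 h2
      rw [hL q h1 (by omega), stateLang, if_pos h2, hsβ]
    have hsα := hα (2 * (i + α.code.length)) (by omega) (by omega)
    rw [stateLang_start, hsβ] at hsα
    rcases h with ⟨rfl, rfl, rfl, rfl⟩ | h | h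
    · rw [label_zero, one_mul, hsα, Nat.add_assoc i, Nat.add_assoc i, hs]
    · exact ihα hc.1 hα h
    · exact ihβ hc.2.1 hβ h
  | star α ih =>
    intro i nx L hc hL q kd ad q' h
    rw [codeAt_star] at hc
    have e1 : (star α).code.length = α.code.length + 1 := by simp [code]
    have hpα := α.code_length_pos
    have hs := hL (2 * (i + (star α).code.length)) (by omega) (by omega)
    rw [stateLang_start, e1] at hs
    rw [e1] at hL
    have hα : ∀ q, 2 * i + 1 < q → q ≤ 2 * (i + α.code.length) + 1 →
        L q = α.stateLang i (L (2 * (i + α.code.length + 1))) q := by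
      intro q h1 h2
      rw [hL q h1 (by omega), stateLang, if_pos h2, Nat.add_assoc i, hs]
    have hsα := hα (2 * (i + α.code.length)) (by omega) (by omega)
    rw [stateLang_start, Nat.add_assoc i, hs, ← mul_assoc] at hsα
    -- The two summands correspond to the two edges that leave the state of the star.
    have hst : (star α).refLang = 1 + α.refLang * (star α).refLang :=
      (Language.one_add_self_mul_kstar_eq_kstar _).symm
    rw [hst, add_mul, one_mul, ← hsα] at hs
    rcases h with ⟨rfl, rfl, rfl, rfl | rfl⟩ | h
    · rw [label_zero, one_mul, Nat.add_assoc i, hs]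
      exact le_self_add
    · rw [label_zero, one_mul, Nat.add_assoc i, hs]
      exact le_add_self
    · exact ih hc.1 hα h
  | bind x α ih =>
    intro i nx L hc hL q kd ad q' h
    rw [codeAt_bind] at hc
    have e1 : (bind x α).code.length = α.code.length + 2 := by simp [code]
    have hpα := α.code_length_pos
    have hs := hL (2 * (i + (bind x α).code.length)) (by omega) (by omega)
    rw [stateLang_start, e1] at hs
    rw [e1] at hL
    have hs' : L (2 * (i + α.code.length + 2) + 1) = {[RefSym.cls x]} * L nx := by
      rw [hL _ (by omega) (by omega), stateLang, if_neg (by omega), if_neg (by omega)]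
    have hα : ∀ q, 2 * i + 1 < q → q ≤ 2 * (i + α.code.length) + 1 →
        L q = α.stateLang i (L (2 * (i + α.code.length + 2) + 1)) q := by
      intro q h1 h2
      rw [hL q h1 (by omega), stateLang, if_pos h2, hs']
    have hsα := hα (2 * (i + α.code.length)) (by omega) (by omega)
    rw [stateLang_start, hs'] at hsα
    rcases h with ⟨rfl, rfl, rfl, rfl⟩ | ⟨rfl, rfl, rfl, rfl⟩ | h
    · rw [hsα, Nat.add_assoc i _ 2, hs, refLang]
      simp [label, hc.2.2, mul_assoc]
    · rw [hs']
      simp [label, hc.2.2]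
    · exact ih hc.1 hα h

theorem path_iff {w : ℕ → ℕ} {i : ℕ} {α : RegexFormula} (hc : CodeAt w i α) (u : List RefSym) :
    Path (α.Step w i 0) (2 * (i + α.code.length)) u 0 ↔ u ∈ α.refLang := by
  constructor
  · intro h
    -- `0` is the accepting state. It is not a state of `α`, since these exceed `2 * i + 1`.
    let L : ℕ → Language RefSym := fun q => if q = 0 then 1 else α.stateLang i 1 q
    have hL : ∀ q, 2 * i + 1 < q → q ≤ 2 * (i + α.code.length) + 1 →
        L q = α.stateLang i (L 0) q := by
      intro q h1 _
      simp only [L, if_true, if_neg (show q ≠ 0 by omega)]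
    have key : ∀ q u q', Path (α.Step w i 0) q u q' → q' = 0 → u ∈ L q := by
      intro q u q' h
      induction h with
      | nil q =>
        rintro rfl
        simp only [L, if_true]
        exact Language.nil_mem_one
      | cons h1 _ ih =>
        intro h0
        obtain ⟨kd, ad, he, rfl⟩ := h1
        exact Edge.sound hc hL he (Language.mem_mul.2 ⟨_, rfl, _, ih h0, rfl⟩)
    have := key _ _ _ h rfl
    have hp := α.code_length_pos
    rw [hL _ (by omega) (by omega), stateLang_start] at this
    simpa [L] using this
  · exact path_of_mem α hc fun _ _ _ h => h

/-- Occurrence of a variable is syntactic: every binding contributes its opening edge, reachable or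
not. -/
theorem mem_vars_iff {w : ℕ → ℕ} {x : Var} (α : RegexFormula) : ∀ {i nx : ℕ}, CodeAt w i α →
    (x ∈ α.vars ↔ ∃ q ad q', α.Edge i nx q 2 ad q' ∧ w ad = x) := by
  induction α with
  | empty => intro i nx _; simp [vars, Edge]
  | eps => intro i nx _; simp [vars, Edge]
  | letter a => intro i nx _; simp [vars, Edge]
  | alt α β ihα ihβ =>
    intro i nx hc
    rw [codeAt_alt] at hc
    simp [vars, Edge, ihα (nx := nx) hc.1, ihβ (nx := nx) hc.2.1, or_and_right, exists_or]
  | cat α β ihα ihβ =>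
    intro i nx hc
    rw [codeAt_cat] at hc
    simp [vars, Edge, ihα (nx := 2 * (i + α.code.length + β.code.length)) hc.1,
      ihβ (nx := nx) hc.2.1, or_and_right, exists_or]
  | star α ih =>
    intro i nx hc
    rw [codeAt_star] at hc
    simp [vars, Edge, ih (nx := 2 * (i + α.code.length + 1)) hc.1]
  | bind y α ih =>
    intro i nx hc
    rw [codeAt_bind] at hc
    simp only [vars, Edge, Finset.mem_insert, ih (nx := 2 * (i + α.code.length + 2) + 1) hc.1,
      or_and_right, exists_or]
    simp [hc.2.2, eq_comm]

end RegexFormula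

end DocSpanners

/-! ### Accepting runs on a string, and what their states know about the variables. -/

namespace DocSpanners

/-! ### Runs on a string -/

theorem clean_append (u v : List RefSym) : clean (u ++ v) = clean u ++ clean v := by
  simp [clean]

theorem clean_letter (a : Letter) (v : List RefSym) : clean (.letter a :: v) = a :: clean v := by
  simp [clean]

/-- `q'` is reachable from `q` without reading a letter. -/
def OpReach (S : ℕ → List RefSym → ℕ → Prop) (q q' : ℕ) : Prop :=
  ∃ u, Path (fun q u q' => S q u q' ∧ clean u = []) q u q'

/-- The symbol `o` can occur on the way from `q₀` to `q`. -/
def Passed (S : ℕ → List RefSym → ℕ → Prop) (q₀ q : ℕ) (o : RefSym) : Prop :=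
  ∃ u, Path S q₀ u q ∧ o ∈ u

/-- An accepting run on `s`: `qs p` is the state that is left by reading the letter at position
`p`. -/
def IsRun (S : ℕ → List RefSym → ℕ → Prop) (q₀ : ℕ) (s : List Letter) (qs : ℕ → ℕ) : Prop :=
  OpReach S q₀ (qs 0) ∧
  (∀ p < s.length, ∃ r, S (qs p) [.letter (s.getD p 0)] r ∧ OpReach S r (qs (p + 1))) ∧
  qs s.length = 0

/-- A run, with the words `us p` that are read between the letters. -/
def IsRunOf (S : ℕ → List RefSym → ℕ → Prop) (q₀ : ℕ) (s : List Letter) (qs : ℕ → ℕ)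
    (us : ℕ → List RefSym) : Prop :=
  Path (fun q u q' => S q u q' ∧ clean u = []) q₀ (us 0) (qs 0) ∧
  (∀ p < s.length, ∃ r, S (qs p) [.letter (s.getD p 0)] r ∧
    Path (fun q u q' => S q u q' ∧ clean u = []) r (us (p + 1)) (qs (p + 1))) ∧
  qs s.length = 0

/-- The word that is read before the letter at position `p`. -/
def readBefore (s : List Letter) (us : ℕ → List RefSym) : ℕ → List RefSym
  | 0 => us 0
  | p + 1 => readBefore s us p ++ .letter (s.getD p 0) :: us (p + 1)

section Runs

variable {S : ℕ → List RefSym → ℕ → Prop} {q q₀ : ℕ} {s : List Letter} {qs : ℕ → ℕ}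
  {us : ℕ → List RefSym}

theorem IsRunOf.isRun (h : IsRunOf S q₀ s qs us) : IsRun S q₀ s qs := by
  refine ⟨⟨_, h.1⟩, fun p hp => ?_, h.2.2⟩
  obtain ⟨r, h1, h2⟩ := h.2.1 p hp
  exact ⟨r, h1, _, h2⟩

theorem IsRun.exists_words (h : IsRun S q₀ s qs) : ∃ us, IsRunOf S q₀ s qs us := by
  obtain ⟨⟨u, hu⟩, h2, h3⟩ := h
  choose! r hr us hus using h2
  exact ⟨fun p => Nat.casesOn p u us, hu, fun p hp => ⟨r p, hr p hp, hus p hp⟩, h3⟩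

theorem clean_of_opPath {q' : ℕ} {u : List RefSym}
    (h : Path (fun q u q' => S q u q' ∧ clean u = []) q u q') : clean u = [] := by
  induction h with
  | nil q => rfl
  | cons h1 _ ih => rw [clean_append, h1.2, ih]; rfl

theorem IsRunOf.path_readBefore (h : IsRunOf S q₀ s qs us) :
    ∀ p ≤ s.length, Path S q₀ (readBefore s us p) (qs p) ∧
      clean (readBefore s us p) = s.take p := by
  intro p
  induction p with
  | zero =>
    exact fun _ => ⟨h.1.mono fun _ _ _ h => h.1, by simp [readBefore, clean_of_opPath h.1]⟩
  | succ p ih =>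
    intro hp
    obtain ⟨h1, h2⟩ := ih (by omega)
    obtain ⟨r, h3, h4⟩ := h.2.1 p (by omega)
    refine ⟨h1.append (Path.cons h3 (h4.mono fun _ _ _ h => h.1)), ?_⟩
    rw [readBefore, clean_append, clean_letter, clean_of_opPath h4, h2, List.take_add_one,
      List.getElem?_eq_getElem (by omega)]
    simp [List.getD_eq_getElem?_getD, List.getElem?_eq_getElem (show p < s.length by omega)]

/-- All operations between two letters are read before `qs p` is left, so the remaining word is
empty or begins with a letter. This makes it possible to tell by counting letters on which side of
the cut an operation lies. -/
theorem IsRunOf.path_after (h : IsRunOf S q₀ s qs us) : ∀ m p, p + m = s.length →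
    ∃ v, readBefore s us s.length = readBefore s us p ++ v ∧ Path S (qs p) v 0 ∧
      (v = [] ∨ ∃ a v', v = .letter a :: v') := by
  intro m
  induction m with
  | zero =>
    rintro p hp
    obtain rfl : p = s.length := by omega
    exact ⟨[], by simp, by rw [h.2.2]; exact .nil 0, .inl rfl⟩
  | succ m ih =>
    intro p hp
    obtain ⟨v, h1, h2, -⟩ := ih (p + 1) (by omega)
    obtain ⟨r, h3, h4⟩ := h.2.1 p (by omega)
    refine ⟨.letter (s.getD p 0) :: (us (p + 1) ++ v), by simp [h1, readBefore], ?_,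
      .inr ⟨_, _, rfl⟩⟩
    exact Path.cons (u := [_]) h3 ((h4.mono fun _ _ _ h => h.1).append h2)

/-- Induction from the front of the path: an edge without letter is prepended to the first word, and
an edge with a letter creates a new position `0`, preceded by the empty word. -/
theorem exists_isRunOf (hS : ∀ q u q', S q u q' → clean u = [] ∨ ∃ a, u = [.letter a]) {q' : ℕ}
    {r : List RefSym} (h : Path S q r q') : q' = 0 → ∃ qs us, IsRunOf S q (clean r) qs us ∧
      readBefore (clean r) us (clean r).length = r := by
  induction h with
  | nil q =>
    rintro rfl
    exact ⟨fun _ => 0, fun _ => [], ⟨.nil 0, fun p hp => by simp [clean] at hp, rfl⟩, rfl⟩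
  | @cons q q₁ q₂ u v h1 _ ih =>
    intro h0
    obtain ⟨qs, us, ⟨k1, k2, k3⟩, k4⟩ := ih h0
    rcases hS _ _ _ h1 with hu | ⟨a, rfl⟩
    · have e : clean (u ++ v) = clean v := by rw [clean_append, hu, List.nil_append]
      let us' : ℕ → List RefSym := fun p => Nat.casesOn p (u ++ us 0) fun p => us (p + 1)
      have hus : ∀ p, readBefore (clean v) us' p = u ++ readBefore (clean v) us p := by
        intro p
        induction p with
        | zero => rfl
        | succ p ihp => simp [readBefore, ihp, us']
      rw [e]
      exact ⟨qs, us', ⟨Path.cons ⟨h1, hu⟩ k1, k2, k3⟩, by rw [hus, k4]⟩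
    · have e : clean ([.letter a] ++ v) = a :: clean v := clean_letter a v
      let us' : ℕ → List RefSym := fun p => Nat.casesOn p [] us
      let qs' : ℕ → ℕ := fun p => Nat.casesOn p q qs
      have hus : ∀ p, readBefore (a :: clean v) us' (p + 1) =
          .letter a :: readBefore (clean v) us p := by
        intro p
        induction p with
        | zero => rfl
        | succ p ihp => rw [readBefore, ihp]; simp [readBefore, us']
      rw [e]
      refine ⟨qs', us', ⟨.nil _, ?_, k3⟩, by rw [List.length_cons, hus, k4]; rfl⟩
      rintro (_ | p) hp
      · exact ⟨q₁, h1, k1⟩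
      · exact k2 p (by simpa using hp)

end Runs

/-! ### The status of a variable -/

/-- The opening of `x` for `z = 2`, the closing of `x` for `z = 3`. -/
def varOp (z : ℕ) (x : Var) : RefSym := if z = 2 then .opn x else .cls x

/-- The left or the right end of a span. -/
def Span.bound (z : ℕ) (sp : Span) : ℕ := if z = 2 then sp.lo else sp.hi

/-- If `o` lies beyond the cut, then the letter at the beginning of `v` precedes it, so strictly
more letters precede `o` than occur in `u`. If `o` lies in `u`, then so does all that precedes it.
As `o` occurs only once, the two cases exclude each other. -/
theorem mem_prefix_iff {o : RefSym} (ho : ∀ a, o ≠ .letter a) {u v r₁ r₂ : List RefSym}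
    (h : u ++ v = r₁ ++ o :: r₂) (hc : (u ++ v).count o = 1)
    (hv : v = [] ∨ ∃ a v', v = .letter a :: v') :
    o ∈ u ↔ (clean r₁).length ≤ (clean u).length := by
  rcases List.append_eq_append_iff.1 h with ⟨c, rfl, rfl⟩ | ⟨c, rfl, hc'⟩
  · rcases c with _ | ⟨b, c⟩
    · rcases hv with hv | ⟨a, v', hv⟩
      · simp at hv
      · simp at hv
        exact absurd hv.1 (ho a)
    · obtain ⟨a, rfl⟩ : ∃ a, b = .letter a := by
        rcases hv with hv | ⟨a, v', hv⟩
        · simp at hv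
        · simp at hv
          exact ⟨a, hv.1⟩
      constructor
      · intro hu
        have := List.count_pos_iff.2 hu
        simp only [List.count_append, List.cons_append, List.count_cons_self, List.count_cons] at hc
        omega
      · intro hl
        rw [clean_append, clean_letter] at hl
        simp at hl
  · rcases c with _ | ⟨b, c⟩
    · rcases hv with rfl | ⟨a, v', rfl⟩
      · simp at hc'
      · simp at hc'
        exact absurd hc'.1 (ho a)
    · simp at hc'
      simp [hc'.1, clean_append]

theorem Marks.varOp_mem_iff {V : Finset Var} {u v : List RefSym} {x : Var} {sp : Span} {z : ℕ}
    (hV : ValidRef V (u ++ v)) (hx : x ∈ V) (h : Marks (u ++ v) x sp)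
    (hv : v = [] ∨ ∃ a v', v = .letter a :: v') :
    varOp z x ∈ u ↔ sp.bound z ≤ (clean u).length + 1 := by
  obtain ⟨r₁, r₂, r₃, hr, h1, h2⟩ := h
  obtain ⟨hc1, hc2, -⟩ := hV x hx
  unfold varOp Span.bound
  split
  · rw [mem_prefix_iff (by simp) (r₁ := r₁) (r₂ := r₂ ++ [RefSym.cls x] ++ r₃)
      (by simpa using hr) hc1 hv]
    omega
  · rw [mem_prefix_iff (by simp) (r₁ := r₁ ++ [RefSym.opn x] ++ r₂) (r₂ := r₃)
      (by simpa using hr) hc2 hv]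
    have : clean [RefSym.opn x] = [] := rfl
    simp only [clean_append, List.length_append, this, List.length_nil]
    omega

namespace RegexFormula

variable {w : ℕ → ℕ} {i : ℕ} {α : RegexFormula} {s : List Letter}

theorem clean_label {nx q q' : ℕ} {u : List RefSym} (h : α.Step w i nx q u q') :
    clean u = [] ∨ ∃ a, u = [.letter a] := by
  obtain ⟨kd, ad, -, rfl⟩ := h
  unfold label
  split_ifs
  · exact .inr ⟨_, rfl⟩
  all_goals exact .inl rfl

/-- Along the run `qs`, the variables change their status as prescribed by the tuple `μ`. -/
def StatusOf (α : RegexFormula) (w : ℕ → ℕ) (i : ℕ) (s : List Letter) (qs : ℕ → ℕ)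
    (μ : Assignment) : Prop :=
  ∀ x ∈ α.vars, ∀ sp, μ x = some sp → ∀ z, ∀ p ≤ s.length,
    (Passed (α.Step w i 0) (2 * (i + α.code.length)) (qs p) (varOp z x) ↔ sp.bound z ≤ p + 1)

/-- Any path into `qs p`, continued by what the run reads from there, is an accepting path again. By
functionality its word contains the operation exactly once, and so does the word of the run itself.
Both have the same second part, so the operation occurs in both first parts or in neither. For the
run itself, `Marks.varOp_mem_iff` compares the position with the end of the span. -/
theorem statusOf_of_isRunOf (hα : α.Functional) (hc : CodeAt w i α) {qs : ℕ → ℕ}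
    {us : ℕ → List RefSym} {μ : Assignment}
    (h : IsRunOf (α.Step w i 0) (2 * (i + α.code.length)) s qs us)
    (hμ : IsTupleOfRef α.vars (readBefore s us s.length) μ) : α.StatusOf w i s qs μ := by
  intro x hx sp hsp z p hp
  obtain ⟨sp', hsp', hm⟩ := hμ.1 x hx
  obtain rfl : sp = sp' := by rw [hsp] at hsp'; exact Option.some.inj hsp'
  obtain ⟨v, h1, h2, h3⟩ := h.path_after (s.length - p) p (by omega)
  obtain ⟨h4, h5⟩ := h.path_readBefore p hp
  have hval : ValidRef α.vars (readBefore s us p ++ v) :=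
    hα _ ((path_iff hc _).1 (h4.append h2))
  rw [h1] at hm
  have key := hm.varOp_mem_iff (z := z) hval hx h3
  rw [h5, List.length_take, min_eq_left hp] at key
  rw [← key]
  have hone : ∀ r, ValidRef α.vars r → r.count (varOp z x) = 1 := by
    intro r hr
    unfold varOp
    split
    exacts [(hr x hx).1, (hr x hx).2.1]
  constructor
  · rintro ⟨u, hu, hu'⟩
    -- The operation occurs once in `u ++ v` and once in the word of the run. Being in `u`, it is
    -- not in `v`, hence it is in the prefix of the run.
    have e1 := hone _ (hα _ ((path_iff hc _).1 (hu.append h2)))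
    have e2 := hone _ hval
    rw [List.count_append] at e1 e2
    have := List.count_pos_iff.2 hu'
    exact List.count_pos_iff.1 (by omega)
  · exact fun hu => ⟨_, h4, hu⟩

theorem exists_tuple_of_isRun (hα : α.Functional) (hc : CodeAt w i α) {qs : ℕ → ℕ}
    (h : IsRun (α.Step w i 0) (2 * (i + α.code.length)) s qs) :
    ∃ μ ∈ α.spanner.rel s, α.StatusOf w i s qs μ := by
  obtain ⟨us, hus⟩ := h.exists_words
  obtain ⟨h1, h2⟩ := hus.path_readBefore s.length le_rfl
  rw [hus.2.2, path_iff hc] at h1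
  have hval := hα _ h1
  have hm : ∀ x ∈ α.vars, ∃ sp, Marks (readBefore s us s.length) x sp := by
    intro x hx
    obtain ⟨-, -, r₁, r₂, r₃, hr⟩ := hval x hx
    exact ⟨⟨(clean r₁).length + 1, (clean r₁).length + 1 + (clean r₂).length⟩, r₁, r₂, r₃, hr, rfl,
      rfl⟩
  have : Nonempty Span := ⟨⟨0, 0⟩⟩
  choose! sp hsp using hm
  have hμ : IsTupleOfRef α.vars (readBefore s us s.length)
      (fun x => if x ∈ α.vars then some (sp x) else none) :=
    ⟨fun x hx => ⟨sp x, by simp [hx], hsp x hx⟩, fun x hx => by simp [hx]⟩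
  exact ⟨_, ⟨_, h1, hval, by simpa using h2, hμ⟩, statusOf_of_isRunOf hα hc hus hμ⟩

theorem exists_isRun_of_tuple (hα : α.Functional) (hc : CodeAt w i α) {μ : Assignment}
    (h : μ ∈ α.spanner.rel s) :
    ∃ qs, IsRun (α.Step w i 0) (2 * (i + α.code.length)) s qs ∧ α.StatusOf w i s qs μ := by
  obtain ⟨r, h1, -, rfl, h3⟩ := h
  obtain ⟨qs, us, k1, k2⟩ := exists_isRunOf (fun _ _ _ => clean_label) ((path_iff hc _).2 h1) rfl
  exact ⟨qs, k1.isRun, statusOf_of_isRunOf hα hc k1 (by rw [k2]; exact h3)⟩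

end RegexFormula

/-! ### Joins -/

theorem restrict_restrict (μ : Assignment) {U V : Finset Var} (h : U ⊆ V) :
    (μ.restrict V).restrict U = μ.restrict U := by
  funext x
  simp only [Assignment.restrict]
  by_cases hx : x ∈ U
  · simp [hx, h hx]
  · simp [hx]

theorem IsTuple.restrict {μ : Assignment} {U V : Finset Var} {s : List Letter}
    (hμ : IsTuple V s μ) (h : U ⊆ V) : IsTuple U s (μ.restrict U) := by
  refine ⟨fun x hx => ?_, fun x hx => by simp [Assignment.restrict, hx]⟩
  obtain ⟨sp, h1, h2⟩ := hμ.1 x (h hx)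
  exact ⟨sp, by simp [Assignment.restrict, hx, h1], h2⟩

/-- The natural join of a list of spanners. -/
abbrev joinAll (l : List Spanner) : Spanner := l.foldr Spanner.join Spanner.unit

theorem subset_joinAll_vars {l : List Spanner} {P : Spanner} (hP : P ∈ l) :
    P.vars ⊆ (joinAll l).vars := by
  induction l with
  | nil => simp at hP
  | cons Q l ih =>
    rcases List.mem_cons.1 hP with rfl | h
    · exact Finset.subset_union_left
    · exact (ih h).trans Finset.subset_union_right

theorem exists_of_mem_joinAll_vars {l : List Spanner} {x : Var} (hx : x ∈ (joinAll l).vars) :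
    ∃ P ∈ l, x ∈ P.vars := by
  induction l with
  | nil => simp [joinAll, Spanner.unit] at hx
  | cons Q l ih =>
    rcases Finset.mem_union.1 hx with h | h
    · exact ⟨Q, by simp, h⟩
    · obtain ⟨P, hP, hxP⟩ := ih h
      exact ⟨P, by simp [hP], hxP⟩

/-- The partial joins disappear because a restriction to the variables of the tail, followed by one
to those of a member, is a single restriction. -/
theorem mem_joinAll {l : List Spanner} {s : List Letter} : ∀ {μ : Assignment},
    μ ∈ (joinAll l).rel s ↔
      IsTuple (joinAll l).vars s μ ∧ ∀ P ∈ l, μ.restrict P.vars ∈ P.rel s := by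
  induction l with
  | nil =>
    intro μ
    simp only [joinAll, List.foldr_nil, Spanner.unit, Set.mem_singleton_iff, IsTuple]
    simp [funext_iff]
  | cons Q l ih =>
    intro μ
    change (IsTuple (Q.vars ∪ (joinAll l).vars) s μ ∧ μ.restrict Q.vars ∈ Q.rel s ∧
      μ.restrict (joinAll l).vars ∈ (joinAll l).rel s) ↔
      IsTuple (Q.vars ∪ (joinAll l).vars) s μ ∧ _
    refine and_congr_right fun hμ => ?_
    rw [ih, List.forall_mem_cons]
    refine and_congr_right fun _ => ?_
    rw [and_iff_right (hμ.restrict Finset.subset_union_right)]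
    refine forall₂_congr fun P hP => ?_
    rw [restrict_restrict _ (subset_joinAll_vars hP)]

/-- If the tuples `ν a` agree on shared variables, then they have a join. -/
theorem exists_join {l : List Spanner} {s : List Letter} {ν : Spanner → Assignment}
    (hν : ∀ P ∈ l, ν P ∈ P.rel s)
    (hcomp : ∀ P ∈ l, ∀ Q ∈ l, ∀ x ∈ P.vars, x ∈ Q.vars → ν P x = ν Q x) :
    ∃ μ ∈ (joinAll l).rel s, ∀ P ∈ l, ∀ x ∈ P.vars, μ x = ν P x := by
  have hch : ∀ x, ∃ P, x ∈ (joinAll l).vars → P ∈ l ∧ x ∈ P.vars := by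
    intro x
    by_cases hx : x ∈ (joinAll l).vars
    · obtain ⟨P, h⟩ := exists_of_mem_joinAll_vars hx
      exact ⟨P, fun _ => h⟩
    · exact ⟨Spanner.unit, fun h => absurd h hx⟩
  choose c hcc using hch
  let μ : Assignment := fun x => if x ∈ (joinAll l).vars then ν (c x) x else none
  have hμ : ∀ P ∈ l, ∀ x ∈ P.vars, μ x = ν P x := by
    intro P hP x hx
    have hx' := subset_joinAll_vars hP hx
    obtain ⟨h1, h2⟩ := hcc x hx'
    simp only [μ, if_pos hx']
    exact hcomp _ h1 _ hP x h2 hx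
  refine ⟨μ, mem_joinAll.2 ⟨⟨fun x hx => ?_, fun x hx => by simp [μ, hx]⟩, fun P hP => ?_⟩, hμ⟩
  · obtain ⟨h1, h2⟩ := hcc x hx
    obtain ⟨sp, h3, h4⟩ := ((c x).isTuple s _ (hν _ h1)).1 x h2
    exact ⟨sp, by rw [hμ _ h1 x h2, h3], h4⟩
  · convert hν P hP using 1
    funext x
    by_cases hx : x ∈ P.vars
    · simp [Assignment.restrict, hx, hμ P hP x hx]
    · simp [Assignment.restrict, hx, (P.isTuple s _ (hν P hP)).2 x hx]

end DocSpanners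

/-! ### Answers of a regex CQ as synchronized runs of its atoms. -/

namespace DocSpanners

/-! ### Regex CQs and runs -/

/-- The bounds of the spans of the variables `ys` under `μ`, decreased by one. -/
def digit (ys : List Var) (μ : Assignment) (e : ℕ) : ℕ :=
  ((μ (ys.getD (e / 2) 0)).elim 0 fun sp => sp.bound (2 + e % 2)) - 1

theorem Span.IsSpanOf.bound {sp : Span} {s : List Letter} (h : sp.IsSpanOf s) (z : ℕ) :
    1 ≤ sp.bound z ∧ sp.bound z ≤ s.length + 1 := by
  obtain ⟨h1, h2, h3⟩ := h
  unfold Span.bound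
  split <;> omega

/-- The states `st i` of the automata of the atoms `α i` agree on the status of shared variables,
and this status is compatible with the first `d` digits `A` at position `p`. -/
def Consistent (α : ℕ → RegexFormula) (loc : ℕ → ℕ) (m : ℕ) (w : ℕ → ℕ) (ys : List Var) (A : ℕ → ℕ)
    (d p : ℕ) (st : ℕ → ℕ) : Prop :=
  (∀ i < m, ∀ i' < m, ∀ x ∈ (α i).vars, x ∈ (α i').vars → ∀ z, z = 2 ∨ z = 3 →
    (Passed ((α i).Step w (loc i) 0) (2 * (loc i + (α i).code.length)) (st i) (varOp z x) ↔
      Passed ((α i').Step w (loc i') 0) (2 * (loc i' + (α i').code.length)) (st i')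
        (varOp z x))) ∧
  ∀ e < d, ∀ i < m, ys.getD (e / 2) 0 ∈ (α i).vars →
    (Passed ((α i).Step w (loc i) 0) (2 * (loc i + (α i).code.length)) (st i)
      (varOp (2 + e % 2) (ys.getD (e / 2) 0)) ↔ A e ≤ p)

/-- From a tuple every atom gets a run, and the same spans dictate the status in all of them.
Conversely every run yields a tuple of its atom. Span ends lie between `1` and `s.length + 1`, so
they are determined by the status at the positions `0, …, s.length`; equal status of shared
variables means equal spans, and the tuples can be joined. -/
theorem RegexCQ.exists_answer_iff (q : RegexCQ) {α : ℕ → RegexFormula} {loc : ℕ → ℕ} {w : ℕ → ℕ}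
    (hα : ∀ i, α i = q.atoms.getD i .empty) (hc : ∀ i < q.atoms.length, RegexFormula.CodeAt w (loc i) (α i))
    {s : List Letter} {A : ℕ → ℕ} {d : ℕ} (hd : d ≤ 2 * q.head.card) :
    (∃ ν ∈ q.spanner.rel s, ∀ e < d, digit (q.head.sort (· ≤ ·)) ν e = A e) ↔
      ∃ qs : ℕ → ℕ → ℕ,
        (∀ i < q.atoms.length, IsRun ((α i).Step w (loc i) 0)
          (2 * (loc i + (α i).code.length)) s fun p => qs p i) ∧
        ∀ p ≤ s.length,
          Consistent α loc q.atoms.length w (q.head.sort (· ≤ ·)) A d p (qs p) := by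
  set ys := q.head.sort (· ≤ ·) with hys
  have hmem : ∀ i < q.atoms.length, α i ∈ q.atoms := by
    intro i hi
    rw [hα, List.getD_eq_getElem _ _ hi]
    exact List.getElem_mem hi
  have hex : ∀ β ∈ q.atoms, ∃ i < q.atoms.length, α i = β := by
    intro β hβ
    obtain ⟨i, hi, rfl⟩ := List.getElem_of_mem hβ
    exact ⟨i, hi, by rw [hα, List.getD_eq_getElem _ _ hi]⟩
  have hhead : ∀ e < d, ys.getD (e / 2) 0 ∈ q.head := by
    intro e he
    have : e / 2 < ys.length := by rw [hys, Finset.length_sort]; omega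
    rw [List.getD_eq_getElem _ _ this, ← Finset.mem_sort (· ≤ ·)]
    exact List.getElem_mem this
  constructor
  · rintro ⟨ν, ⟨μ, hμ, rfl⟩, hA⟩
    obtain ⟨hμ1, hμ2⟩ := mem_joinAll.1 hμ
    have hrun : ∀ i, ∃ qs, i < q.atoms.length →
        IsRun ((α i).Step w (loc i) 0) (2 * (loc i + (α i).code.length)) s qs ∧
          (α i).StatusOf w (loc i) s qs (μ.restrict (α i).vars) := by
      intro i
      by_cases hi : i < q.atoms.length
      · obtain ⟨qs, h⟩ := RegexFormula.exists_isRun_of_tuple (q.functional _ (hmem i hi)) (hc i hi)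
          (hμ2 _ (List.mem_map_of_mem (hmem i hi)))
        exact ⟨qs, fun _ => h⟩
      · exact ⟨fun _ => 0, fun h => absurd h hi⟩
    choose qs hqs using hrun
    have hst : ∀ i < q.atoms.length, ∀ x ∈ (α i).vars, ∃ sp, μ x = some sp ∧ ∀ z, ∀ p ≤ s.length,
        (Passed ((α i).Step w (loc i) 0) (2 * (loc i + (α i).code.length)) (qs i p)
          (varOp z x) ↔ sp.bound z ≤ p + 1) := by
      intro i hi x hx
      obtain ⟨sp, hsp, -⟩ := hμ1.1 x
        (subset_joinAll_vars (List.mem_map_of_mem (f := RegexFormula.spanner) (hmem i hi)) hx)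
      exact ⟨sp, hsp, (hqs i hi).2 x hx sp (by simp [Assignment.restrict, hx, hsp])⟩
    refine ⟨fun p i => qs i p, fun i hi => (hqs i hi).1, fun p hp => ⟨?_, ?_⟩⟩
    · intro i hi i' hi' x hx hx' z _
      obtain ⟨sp, h1, h2⟩ := hst i hi x hx
      obtain ⟨sp', h1', h2'⟩ := hst i' hi' x hx'
      obtain rfl : sp = sp' := by rw [h1] at h1'; exact Option.some.inj h1'
      rw [h2 z p hp, h2' z p hp]
    · intro e he i hi hx
      obtain ⟨sp, h1, h2⟩ := hst i hi _ hx
      have h3 := hA e he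
      simp only [digit, Assignment.restrict, hhead e he, if_true, h1, Option.elim] at h3
      rw [h2 _ p hp, ← h3]
      omega
  · rintro ⟨qs, hrun, hcons⟩
    have htup : ∀ i, ∃ μ, i < q.atoms.length → μ ∈ (α i).spanner.rel s ∧
        (α i).StatusOf w (loc i) s (fun p => qs p i) μ := by
      intro i
      by_cases hi : i < q.atoms.length
      · obtain ⟨μ, h⟩ := RegexFormula.exists_tuple_of_isRun (q.functional _ (hmem i hi)) (hc i hi)
          (hrun i hi)
        exact ⟨μ, fun _ => h⟩
      · exact ⟨fun _ => none, fun h => absurd h hi⟩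
    choose μ hμ using htup
    have hst : ∀ i < q.atoms.length, ∀ x ∈ (α i).vars, ∃ sp, μ i x = some sp ∧ sp.IsSpanOf s ∧
        ∀ z, ∀ p ≤ s.length,
          (Passed ((α i).Step w (loc i) 0) (2 * (loc i + (α i).code.length)) (qs p i)
            (varOp z x) ↔ sp.bound z ≤ p + 1) := by
      intro i hi x hx
      obtain ⟨sp, hsp, hs⟩ := ((α i).spanner.isTuple s _ (hμ i hi).1).1 x hx
      exact ⟨sp, hsp, hs, (hμ i hi).2 x hx sp hsp⟩
    have hidx : ∀ P, ∃ i, P ∈ q.atoms.map RegexFormula.spanner →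
        i < q.atoms.length ∧ (α i).spanner = P := by
      intro P
      by_cases hP : P ∈ q.atoms.map RegexFormula.spanner
      · obtain ⟨β, hβ, rfl⟩ := List.mem_map.1 hP
        obtain ⟨i, hi, rfl⟩ := hex β hβ
        exact ⟨i, fun _ => ⟨hi, rfl⟩⟩
      · exact ⟨0, fun h => absurd h hP⟩
    choose c hcc using hidx
    obtain ⟨ν, hν, hν'⟩ := exists_join (l := q.atoms.map RegexFormula.spanner) (s := s)
      (ν := fun P => μ (c P))
      (fun P hP => by
        obtain ⟨h1, h2⟩ := hcc P hP
        have := (hμ _ h1).1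
        rwa [h2] at this)
      (fun P hP Q hQ x hx hx' => by
        obtain ⟨h1, h2⟩ := hcc P hP
        obtain ⟨k1, k2⟩ := hcc Q hQ
        have hx : x ∈ (α (c P)).spanner.vars := by rw [h2]; exact hx
        have hx' : x ∈ (α (c Q)).spanner.vars := by rw [k2]; exact hx'
        obtain ⟨sp, e1, e2, e3⟩ := hst _ h1 x hx
        obtain ⟨sp', f1, f2, f3⟩ := hst _ k1 x hx'
        have hb : ∀ z, z = 2 ∨ z = 3 → sp.bound z = sp'.bound z := by
          intro z hz
          have hb1 := e2.bound z
          have hb2 := f2.bound z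
          have key : ∀ p ≤ s.length, sp.bound z ≤ p + 1 ↔ sp'.bound z ≤ p + 1 := by
            intro p hp
            rw [← e3 z p hp, ← f3 z p hp]
            exact (hcons p hp).1 _ h1 _ k1 x hx hx' z hz
          -- Each end `b` is tested at position `b - 1`, the first at which it counts as passed; so
          -- neither end exceeds the other.
          have := key (sp.bound z - 1) (by omega)
          have := key (sp'.bound z - 1) (by omega)
          omega
        have hb2 := hb 2 (.inl rfl)
        have hb3 := hb 3 (.inr rfl)
        have hsp : sp = sp' :=
          Span.ext (by simpa [Span.bound] using hb2) (by simpa [Span.bound] using hb3)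
        rw [e1, f1, hsp])
    refine ⟨ν.restrict q.head, ⟨ν, hν, rfl⟩, fun e he => ?_⟩
    -- A digit is visible only in the status of its variable in some atom; every head variable
    -- occurs in one.
    obtain ⟨P, hP, hx⟩ := exists_of_mem_joinAll_vars (q.head_subset (hhead e he))
    obtain ⟨h1, h2⟩ := hcc P hP
    have hx' : ys.getD (e / 2) 0 ∈ (α (c P)).spanner.vars := by rw [h2]; exact hx
    obtain ⟨sp, e1, e2, e3⟩ := hst _ h1 _ hx'
    simp only [digit, Assignment.restrict, hhead e he, if_true, hν' P hP _ hx, e1, Option.elim]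
    have hb1 := e2.bound (2 + e % 2)
    have key : ∀ p ≤ s.length, sp.bound (2 + e % 2) ≤ p + 1 ↔ A e ≤ p := by
      intro p hp
      rw [← e3 _ p hp]
      exact (hcons p hp).2 e he _ h1 hx'
    -- This bounds `A e` by the end minus one; if it were smaller, a test at position `A e` would
    -- give a contradiction.
    have h1 := key (sp.bound (2 + e % 2) - 1) (by omega)
    by_contra hne
    have h2 := key (A e) (by omega)
    omega

end DocSpanners

/-! ### The ten tabulated relations and the formulas that define them. -/

namespace DocSpanners

/-! ### A language for formulas -/

namespace Tm

instance : Add Tm := ⟨.op .add⟩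
instance : Sub Tm := ⟨.op .sub⟩
instance : Mul Tm := ⟨.op .mul⟩
instance : Div Tm := ⟨.op .div⟩
instance : Mod Tm := ⟨.op .mod⟩
instance (n : ℕ) : OfNat Tm n := ⟨.const n⟩

variable (w ρ : ℕ → ℕ) (s t : Tm)

theorem eval_add : (s + t).eval w ρ = s.eval w ρ + t.eval w ρ := rfl
theorem eval_sub : (s - t).eval w ρ = s.eval w ρ - t.eval w ρ := rfl
theorem eval_mul : (s * t).eval w ρ = s.eval w ρ * t.eval w ρ := rfl
theorem eval_div : (s / t).eval w ρ = s.eval w ρ / t.eval w ρ := rfl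
theorem eval_mod : (s % t).eval w ρ = s.eval w ρ % t.eval w ρ := rfl
theorem eval_ofNat (n : ℕ) : Tm.eval w ρ ofNat(n) = n := rfl
theorem eval_inp : (inp t).eval w ρ = w (t.eval w ρ) := rfl
theorem eval_var (i : ℕ) : (var i).eval w ρ = ρ i := rfl

variable (ℓ : ℕ)

theorem wf_add : (s + t).Wf ℓ ↔ s.Wf ℓ ∧ t.Wf ℓ := Iff.rfl
theorem wf_sub : (s - t).Wf ℓ ↔ s.Wf ℓ ∧ t.Wf ℓ := Iff.rfl
theorem wf_mul : (s * t).Wf ℓ ↔ s.Wf ℓ ∧ t.Wf ℓ := Iff.rfl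
theorem wf_div : (s / t).Wf ℓ ↔ s.Wf ℓ ∧ t.Wf ℓ := Iff.rfl
theorem wf_mod : (s % t).Wf ℓ ↔ s.Wf ℓ ∧ t.Wf ℓ := Iff.rfl
theorem wf_ofNat (n : ℕ) : Tm.Wf ℓ ofNat(n) ↔ True := Iff.rfl
theorem wf_inp : (inp t).Wf ℓ ↔ t.Wf ℓ := Iff.rfl
theorem wf_var (i : ℕ) : (var i).Wf ℓ ↔ i < ℓ ∧ i ≠ 2 := Iff.rfl

end Tm

/-- Formulas that are still to be placed at a level. -/
abbrev LFm : Type := ℕ → Fm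

namespace LFm

def eq (s t : Tm) : LFm := fun _ => .tm (.op .eq s t)
def lt (s t : Tm) : LFm := fun _ => .tm (.op .lt s t)
def tab (j : ℕ) (ts : List Tm) : LFm := fun _ => .tab j ts
def not (φ : LFm) : LFm := fun ℓ => .not (φ ℓ)
def and (φ ψ : LFm) : LFm := fun ℓ => .and (φ ℓ) (ψ ℓ)
def or (φ ψ : LFm) : LFm := not (and (not φ) (not ψ))
def imp (φ ψ : LFm) : LFm := not (and φ (not ψ))
def iff (φ ψ : LFm) : LFm := and (imp φ ψ) (imp ψ φ)
def le (s t : Tm) : LFm := not (lt t s)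
def ex (f : Tm → LFm) : LFm := fun ℓ => .ex (f (.var ℓ) (ℓ + 1))
def all (f : Tm → LFm) : LFm := not (ex fun t => not (f t))

/-- An entry of the table that is being filled, at an earlier stage. -/
def earlier (j : ℕ) (s : Tm) (ts : List Tm) : LFm := and (lt s (.var 10)) (tab j (s :: ts))

section Sat

variable {B : ℕ} {w : ℕ → ℕ} {I : ℕ → List ℕ → Prop} {ℓ : ℕ} {ρ : ℕ → ℕ} {s t : Tm} {φ ψ : LFm}

theorem sat_eq : Fm.Sat B w I ℓ (eq s t ℓ) ρ ↔ s.eval w ρ = t.eval w ρ := by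
  simp [eq, Fm.Sat, Tm.eval, BinOp.eval]

theorem sat_lt : Fm.Sat B w I ℓ (lt s t ℓ) ρ ↔ s.eval w ρ < t.eval w ρ := by
  simp [lt, Fm.Sat, Tm.eval, BinOp.eval]

theorem sat_not : Fm.Sat B w I ℓ (not φ ℓ) ρ ↔ ¬ Fm.Sat B w I ℓ (φ ℓ) ρ := Iff.rfl

theorem sat_and : Fm.Sat B w I ℓ (and φ ψ ℓ) ρ ↔
    Fm.Sat B w I ℓ (φ ℓ) ρ ∧ Fm.Sat B w I ℓ (ψ ℓ) ρ := Iff.rfl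

theorem sat_or : Fm.Sat B w I ℓ (or φ ψ ℓ) ρ ↔
    Fm.Sat B w I ℓ (φ ℓ) ρ ∨ Fm.Sat B w I ℓ (ψ ℓ) ρ := by
  simp only [or, sat_not, sat_and]; tauto

theorem sat_imp : Fm.Sat B w I ℓ (imp φ ψ ℓ) ρ ↔
    (Fm.Sat B w I ℓ (φ ℓ) ρ → Fm.Sat B w I ℓ (ψ ℓ) ρ) := by
  simp only [imp, sat_not, sat_and]; tauto

theorem sat_iff : Fm.Sat B w I ℓ (iff φ ψ ℓ) ρ ↔
    (Fm.Sat B w I ℓ (φ ℓ) ρ ↔ Fm.Sat B w I ℓ (ψ ℓ) ρ) := by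
  simp only [iff, sat_imp, sat_and]; tauto

theorem sat_le : Fm.Sat B w I ℓ (le s t ℓ) ρ ↔ s.eval w ρ ≤ t.eval w ρ := by
  simp only [le, sat_not, sat_lt, not_lt]

theorem sat_ex {f : Tm → LFm} : Fm.Sat B w I ℓ (ex f ℓ) ρ ↔
    ∃ v < B, Fm.Sat B w I (ℓ + 1) (f (.var ℓ) (ℓ + 1)) (Function.update ρ ℓ v) := Iff.rfl

theorem sat_all {f : Tm → LFm} : Fm.Sat B w I ℓ (all f ℓ) ρ ↔
    ∀ v < B, Fm.Sat B w I (ℓ + 1) (f (.var ℓ) (ℓ + 1)) (Function.update ρ ℓ v) := by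
  simp only [all, sat_not, sat_ex]; push Not; rfl

theorem sat_tab {j : ℕ} {ts : List Tm} {R : List ℕ → Prop} {r : ℕ}
    (h : ∀ xs, xs.length = r → (∀ x ∈ xs, x < B) → (I j xs ↔ R xs)) (hts : ts.length = r) :
    Fm.Sat B w I ℓ (tab j ts ℓ) ρ ↔
      (∀ x ∈ ts.map (·.eval w ρ), x < B) ∧ R (ts.map (·.eval w ρ)) :=
  and_congr_right fun hx => h _ (by simpa using hts) hx

/-- `Defines` controls the unfinished table only at stages below the current one. The comparison
that is built into `earlier` ensures this, so no side condition is left for the formulas. -/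
theorem sat_earlier {j : ℕ} {ts : List Tm} {R : List ℕ → Prop} {r X : ℕ}
    (h : ∀ x < X, ∀ xs, xs.length + 1 = r → (∀ y ∈ xs, y < B) → (I j (x :: xs) ↔ R (x :: xs)))
    (hts : ts.length + 1 = r) (hX : ρ 10 = X) :
    Fm.Sat B w I ℓ (earlier j s ts ℓ) ρ ↔ s.eval w ρ < X ∧
      (∀ x ∈ (s :: ts).map (·.eval w ρ), x < B) ∧ R ((s :: ts).map (·.eval w ρ)) := by
  rw [earlier, sat_and, sat_lt, Tm.eval_var, hX]
  refine and_congr_right fun hs => and_congr_right fun hx => ?_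
  rw [List.map_cons] at hx ⊢
  exact h _ hs _ (by simpa using hts) fun y hy => hx y (by simp [hy])

end Sat

section Wf

variable {ℓ : ℕ} {s t : Tm} {φ ψ : LFm}

theorem wf_eq : (eq s t ℓ).Wf ℓ ↔ s.Wf ℓ ∧ t.Wf ℓ := Iff.rfl
theorem wf_lt : (lt s t ℓ).Wf ℓ ↔ s.Wf ℓ ∧ t.Wf ℓ := Iff.rfl
theorem wf_tab {j : ℕ} {ts : List Tm} : (tab j ts ℓ).Wf ℓ ↔ ∀ t ∈ ts, t.Wf ℓ := Iff.rfl
theorem wf_not : (not φ ℓ).Wf ℓ ↔ (φ ℓ).Wf ℓ := Iff.rfl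
theorem wf_and : (and φ ψ ℓ).Wf ℓ ↔ (φ ℓ).Wf ℓ ∧ (ψ ℓ).Wf ℓ := Iff.rfl
theorem wf_or : (or φ ψ ℓ).Wf ℓ ↔ (φ ℓ).Wf ℓ ∧ (ψ ℓ).Wf ℓ := Iff.rfl
theorem wf_imp : (imp φ ψ ℓ).Wf ℓ ↔ (φ ℓ).Wf ℓ ∧ (ψ ℓ).Wf ℓ := Iff.rfl
theorem wf_iff : (iff φ ψ ℓ).Wf ℓ ↔ ((φ ℓ).Wf ℓ ∧ (ψ ℓ).Wf ℓ) ∧ (ψ ℓ).Wf ℓ ∧ (φ ℓ).Wf ℓ := Iff.rfl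
theorem wf_le : (le s t ℓ).Wf ℓ ↔ t.Wf ℓ ∧ s.Wf ℓ := Iff.rfl
theorem wf_ex {f : Tm → LFm} : (ex f ℓ).Wf ℓ ↔ (f (.var ℓ) (ℓ + 1)).Wf (ℓ + 1) := Iff.rfl
theorem wf_all {f : Tm → LFm} : (all f ℓ).Wf ℓ ↔ (f (.var ℓ) (ℓ + 1)).Wf (ℓ + 1) := Iff.rfl
theorem wf_earlier {j : ℕ} {ts : List Tm} : (earlier j s ts ℓ).Wf ℓ ↔
    (s.Wf ℓ ∧ (Tm.var 10).Wf ℓ) ∧ ∀ t ∈ s :: ts, t.Wf ℓ := Iff.rfl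

end Wf

end LFm

/-! ### The relations in the tables

`w` is the input, `n` its length; the words from `n` on are the digits that an answer is required to
have, and `d` is their number. -/

open RegexFormula

section Relations

variable (w : ℕ → ℕ) (n d : ℕ)

/-- The address of the `i`-th atom of the disjunct at address `h`. -/
def atomAddr (h : ℕ) : ℕ → ℕ
  | 0 => h + w h + 2
  | i + 1 => atomAddr h i + w (atomAddr h i) + 1

/-- The number of atoms of the disjunct at address `h`. -/
def numAtoms (h : ℕ) : ℕ := w (h + w h + 1)

/-- The address of the `u`-th disjunct. -/
def disjAddr : ℕ → ℕ
  | 0 => 1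
  | u + 1 => atomAddr w (disjAddr u) (numAtoms w (disjAddr u))

/-- The length comes first because tables are filled by recursion on the first argument, and the
codes of proper subformulas are shorter. `hasCodeF` replaces the quantifier over formulas by one
over the lengths of immediate subformulas. -/
def HasCode (l i : ℕ) : Prop := i + l ≤ n ∧ ∃ α : RegexFormula, α.code.length = l ∧ CodeAt w i α

def EdgeIn (l i nx q kd ad q' : ℕ) : Prop :=
  i + l ≤ n ∧ ∃ α : RegexFormula, α.code.length = l ∧ CodeAt w i α ∧ α.Edge i nx q kd ad q'

/-- The edges of the atom at address `a`. -/
def EdgeAt (a q kd ad q' : ℕ) : Prop := EdgeIn w n (w a) (a + 1) 0 q kd ad q'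

/-- Reachability by paths all of whose inner states are below `t`, for `z ≠ 0` without reading
letters. -/
def ReachBelow (a z : ℕ) : (t q q' : ℕ) → Prop
  | 0, q, q' => q = q' ∨ ∃ kd ad, EdgeAt w n a q kd ad q' ∧ (z = 0 ∨ kd ≠ 1)
  | t + 1, q, q' => ReachBelow a z t q q' ∨ ReachBelow a z t q t ∧ ReachBelow a z t t q'

def ReachAt (a z q q' : ℕ) : Prop := ReachBelow w n a z (2 * n + 2) q q'

/-- The variable at address `y` occurs in the atom at address `a`. -/
def HasVar (a y : ℕ) : Prop := ∃ q ad q', EdgeAt w n a q 2 ad q' ∧ w ad = w y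

/-- The variable at address `y` has been opened (`z = 2`) or closed (`z = 3`) in state `q`. -/
def PassedAt (a z q y : ℕ) : Prop := ∃ q₁ ad q₂, EdgeAt w n a q₁ z ad q₂ ∧ w ad = w y ∧
  ReachAt w n a 0 (2 * (a + 1 + w a)) q₁ ∧ ReachAt w n a 0 q₂ q

/-- The `i`-th component of the tuple of states `c`. -/
def stateOf (c i : ℕ) : ℕ := c / (2 * n + 2) ^ i % (2 * n + 2)

def ValidHeader (h : ℕ) : Prop := atomAddr w h (numAtoms w h) ≤ n

/-- The relation is tabulated for all `h` below `B`, most of which are no headers. Validity keeps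
the atoms inside the input, and `d ≤ 2 * w h` does so for the addresses of head variables; otherwise
bounded quantifiers and guarded table atoms might miss some of them. -/
def ConsistentAt (p h c : ℕ) : Prop :=
  ValidHeader w n h ∧ d ≤ 2 * w h ∧
  (∀ i < numAtoms w h, ∀ i' < numAtoms w h, ∀ y < n, HasVar w n (atomAddr w h i) y →
    HasVar w n (atomAddr w h i') y → ∀ z, z = 2 ∨ z = 3 →
      (PassedAt w n (atomAddr w h i) z (stateOf n c i) y ↔
        PassedAt w n (atomAddr w h i') z (stateOf n c i') y)) ∧
  ∀ e < d, ∀ i < numAtoms w h, HasVar w n (atomAddr w h i) (h + 1 + e / 2) →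
    (PassedAt w n (atomAddr w h i) (2 + e % 2) (stateOf n c i) (h + 1 + e / 2) ↔ w (n + e) ≤ p)

/-- The tuple of states `c` is reachable at position `p`, for the disjunct at address `h`; the
string starts after the address `S`. -/
def RunAt (B h : ℕ) : (p c : ℕ) → Prop
  | 0, c => ConsistentAt w n d 0 h c ∧ ∀ i < numAtoms w h, ReachAt w n (atomAddr w h i) 1
      (2 * (atomAddr w h i + 1 + w (atomAddr w h i))) (stateOf n c i)
  | p + 1, c => ConsistentAt w n d (p + 1) h c ∧ ∃ c₀ < B, RunAt B h p c₀ ∧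
      ∀ i < numAtoms w h, ∃ ad r, EdgeAt w n (atomAddr w h i) (stateOf n c₀ i) 1 ad r ∧
        w ad = w (disjAddr w (w 0) + (p + 1)) ∧ ReachAt w n (atomAddr w h i) 1 r (stateOf n c i)

/-- Some answer has the required digits. -/
def Extendable (B : ℕ) : Prop := ∃ u < w 0, ∃ c < B,
  RunAt w n d B (disjAddr w u) (w (disjAddr w (w 0))) c ∧
    ∀ i < numAtoms w (disjAddr w u), stateOf n c i = 0

/-- The number of arguments of the tables. -/
def arity : ℕ → ℕ
  | 0 => 3 | 1 => 2 | 2 => 2 | 3 => 7 | 4 => 5 | 5 => 2 | 6 => 4 | _ => 3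

/-- In the recursive tables `0`–`4`, `7` and `9` the first argument is the parameter of the
recursion. Apart from its own earlier stages, each relation is defined from tables with smaller
numbers. -/
def tableRel (B : ℕ) : ℕ → List ℕ → Prop
  | 0, [i, h, a] => a = atomAddr w h i
  | 1, [u, h] => h = disjAddr w u
  | 2, [l, i] => HasCode w n l i
  | 3, [l, i, nx, q, kd, ad, q'] => EdgeIn w n l i nx q kd ad q'
  | 4, [t, a, z, q, q'] => ReachBelow w n a z t q q'
  | 5, [a, y] => HasVar w n a y
  | 6, [a, z, q, y] => PassedAt w n a z q y
  | 7, [i, c, c'] => c' = c / (2 * n + 2) ^ i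
  | 8, [p, h, c] => ConsistentAt w n d p h c
  | 9, [p, h, c] => RunAt w n d B h p c
  | _, _ => False

end Relations

/-! ### Their definitions by formulas -/

open LFm

/-- In this and the other recursive formulas that go back by one stage, no case distinction is
needed to exclude the recursive part at stage `0`: the truncated `.var 10 - 1` is `0` there, and the
comparison in `earlier` fails. -/
def atomAddrF : LFm :=
  or (and (eq (.var 10) 0) (eq (.var 12) (.var 11 + .inp (.var 11) + 2)))
    (ex fun a => and (earlier 0 (.var 10 - 1) [.var 11, a]) (eq (.var 12) (a + .inp a + 1)))

def disjAddrF : LFm :=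
  or (and (eq (.var 10) 0) (eq (.var 11) 1))
    (ex fun h => and (earlier 1 (.var 10 - 1) [h])
      (tab 0 [.inp (h + .inp h + 1), h, .var 11]))

def hasCodeF : LFm :=
  and (le (.var 11 + .var 10) (.var 0))
    (or (and (eq (.var 10) 1) (or (eq (.inp (.var 11)) 0) (eq (.inp (.var 11)) 1)))
    (or (and (eq (.var 10) 2) (eq (.inp (.var 11)) 2))
    (or (ex fun l₁ => ex fun l₂ => and (eq (.var 10) (l₁ + l₂ + 1))
      (and (earlier 2 l₁ [.var 11]) (and (earlier 2 l₂ [.var 11 + l₁])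
        (or (eq (.inp (.var 11 + l₁ + l₂)) 3) (eq (.inp (.var 11 + l₁ + l₂)) 4)))))
    (ex fun l₁ => and (earlier 2 l₁ [.var 11])
      (or (and (eq (.var 10) (l₁ + 1)) (eq (.inp (.var 11 + l₁)) 5))
        (and (eq (.var 10) (l₁ + 2)) (eq (.inp (.var 11 + l₁)) 6)))))))

/-- The edge given by the arguments of table `3` is `(q, kd, ad, q')`. -/
def isEdgeF (q kd ad q' : Tm) : LFm :=
  and (eq (.var 13) q) (and (eq (.var 14) kd) (and (eq (.var 15) ad) (eq (.var 16) q')))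

def earlierEdgeF (l i nx : Tm) : LFm :=
  earlier 3 l [i, nx, .var 13, .var 14, .var 15, .var 16]

/-- Table `2` is consulted for both subformulas even if the edge comes from only one of them, since
the whole word must be the code of a formula. The formula `empty` has no edges and needs no case. -/
def edgeF : LFm :=
  and (le (.var 11 + .var 10) (.var 0))
    (or (and (eq (.var 10) 1) (and (eq (.inp (.var 11)) 1)
      (isEdgeF (2 * (.var 11 + 1)) 0 0 (.var 12))))
    (or (and (eq (.var 10) 2) (and (eq (.inp (.var 11)) 2)
      (isEdgeF (2 * (.var 11 + 2)) 1 (.var 11 + 1) (.var 12))))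
    (or (ex fun l₁ => ex fun l₂ => and (eq (.var 10) (l₁ + l₂ + 1))
      (and (tab 2 [l₁, .var 11]) (and (tab 2 [l₂, .var 11 + l₁])
        (or (and (eq (.inp (.var 11 + l₁ + l₂)) 3)
          (or (or (isEdgeF (2 * (.var 11 + l₁ + l₂ + 1)) 0 0 (2 * (.var 11 + l₁)))
            (isEdgeF (2 * (.var 11 + l₁ + l₂ + 1)) 0 0 (2 * (.var 11 + l₁ + l₂))))
            (or (earlierEdgeF l₁ (.var 11) (.var 12))
              (earlierEdgeF l₂ (.var 11 + l₁) (.var 12)))))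
        (and (eq (.inp (.var 11 + l₁ + l₂)) 4)
          (or (isEdgeF (2 * (.var 11 + l₁ + l₂ + 1)) 0 0 (2 * (.var 11 + l₁)))
            (or (earlierEdgeF l₁ (.var 11) (2 * (.var 11 + l₁ + l₂)))
              (earlierEdgeF l₂ (.var 11 + l₁) (.var 12)))))))))
    (ex fun l₁ => and (tab 2 [l₁, .var 11])
      (or (and (eq (.var 10) (l₁ + 1)) (and (eq (.inp (.var 11 + l₁)) 5)
        (or (or (isEdgeF (2 * (.var 11 + l₁ + 1)) 0 0 (.var 12))
            (isEdgeF (2 * (.var 11 + l₁ + 1)) 0 0 (2 * (.var 11 + l₁))))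
          (earlierEdgeF l₁ (.var 11) (2 * (.var 11 + l₁ + 1))))))
      (and (eq (.var 10) (l₁ + 2)) (and (eq (.inp (.var 11 + l₁)) 6)
        (or (isEdgeF (2 * (.var 11 + l₁ + 2)) 2 (.var 11 + l₁ + 1) (2 * (.var 11 + l₁)))
        (or (isEdgeF (2 * (.var 11 + l₁ + 2) + 1) 3 (.var 11 + l₁ + 1) (.var 12))
          (earlierEdgeF l₁ (.var 11) (2 * (.var 11 + l₁ + 2) + 1)))))))))))

def edgeAtF (a q kd ad q' : Tm) : LFm := tab 3 [.inp a, a + 1, 0, q, kd, ad, q']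

def reachBelowF : LFm :=
  or (and (eq (.var 10) 0) (or (eq (.var 13) (.var 14))
      (ex fun kd => ex fun ad => and (edgeAtF (.var 11) (.var 13) kd ad (.var 14))
        (or (eq (.var 12) 0) (not (eq kd 1))))))
    (or (earlier 4 (.var 10 - 1) [.var 11, .var 12, .var 13, .var 14])
      (and (earlier 4 (.var 10 - 1) [.var 11, .var 12, .var 13, .var 10 - 1])
        (earlier 4 (.var 10 - 1) [.var 11, .var 12, .var 10 - 1, .var 14])))

def reachAtF (a z q q' : Tm) : LFm := tab 4 [2 * .var 0 + 2, a, z, q, q']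

def hasVarF : LFm := ex fun q => ex fun ad => ex fun q' =>
  and (edgeAtF (.var 10) q 2 ad q') (eq (.inp ad) (.inp (.var 11)))

def passedAtF : LFm := ex fun q₁ => ex fun ad => ex fun q₂ =>
  and (edgeAtF (.var 10) q₁ (.var 11) ad q₂) (and (eq (.inp ad) (.inp (.var 13)))
    (and (reachAtF (.var 10) 0 (2 * (.var 10 + 1 + .inp (.var 10))) q₁)
      (reachAtF (.var 10) 0 q₂ (.var 12))))

def quotF : LFm :=
  or (and (eq (.var 10) 0) (eq (.var 12) (.var 11)))
    (ex fun c => and (earlier 7 (.var 10 - 1) [.var 11, c])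
      (eq (.var 12) (c / (2 * .var 0 + 2))))

/-- The `i`-th atom of the disjunct at `h` has the address `a`, and the `i`-th component of `c` is
`q`. -/
def atomStateF (h c i a q : Tm) : LFm :=
  and (lt i (.inp (h + .inp h + 1))) (and (tab 0 [i, h, a])
    (ex fun r => and (tab 7 [i, c, r]) (eq q (r % (2 * .var 0 + 2)))))

def consistentAtF : LFm :=
  and (ex fun a => and (tab 0 [.inp (.var 11 + .inp (.var 11) + 1), .var 11, a]) (le a (.var 0)))
  (and (le (.var 3) (2 * .inp (.var 11)))
  (and (all fun i => all fun a => all fun q => imp (atomStateF (.var 11) (.var 12) i a q)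
      (all fun i' => all fun a' => all fun q' => imp (atomStateF (.var 11) (.var 12) i' a' q')
        (all fun y => imp (lt y (.var 0)) (imp (tab 5 [a, y]) (imp (tab 5 [a', y])
          (and (iff (tab 6 [a, 2, q, y]) (tab 6 [a', 2, q', y]))
            (iff (tab 6 [a, 3, q, y]) (tab 6 [a', 3, q', y]))))))))
    (all fun i => all fun a => all fun q => imp (atomStateF (.var 11) (.var 12) i a q)
      (all fun e => imp (lt e (.var 3)) (imp (tab 5 [a, .var 11 + 1 + e / 2])
        (iff (tab 6 [a, 2 + e % 2, q, .var 11 + 1 + e / 2])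
          (le (.inp (.var 0 + e)) (.var 10))))))))

def runAtF : LFm :=
  and (tab 8 [.var 10, .var 11, .var 12])
    (or (and (eq (.var 10) 0) (all fun i => all fun a => all fun q =>
        imp (atomStateF (.var 11) (.var 12) i a q) (reachAtF a 1 (2 * (a + 1 + .inp a)) q)))
      (ex fun S => and (tab 1 [.inp 0, S]) (ex fun c => and (earlier 9 (.var 10 - 1) [.var 11, c])
        (all fun i => all fun a => all fun q => imp (atomStateF (.var 11) (.var 12) i a q)
          (all fun q₀ => imp (atomStateF (.var 11) c i a q₀)
            (ex fun ad => ex fun r => and (edgeAtF a q₀ 1 ad r)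
              (and (eq (.inp ad) (.inp (S + .var 10))) (reachAtF a 1 r q))))))))

def extendableF : LFm :=
  ex fun u => ex fun h => ex fun S => ex fun c => and (lt u (.inp 0)) (and (tab 1 [u, h])
    (and (tab 1 [.inp 0, S]) (and (tab 9 [.inp S, h, c])
      (all fun i => all fun a => all fun q => imp (atomStateF h c i a q) (eq q 0)))))

def tableF (j : ℕ) : Fm :=
  match j with
  | 0 => atomAddrF 13 | 1 => disjAddrF 12 | 2 => hasCodeF 12 | 3 => edgeF 17
  | 4 => reachBelowF 15 | 5 => hasVarF 12 | 6 => passedAtF 14 | 7 => quotF 13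
  | 8 => consistentAtF 13 | _ => runAtF 13

theorem arity_pos (j : ℕ) : 0 < arity j := by
  unfold arity; split <;> omega

theorem tableF_wf (j : ℕ) (hj : j < 10) : (tableF j).Wf (10 + arity j) ∧ arity j ≤ 7 := by
  refine ⟨?_, by unfold arity; split <;> omega⟩
  interval_cases j <;>
  simp [tableF, arity, atomAddrF, disjAddrF, hasCodeF, edgeF, isEdgeF, earlierEdgeF, edgeAtF,
    reachBelowF, reachAtF, hasVarF, passedAtF, quotF, atomStateF, consistentAtF, runAtF,
    wf_eq, wf_lt, wf_tab, wf_not, wf_and, wf_or, wf_imp, wf_iff, wf_le, wf_ex, wf_all, wf_earlier,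
    Tm.wf_add, Tm.wf_sub, Tm.wf_mul, Tm.wf_div, Tm.wf_mod, Tm.wf_ofNat, Tm.wf_inp, Tm.wf_var]

theorem extendableF_wf : (extendableF 10).Wf 10 := by
  simp [extendableF, atomStateF, wf_eq, wf_lt, wf_tab, wf_and, wf_imp, wf_ex, wf_all,
    Tm.wf_add, Tm.wf_mul, Tm.wf_mod, Tm.wf_ofNat, Tm.wf_inp, Tm.wf_var]

end DocSpanners

/-! ### The formulas define the relations: all witnesses lie below the bound. -/

namespace DocSpanners

open LFm RegexFormula

/-! ### Correctness of the definitions -/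

section Bounds

variable {B n : ℕ} {w : ℕ → ℕ}

theorem add_le_atomAddr (w : ℕ → ℕ) (h i : ℕ) : h + w h + 2 + i ≤ atomAddr w h i := by
  induction i with
  | zero => exact le_rfl
  | succ i ih => rw [atomAddr]; omega

theorem atomAddr_mono (w : ℕ → ℕ) (h : ℕ) : Monotone (atomAddr w h) :=
  monotone_nat_of_le_succ fun i => by rw [atomAddr]; omega

theorem ValidHeader.atomAddr_lt {h i : ℕ} (hv : ValidHeader w n h) (hi : i < numAtoms w h) :
    atomAddr w h i + 1 + w (atomAddr w h i) ≤ n := by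
  have h1 := (atomAddr_mono w h (show i + 1 ≤ numAtoms w h by omega)).trans hv
  rw [atomAddr] at h1
  omega

theorem ValidHeader.numAtoms_lt {h : ℕ} (hv : ValidHeader w n h) :
    h + w h + 2 + numAtoms w h ≤ n :=
  (add_le_atomAddr w h _).trans hv

theorem EdgeAt.bounds {a q kd ad q' : ℕ} (h : EdgeAt w n a q kd ad q') :
    a + 1 + w a ≤ n ∧ q < 2 * n + 2 ∧ kd < 4 ∧ ad < n ∧ q' < 2 * n + 2 := by
  obtain ⟨h1, α, h2, -, h3⟩ := h
  have := h3.range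
  omega

theorem stateOf_lt (n c i : ℕ) : stateOf n c i < 2 * n + 2 := Nat.mod_lt _ (by omega)

/-- The intermediate quotient is at most `c`, hence in range. The right-hand side separates the
range conditions from the meaning. -/
theorem atomState_iff {h c i a q : ℕ} : (i < w (h + w h + 1) ∧
    ((i < B ∧ h < B ∧ a < B) ∧ a = atomAddr w h i) ∧ ∃ r < B, ((i < B ∧ c < B ∧ r < B) ∧
      r = c / (2 * n + 2) ^ i) ∧ q = r % (2 * n + 2)) ↔
    (i < B ∧ h < B ∧ a < B ∧ c < B) ∧ i < numAtoms w h ∧ a = atomAddr w h i ∧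
      q = stateOf n c i := by
  constructor
  · rintro ⟨h1, ⟨h2, h3⟩, r, hr, ⟨h4, rfl⟩, h5⟩
    exact ⟨⟨h2.1, h2.2.1, h2.2.2, h4.2.1⟩, h1, h3, h5⟩
  · rintro ⟨h1, h2, h3, h4⟩
    have := Nat.div_le_self c ((2 * n + 2) ^ i)
    exact ⟨h2, ⟨⟨h1.1, h1.2.1, h1.2.2.1⟩, h3⟩, _, by omega,
      ⟨⟨h1.1, h1.2.2.2, by omega⟩, rfl⟩, h4⟩

/-- A valid header keeps indices, addresses and states of its atoms below `B`, so bounding the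
quantifiers loses nothing. -/
theorem forall_atomState {h c : ℕ} (hB : 2 * n + 10 ≤ B) (hv : ValidHeader w n h) (hh : h < B)
    (hc : c < B) {P : ℕ → ℕ → ℕ → Prop} :
    (∀ i < B, ∀ a < B, ∀ q < B, (i < B ∧ h < B ∧ a < B ∧ c < B) ∧ i < numAtoms w h ∧
      a = atomAddr w h i ∧ q = stateOf n c i → P i a q) ↔
    ∀ i < numAtoms w h, P i (atomAddr w h i) (stateOf n c i) := by
  constructor
  · intro H i hi
    have h1 := hv.atomAddr_lt hi
    have h2 := hv.numAtoms_lt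
    have h3 := stateOf_lt n c i
    exact H i (by omega) _ (by omega) _ (by omega) ⟨by omega, hi, rfl, rfl⟩
  · rintro H i _ a _ q _ ⟨-, hi, rfl, rfl⟩
    exact H i hi

end Bounds

section Defines

variable {B n d : ℕ} {w ρ₀ : ℕ → ℕ}

/-- The pattern of all proofs of this kind: after rewriting, the formula is the recursion equation
of the relation, except that its witnesses are restricted to values below `B`. Here the only
witness, the previous address, is smaller than the address given as an argument. -/
theorem defines_atomAddr :
    Defines B w ρ₀ arity (tableRel w n d B) 0 (atomAddrF 13) := by
  intro I ρ hρ hlt hI hself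
  simp only [atomAddrF, sat_or, sat_and, sat_eq, sat_ex, sat_earlier hself, Tm.eval_add,
    Tm.eval_sub, Tm.eval_ofNat, Tm.eval_inp, Tm.eval_var, Nat.reduceAdd, arity,
    List.length_cons, List.length_nil, Function.update_apply, List.map_cons, List.map_nil,
    List.forall_mem_cons, List.not_mem_nil, false_imp_iff, forall_const, and_true, tableRel,
    Nat.reduceEqDiff, if_true, if_false, argsOf, List.range_succ, List.range_zero,
    List.nil_append, List.cons_append]
  have hlt₂ := hlt 2 (by simp [arity])
  norm_num at hlt₂
  rcases hi : ρ 10 with _ | i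
  · simp [atomAddr]
  · have h1 : i < B := by have := hlt 0 (by simp [arity]); norm_num at this; omega
    have h2 : ρ 11 < B := by have := hlt 1 (by simp [arity]); norm_num at this; omega
    simp only [Nat.add_one_sub_one, Nat.add_eq_zero_iff, one_ne_zero, and_false, false_and,
      false_or, lt_add_iff_pos_right, Nat.lt_one_iff, pos_of_gt, true_and, h1, h2, atomAddr]
    constructor
    · rintro ⟨v, -, ⟨-, rfl⟩, h⟩
      exact h
    · intro h
      exact ⟨_, by omega, ⟨by omega, rfl⟩, h⟩

theorem defines_disjAddr :
    Defines B w ρ₀ arity (tableRel w n d B) 1 (disjAddrF 12) := by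
  intro I ρ hρ hlt hI hself
  simp only [disjAddrF, sat_or, sat_and, sat_eq, sat_ex, sat_earlier hself,
    sat_tab (hI 0 (by omega)), Tm.eval_add, Tm.eval_sub, Tm.eval_ofNat, Tm.eval_inp,
    Tm.eval_var, Nat.reduceAdd, arity, List.length_cons, List.length_nil,
    Function.update_apply, List.map_cons, List.map_nil, List.forall_mem_cons, List.not_mem_nil,
    false_imp_iff, forall_const, and_true, tableRel, Nat.reduceEqDiff, if_true, if_false,
    argsOf, List.range_succ, List.range_zero, List.nil_append, List.cons_append]
  have hlt₁ := hlt 1 (by simp [arity])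
  norm_num at hlt₁
  rcases hi : ρ 10 with _ | i
  · simp [disjAddr]
  · have h1 : i < B := by have := hlt 0 (by simp [arity]); norm_num at this; omega
    simp only [Nat.add_one_sub_one, Nat.add_eq_zero_iff, one_ne_zero, and_false, false_and,
      false_or, disjAddr]
    constructor
    · rintro ⟨v, -, ⟨-, -, rfl⟩, -, h⟩
      exact h
    · intro h
      -- The address of the next disjunct bounds that of the previous one and its number of atoms.
      have := add_le_atomAddr w (disjAddr w i) (numAtoms w (disjAddr w i))
      unfold numAtoms at this h
      exact ⟨_, by omega, ⟨by omega, ⟨by omega, by omega⟩, rfl⟩, ⟨by omega, by omega, by omega⟩, h⟩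

theorem defines_hasCode (h₀ : ρ₀ 0 = n) (hB : 2 * n + 10 ≤ B) :
    Defines B w ρ₀ arity (tableRel w n d B) 2 (hasCodeF 12) := by
  intro I ρ hρ hlt hI hself
  have r₀ : ρ 0 = n := (hρ 0 (by omega) (by omega)).trans h₀
  simp only [hasCodeF, sat_or, sat_and, sat_eq, sat_le, sat_ex, sat_earlier hself, Tm.eval_add,
    Tm.eval_ofNat, Tm.eval_inp, Tm.eval_var, Nat.reduceAdd, arity, List.length_cons,
    List.length_nil, Function.update_apply, List.map_cons, List.map_nil, List.forall_mem_cons,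
    List.not_mem_nil, false_imp_iff, forall_const, and_true, tableRel, Nat.reduceEqDiff,
    if_true, if_false, argsOf, List.range_succ, List.range_zero, List.nil_append,
    List.cons_append, r₀]
  have hl := hlt 0 (by simp [arity])
  have hi := hlt 1 (by simp [arity])
  norm_num at hl hi
  generalize ρ 10 = l at *
  generalize ρ 11 = i at *
  unfold HasCode
  refine and_congr_right fun hn => ?_
  constructor
  · rintro (⟨rfl, h | h⟩ | ⟨rfl, h⟩ | ⟨l₁, -, l₂, -, rfl, ⟨-, -, -, α, rfl, hα⟩,
      ⟨-, -, -, β, rfl, hβ⟩, h | h⟩ | ⟨l₁, -, ⟨-, -, -, α, rfl, hα⟩, ⟨rfl, h⟩ | ⟨rfl, h⟩⟩)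
    · exact ⟨.empty, rfl, codeAt_empty.2 h⟩
    · exact ⟨.eps, rfl, codeAt_eps.2 h⟩
    · exact ⟨.letter (w (i + 1)), rfl, codeAt_letter.2 ⟨h, rfl⟩⟩
    · exact ⟨.alt α β, by simp [code]; omega, codeAt_alt.2 ⟨hα, hβ, h⟩⟩
    · exact ⟨.cat α β, by simp [code]; omega, codeAt_cat.2 ⟨hα, hβ, h⟩⟩
    · exact ⟨.star α, by simp [code], codeAt_star.2 ⟨hα, h⟩⟩
    · exact ⟨.bind (w (i + α.code.length + 1)) α, by simp [code], codeAt_bind.2 ⟨hα, h, rfl⟩⟩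
  · rintro ⟨α, rfl, hα⟩
    cases α with
    | empty => exact .inl ⟨rfl, .inl (codeAt_empty.1 hα)⟩
    | eps => exact .inl ⟨rfl, .inr (codeAt_eps.1 hα)⟩
    | letter a => exact .inr (.inl ⟨rfl, (codeAt_letter.1 hα).1⟩)
    | alt α β =>
      obtain ⟨h1, h2, h3⟩ := codeAt_alt.1 hα
      have e : (alt α β).code.length = α.code.length + β.code.length + 1 := by simp [code]; omega
      rw [e] at hl hn ⊢
      exact .inr (.inr (.inl ⟨_, by omega, _, by omega, rfl, ⟨by omega, ⟨by omega, by omega⟩,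
        by omega, α, rfl, h1⟩, ⟨by omega, ⟨by omega, by omega⟩, by omega, β, rfl, h2⟩, .inl h3⟩))
    | cat α β =>
      obtain ⟨h1, h2, h3⟩ := codeAt_cat.1 hα
      have e : (cat α β).code.length = α.code.length + β.code.length + 1 := by simp [code]; omega
      rw [e] at hl hn ⊢
      exact .inr (.inr (.inl ⟨_, by omega, _, by omega, rfl, ⟨by omega, ⟨by omega, by omega⟩,
        by omega, α, rfl, h1⟩, ⟨by omega, ⟨by omega, by omega⟩, by omega, β, rfl, h2⟩, .inr h3⟩))
    | star α =>
      obtain ⟨h1, h2⟩ := codeAt_star.1 hα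
      have e : (star α).code.length = α.code.length + 1 := by simp [code]
      rw [e] at hl hn ⊢
      exact .inr (.inr (.inr ⟨_, by omega, ⟨by omega, ⟨by omega, by omega⟩,
        by omega, α, rfl, h1⟩, .inl ⟨rfl, h2⟩⟩))
    | bind x α =>
      obtain ⟨h1, h2, -⟩ := codeAt_bind.1 hα
      have e : (bind x α).code.length = α.code.length + 2 := by simp [code]
      rw [e] at hl hn ⊢
      exact .inr (.inr (.inr ⟨_, by omega, ⟨by omega, ⟨by omega, by omega⟩,
        by omega, α, rfl, h1⟩, .inr ⟨rfl, h2⟩⟩))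

theorem defines_edgeIn (h₀ : ρ₀ 0 = n) (hB : 2 * n + 10 ≤ B) :
    Defines B w ρ₀ arity (tableRel w n d B) 3 (edgeF 17) := by
  intro I ρ hρ hlt hI hself
  have r₀ : ρ 0 = n := (hρ 0 (by omega) (by omega)).trans h₀
  simp only [edgeF, isEdgeF, earlierEdgeF, sat_or, sat_and, sat_eq, sat_le, sat_ex,
    sat_earlier hself, sat_tab (hI 2 (by omega)), Tm.eval_add, Tm.eval_mul, Tm.eval_ofNat,
    Tm.eval_inp, Tm.eval_var, Nat.reduceAdd, arity, List.length_cons, List.length_nil,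
    Function.update_apply, List.map_cons, List.map_nil, List.forall_mem_cons, List.not_mem_nil,
    false_imp_iff, forall_const, and_true, tableRel, Nat.reduceEqDiff, if_true, if_false,
    argsOf, List.range_succ, List.range_zero, List.nil_append, List.cons_append, r₀]
  have hl := hlt 0 (by simp [arity])
  have hi := hlt 1 (by simp [arity])
  have hnx := hlt 2 (by simp [arity])
  have hq := hlt 3 (by simp [arity])
  have hkd := hlt 4 (by simp [arity])
  have had := hlt 5 (by simp [arity])
  have hq' := hlt 6 (by simp [arity])
  norm_num at hl hi hnx hq hkd had hq'
  generalize ρ 10 = l at *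
  generalize ρ 11 = i at *
  generalize ρ 12 = nx at *
  generalize ρ 13 = q at *
  generalize ρ 14 = kd at *
  generalize ρ 15 = ad at *
  generalize ρ 16 = q' at *
  unfold EdgeIn HasCode
  refine and_congr_right fun hn => ?_
  constructor
  · rintro (⟨rfl, h, h'⟩ | ⟨rfl, h, h'⟩ | ⟨l₁, -, l₂, -, rfl, ⟨-, -, α, rfl, hα⟩,
      ⟨-, -, β, rfl, hβ⟩, h⟩ | ⟨l₁, -, ⟨-, -, α, rfl, hα⟩, ⟨rfl, h, h'⟩ | ⟨rfl, h, h'⟩⟩)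
    · exact ⟨.eps, rfl, codeAt_eps.2 h, h'⟩
    · exact ⟨.letter (w (i + 1)), rfl, codeAt_letter.2 ⟨h, rfl⟩, h'⟩
    · rcases h with ⟨h, h'⟩ | ⟨h, h'⟩
      · refine ⟨.alt α β, by simp [code]; omega, codeAt_alt.2 ⟨hα, hβ, h⟩, ?_⟩
        rcases h' with (⟨h1, h2, h3, h4⟩ | ⟨h1, h2, h3, h4⟩) | ⟨-, -, -, γ, e, hγ, h'⟩ |
          ⟨-, -, -, γ, e, hγ, h'⟩
        · exact .inl ⟨h1, h2, h3, .inl h4⟩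
        · exact .inl ⟨h1, h2, h3, .inr h4⟩
        -- The table entry speaks of some formula `γ`, which address and length identify with `α`.
        · exact .inr (.inl (hγ.eq_of_length hα e ▸ h'))
        · exact .inr (.inr (hγ.eq_of_length hβ e ▸ h'))
      · refine ⟨.cat α β, by simp [code]; omega, codeAt_cat.2 ⟨hα, hβ, h⟩, ?_⟩
        rcases h' with h' | ⟨-, -, -, γ, e, hγ, h'⟩ | ⟨-, -, -, γ, e, hγ, h'⟩
        · exact .inl h'
        · exact .inr (.inl (hγ.eq_of_length hα e ▸ h'))
        · exact .inr (.inr (hγ.eq_of_length hβ e ▸ h'))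
    · refine ⟨.star α, by simp [code], codeAt_star.2 ⟨hα, h⟩, ?_⟩
      rcases h' with (⟨h1, h2, h3, h4⟩ | ⟨h1, h2, h3, h4⟩) | ⟨-, -, -, γ, e, hγ, h'⟩
      · exact .inl ⟨h1, h2, h3, .inl h4⟩
      · exact .inl ⟨h1, h2, h3, .inr h4⟩
      · exact .inr (hγ.eq_of_length hα e ▸ h')
    · refine ⟨.bind (w (i + α.code.length + 1)) α, by simp [code], codeAt_bind.2 ⟨hα, h, rfl⟩, ?_⟩
      rcases h' with h' | h' | ⟨-, -, -, γ, e, hγ, h'⟩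
      · exact .inl h'
      · exact .inr (.inl h')
      · exact .inr (.inr (hγ.eq_of_length hα e ▸ h'))
  · rintro ⟨α, rfl, hα, h⟩
    cases α with
    | empty => exact h.elim
    | eps => exact .inl ⟨rfl, codeAt_eps.1 hα, h⟩
    | letter a => exact .inr (.inl ⟨rfl, (codeAt_letter.1 hα).1, h⟩)
    | alt α β =>
      obtain ⟨h1, h2, h3⟩ := codeAt_alt.1 hα
      have hp := α.code_length_pos
      have hp' := β.code_length_pos
      have e : (alt α β).code.length = α.code.length + β.code.length + 1 := by simp [code]; omega
      rw [e] at hl hn ⊢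
      refine .inr (.inr (.inl ⟨_, by omega, _, by omega, rfl, ⟨⟨by omega, by omega⟩,
        by omega, α, rfl, h1⟩, ⟨⟨by omega, by omega⟩, by omega, β, rfl, h2⟩, .inl ⟨h3, ?_⟩⟩))
      rcases h with ⟨k1, k2, k3, k4 | k4⟩ | h | h
      · exact .inl (.inl ⟨k1, k2, k3, k4⟩)
      · exact .inl (.inr ⟨k1, k2, k3, k4⟩)
      · exact .inr (.inl ⟨by omega, by omega, by omega, α, rfl, h1, h⟩)
      · exact .inr (.inr ⟨by omega, by omega, by omega, β, rfl, h2, h⟩)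
    | cat α β =>
      obtain ⟨h1, h2, h3⟩ := codeAt_cat.1 hα
      have hp := α.code_length_pos
      have hp' := β.code_length_pos
      have e : (cat α β).code.length = α.code.length + β.code.length + 1 := by simp [code]; omega
      rw [e] at hl hn ⊢
      refine .inr (.inr (.inl ⟨_, by omega, _, by omega, rfl, ⟨⟨by omega, by omega⟩,
        by omega, α, rfl, h1⟩, ⟨⟨by omega, by omega⟩, by omega, β, rfl, h2⟩, .inr ⟨h3, ?_⟩⟩))
      rcases h with h | h | h
      · exact .inl h
      · exact .inr (.inl ⟨by omega, by omega, by omega, α, rfl, h1, h⟩)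
      · exact .inr (.inr ⟨by omega, by omega, by omega, β, rfl, h2, h⟩)
    | star α =>
      obtain ⟨h1, h2⟩ := codeAt_star.1 hα
      have hp := α.code_length_pos
      have e : (star α).code.length = α.code.length + 1 := by simp [code]
      rw [e] at hl hn ⊢
      refine .inr (.inr (.inr ⟨_, by omega, ⟨⟨by omega, by omega⟩,
        by omega, α, rfl, h1⟩, .inl ⟨rfl, h2, ?_⟩⟩))
      rcases h with ⟨k1, k2, k3, k4 | k4⟩ | h
      · exact .inl (.inl ⟨k1, k2, k3, k4⟩)
      · exact .inl (.inr ⟨k1, k2, k3, k4⟩)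
      · exact .inr ⟨by omega, by omega, by omega, α, rfl, h1, h⟩
    | bind x α =>
      obtain ⟨h1, h2, -⟩ := codeAt_bind.1 hα
      have hp := α.code_length_pos
      have e : (bind x α).code.length = α.code.length + 2 := by simp [code]
      rw [e] at hl hn ⊢
      refine .inr (.inr (.inr ⟨_, by omega, ⟨⟨by omega, by omega⟩,
        by omega, α, rfl, h1⟩, .inr ⟨rfl, h2, ?_⟩⟩))
      rcases h with h | h | h
      · exact .inl h
      · exact .inr (.inl h)
      · exact .inr (.inr ⟨by omega, by omega, by omega, α, rfl, h1, h⟩)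

theorem defines_reachBelow (hB : 2 * n + 10 ≤ B) :
    Defines B w ρ₀ arity (tableRel w n d B) 4 (reachBelowF 15) := by
  intro I ρ hρ hlt hI hself
  simp only [reachBelowF, edgeAtF, sat_or, sat_and, sat_eq, sat_not, sat_ex, sat_earlier hself,
    sat_tab (hI 3 (by omega)), Tm.eval_add, Tm.eval_sub, Tm.eval_ofNat, Tm.eval_inp,
    Tm.eval_var, Nat.reduceAdd, arity, List.length_cons, List.length_nil,
    Function.update_apply, List.map_cons, List.map_nil, List.forall_mem_cons, List.not_mem_nil,
    false_imp_iff, forall_const, and_true, tableRel, Nat.reduceEqDiff, if_true, if_false,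
    argsOf, List.range_succ, List.range_zero, List.nil_append, List.cons_append]
  have ht := hlt 0 (by simp [arity])
  have ha := hlt 1 (by simp [arity])
  have hz := hlt 2 (by simp [arity])
  have hq := hlt 3 (by simp [arity])
  have hq' := hlt 4 (by simp [arity])
  norm_num at ht ha hz hq hq'
  generalize ρ 11 = a at *
  generalize ρ 12 = z at *
  generalize ρ 13 = q at *
  generalize ρ 14 = q' at *
  rcases ht' : ρ 10 with _ | t
  · simp only [true_and, lt_irrefl, Nat.zero_sub, false_and, or_false, ReachBelow]
    refine or_congr_right ⟨?_, ?_⟩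
    · rintro ⟨kd, -, ad, -, ⟨-, h⟩, h'⟩
      exact ⟨kd, ad, h, h'⟩
    · rintro ⟨kd, ad, h, h'⟩
      obtain ⟨h1, h2, h3, h4, h5⟩ := EdgeAt.bounds h
      exact ⟨kd, by omega, ad, by omega, ⟨by omega, h⟩, h'⟩
  · rw [ht'] at ht
    have htB : t < B := by omega
    simp [ha, hz, hq, hq', htB, ReachBelow]

theorem defines_hasVar (hB : 2 * n + 10 ≤ B) :
    Defines B w ρ₀ arity (tableRel w n d B) 5 (hasVarF 12) := by
  intro I ρ hρ hlt hI hself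
  simp only [hasVarF, edgeAtF, sat_and, sat_eq, sat_ex, sat_tab (hI 3 (by omega)), Tm.eval_add,
    Tm.eval_ofNat, Tm.eval_inp, Tm.eval_var, Nat.reduceAdd, arity, List.length_cons,
    List.length_nil, Function.update_apply, List.map_cons, List.map_nil, List.forall_mem_cons,
    List.not_mem_nil, false_imp_iff, forall_const, and_true, tableRel, Nat.reduceEqDiff,
    if_true, if_false, argsOf, List.range_succ, List.range_zero, List.nil_append,
    List.cons_append]
  have ha := hlt 0 (by simp [arity])
  norm_num at ha
  constructor
  · rintro ⟨q, -, ad, -, q', -, ⟨-, h⟩, h'⟩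
    exact ⟨q, ad, q', h, h'⟩
  · rintro ⟨q, ad, q', h, h'⟩
    obtain ⟨h1, h2, h3, h4, h5⟩ := EdgeAt.bounds h
    exact ⟨q, by omega, ad, by omega, q', by omega, ⟨by omega, h⟩, h'⟩

theorem defines_passedAt (h₀ : ρ₀ 0 = n) (hB : 2 * n + 10 ≤ B) :
    Defines B w ρ₀ arity (tableRel w n d B) 6 (passedAtF 14) := by
  intro I ρ hρ hlt hI hself
  have r₀ : ρ 0 = n := (hρ 0 (by omega) (by omega)).trans h₀
  simp only [passedAtF, edgeAtF, reachAtF, sat_and, sat_eq, sat_ex, sat_tab (hI 3 (by omega)),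
    sat_tab (hI 4 (by omega)), Tm.eval_add, Tm.eval_mul, Tm.eval_ofNat, Tm.eval_inp,
    Tm.eval_var, Nat.reduceAdd, arity, List.length_cons, List.length_nil,
    Function.update_apply, List.map_cons, List.map_nil, List.forall_mem_cons, List.not_mem_nil,
    false_imp_iff, forall_const, and_true, tableRel, Nat.reduceEqDiff, if_true, if_false,
    argsOf, List.range_succ, List.range_zero, List.nil_append, List.cons_append, r₀]
  have ha := hlt 0 (by simp [arity])
  have hq := hlt 2 (by simp [arity])
  norm_num at ha hq
  constructor
  · rintro ⟨q, -, ad, -, q', -, ⟨-, h⟩, h', ⟨-, h1⟩, -, h2⟩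
    exact ⟨q, ad, q', h, h', h1, h2⟩
  · rintro ⟨q, ad, q', h, h', k1, k2⟩
    obtain ⟨h1, h2, h3, h4, h5⟩ := EdgeAt.bounds h
    exact ⟨q, by omega, ad, by omega, q', by omega, ⟨by omega, h⟩, h', ⟨by omega, k1⟩,
      ⟨by omega, by omega, by omega, by omega, by omega⟩, k2⟩

theorem defines_quot (h₀ : ρ₀ 0 = n) :
    Defines B w ρ₀ arity (tableRel w n d B) 7 (quotF 13) := by
  intro I ρ hρ hlt hI hself
  have r₀ : ρ 0 = n := (hρ 0 (by omega) (by omega)).trans h₀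
  simp only [quotF, sat_or, sat_and, sat_eq, sat_ex, sat_earlier hself, Tm.eval_add,
    Tm.eval_sub, Tm.eval_mul, Tm.eval_div, Tm.eval_ofNat, Tm.eval_var, Nat.reduceAdd, arity,
    List.length_cons, List.length_nil, Function.update_apply, List.map_cons, List.map_nil,
    List.forall_mem_cons, List.not_mem_nil, false_imp_iff, forall_const, and_true, tableRel,
    Nat.reduceEqDiff, if_true, if_false, argsOf, List.range_succ, List.range_zero,
    List.nil_append, List.cons_append, r₀]
  have hi := hlt 0 (by simp [arity])
  have hc := hlt 1 (by simp [arity])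
  norm_num at hi hc
  rcases hi' : ρ 10 with _ | i
  · simp
  · simp only [Nat.add_one_sub_one, Nat.add_eq_zero_iff, one_ne_zero, and_false, false_and,
      false_or, pow_succ, ← Nat.div_div_eq_div_mul]
    constructor
    · rintro ⟨v, -, ⟨-, -, rfl⟩, h⟩
      exact h
    · intro h
      have := Nat.div_le_self (ρ 11) ((2 * n + 2) ^ i)
      exact ⟨_, by omega, ⟨by omega, by omega, rfl⟩, h⟩

theorem defines_consistentAt (h₀ : ρ₀ 0 = n) (h₃ : ρ₀ 3 = d) (hB : 2 * n + 10 ≤ B) :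
    Defines B w ρ₀ arity (tableRel w n d B) 8 (consistentAtF 13) := by
  intro I ρ hρ hlt hI hself
  have r₀ : ρ 0 = n := (hρ 0 (by omega) (by omega)).trans h₀
  have r₃ : ρ 3 = d := (hρ 3 (by omega) (by omega)).trans h₃
  simp only [consistentAtF, atomStateF, sat_and, sat_eq, sat_lt, sat_le, sat_imp, sat_iff,
    sat_ex, sat_all, sat_tab (hI 0 (by omega)), sat_tab (hI 5 (by omega)),
    sat_tab (hI 6 (by omega)), sat_tab (hI 7 (by omega)), Tm.eval_add, Tm.eval_mul,
    Tm.eval_div, Tm.eval_mod, Tm.eval_ofNat, Tm.eval_inp, Tm.eval_var, Nat.reduceAdd, arity,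
    List.length_cons, List.length_nil, Function.update_apply, List.map_cons, List.map_nil,
    List.forall_mem_cons, List.not_mem_nil, false_imp_iff, forall_const, and_true, tableRel,
    Nat.reduceEqDiff, if_true, if_false, argsOf, List.range_succ, List.range_zero,
    List.nil_append, List.cons_append, r₀, r₃]
  have hh := hlt 1 (by simp [arity])
  have hc := hlt 2 (by simp [arity])
  norm_num at hh hc
  generalize ρ 10 = p at *
  generalize ρ 11 = h at *
  generalize ρ 12 = c at *
  unfold ConsistentAt
  have hv : (∃ v < B, ((w (h + w h + 1) < B ∧ h < B ∧ v < B) ∧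
      v = atomAddr w h (w (h + w h + 1))) ∧ v ≤ n) ↔ ValidHeader w n h := by
    constructor
    · rintro ⟨v, -, ⟨-, rfl⟩, h'⟩
      exact h'
    · intro h'
      have := add_le_atomAddr w h (numAtoms w h)
      unfold ValidHeader numAtoms at *
      exact ⟨_, by omega, ⟨by omega, rfl⟩, h'⟩
  rw [hv]
  -- The first two conjuncts are now available to discharge the range conditions in the others.
  refine and_congr_right fun hv => and_congr_right fun hd => ?_
  have hadd := add_le_atomAddr w h (numAtoms w h)
  have hv' := hv
  unfold ValidHeader at hv'
  simp only [atomState_iff, forall_atomState hB hv hh hc]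
  refine and_congr ?_ ?_
  · refine forall₂_congr fun i hi => forall₂_congr fun i' hi' => ?_
    have hai := hv.atomAddr_lt hi
    have hai' := hv.atomAddr_lt hi'
    have hst := stateOf_lt n c i
    have hst' := stateOf_lt n c i'
    constructor
    · intro H y hy k1 k2 z hz
      obtain ⟨H2, H3⟩ := H y (by omega) hy ⟨by omega, k1⟩ ⟨by omega, k2⟩
      rcases hz with rfl | rfl
      · rwa [and_iff_right (by omega), and_iff_right (by omega)] at H2
      · rwa [and_iff_right (by omega), and_iff_right (by omega)] at H3
    · intro H y _ hy k1 k2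
      refine ⟨?_, ?_⟩
      · rw [and_iff_right (by omega), and_iff_right (by omega)]
        exact H y hy k1.2 k2.2 2 (.inl rfl)
      · rw [and_iff_right (by omega), and_iff_right (by omega)]
        exact H y hy k1.2 k2.2 3 (.inr rfl)
  · constructor
    · intro H e he i hi k1
      have hai := hv.atomAddr_lt hi
      have hst := stateOf_lt n c i
      have := H i hi e (by omega) he ⟨by omega, k1⟩
      rwa [and_iff_right (by omega)] at this
    · intro H i hi e _ he k1
      have hai := hv.atomAddr_lt hi
      have hst := stateOf_lt n c i
      rw [and_iff_right (by omega)]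
      exact H e he i hi k1.2

theorem defines_runAt (h₀ : ρ₀ 0 = n) (hB : 2 * n + 10 ≤ B) (hw : w 0 < B) (hS : disjAddr w (w 0) < B) :
    Defines B w ρ₀ arity (tableRel w n d B) 9 (runAtF 13) := by
  intro I ρ hρ hlt hI hself
  have r₀ : ρ 0 = n := (hρ 0 (by omega) (by omega)).trans h₀
  simp only [runAtF, atomStateF, edgeAtF, reachAtF, sat_or, sat_and, sat_eq, sat_lt, sat_imp,
    sat_ex, sat_all, sat_earlier hself, sat_tab (hI 0 (by omega)), sat_tab (hI 1 (by omega)),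
    sat_tab (hI 3 (by omega)), sat_tab (hI 4 (by omega)), sat_tab (hI 7 (by omega)),
    sat_tab (hI 8 (by omega)), Tm.eval_add, Tm.eval_sub, Tm.eval_mul, Tm.eval_mod,
    Tm.eval_ofNat, Tm.eval_inp, Tm.eval_var, Nat.reduceAdd, arity, List.length_cons,
    List.length_nil, Function.update_apply, List.map_cons, List.map_nil, List.forall_mem_cons,
    List.not_mem_nil, false_imp_iff, forall_const, and_true, tableRel, Nat.reduceEqDiff,
    if_true, if_false, argsOf, List.range_succ, List.range_zero, List.nil_append,
    List.cons_append, r₀]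
  have hp := hlt 0 (by simp [arity])
  have hh := hlt 1 (by simp [arity])
  have hc := hlt 2 (by simp [arity])
  norm_num at hp hh hc
  generalize ρ 11 = h at *
  generalize ρ 12 = c at *
  refine (and_congr_left' (and_iff_right ⟨hp, hh, hc⟩)).trans ?_
  simp only [atomState_iff]
  rcases hp' : ρ 10 with _ | p
  · simp only [true_and, lt_irrefl, Nat.zero_sub, false_and, exists_false, and_false, or_false,
      RunAt]
    refine and_congr_right fun hcons => ?_
    -- Consistency contains the validity of the header, which makes the remaining range conditions
    -- redundant.
    have hv := hcons.1
    rw [forall_atomState hB hv hh hc (P := fun _ a q => (2 * n + 2 < B ∧ a < B ∧ 1 < B ∧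
      2 * (a + 1 + w a) < B ∧ q < B) ∧ ReachBelow w n a 1 (2 * n + 2) (2 * (a + 1 + w a)) q)]
    refine forall₂_congr fun i hi => ?_
    have hai := hv.atomAddr_lt hi
    have hst := stateOf_lt n c i
    rw [and_iff_right (by omega)]
    rfl
  · rw [hp'] at hp
    simp only [Nat.add_eq_zero_iff, one_ne_zero, and_false, false_and, false_or,
      Nat.add_one_sub_one, RunAt]
    refine and_congr_right fun hcons => ?_
    have hv := hcons.1
    constructor
    · rintro ⟨S, -, ⟨-, rfl⟩, c₀, hc₀, ⟨-, -, hr⟩, H⟩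
      refine ⟨c₀, hc₀, hr, fun i hi => ?_⟩
      have hai := hv.atomAddr_lt hi
      have hst := stateOf_lt n c i
      have hst₀ := stateOf_lt n c₀ i
      have hin := hv.numAtoms_lt
      obtain ⟨ad, -, r, -, ⟨-, h1⟩, h2, -, h3⟩ := H i (by omega) _ (by omega) _
        (show stateOf n c i < B by omega)
        ⟨by omega, hi, rfl, rfl⟩ _ (show stateOf n c₀ i < B by omega) ⟨by omega, hi, rfl, rfl⟩
      exact ⟨ad, r, h1, h2, h3⟩
    · rintro ⟨c₀, hc₀, hr, H⟩
      refine ⟨_, hS, ⟨⟨hw, hS⟩, rfl⟩, c₀, hc₀, ⟨by omega, by omega, hr⟩, ?_⟩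
      rintro i _ a _ q hq ⟨-, hi, rfl, rfl⟩ q₀ hq₀ ⟨-, -, -, rfl⟩
      obtain ⟨ad, r, h1, h2, h3⟩ := H i hi
      obtain ⟨b1, b2, b3, b4, b5⟩ := EdgeAt.bounds h1
      exact ⟨ad, by omega, r, by omega, ⟨by omega, h1⟩, h2, by omega, h3⟩

theorem tableF_defines (h₀ : ρ₀ 0 = n) (h₃ : ρ₀ 3 = d) (hB : 2 * n + 10 ≤ B) (hw : w 0 < B)
    (hS : disjAddr w (w 0) < B) (j : ℕ) (hj : j < 10) :
    Defines B w ρ₀ arity (tableRel w n d B) j (tableF j) := by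
  interval_cases j
  · exact defines_atomAddr
  · exact defines_disjAddr
  · exact defines_hasCode h₀ hB
  · exact defines_edgeIn h₀ hB
  · exact defines_reachBelow hB
  · exact defines_hasVar hB
  · exact defines_passedAt h₀ hB
  · exact defines_quot h₀
  · exact defines_consistentAt h₀ h₃ hB
  · exact defines_runAt h₀ hB hw hS

theorem sat_extendableF (h₀ : ρ₀ 0 = n) (hB : 2 * n + 10 ≤ B) (hw : w 0 < B)
    (hS : disjAddr w (w 0) < B) (hL : w (disjAddr w (w 0)) < B)
    (hv : ∀ u < w 0, ValidHeader w n (disjAddr w u)) {I : ℕ → List ℕ → Prop}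
    (hI : ∀ j < 10, ∀ xs, xs.length = arity j → (∀ x ∈ xs, x < B) →
      (I j xs ↔ tableRel w n d B j xs)) :
    (extendableF 10).Sat B w I 10 ρ₀ ↔ Extendable w n d B := by
  simp only [extendableF, atomStateF, sat_and, sat_eq, sat_lt, sat_imp, sat_ex, sat_all,
    sat_tab (hI 0 (by omega)), sat_tab (hI 1 (by omega)), sat_tab (hI 7 (by omega)),
    sat_tab (hI 9 (by omega)), Tm.eval_add, Tm.eval_mul, Tm.eval_mod, Tm.eval_ofNat, Tm.eval_inp,
    Tm.eval_var, Nat.reduceAdd, arity, List.length_cons, List.length_nil, Function.update_apply,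
    List.map_cons, List.map_nil, List.forall_mem_cons, List.not_mem_nil, false_imp_iff,
    forall_const, and_true, tableRel, Nat.reduceEqDiff, if_true, if_false, h₀, atomState_iff]
  constructor
  · rintro ⟨u, -, h, hh, S, -, c, hc, hu, ⟨-, rfl⟩, ⟨-, rfl⟩, ⟨-, hr⟩, H⟩
    rw [forall_atomState hB (hv u hu) hh hc (P := fun _ _ q => q = 0)] at H
    exact ⟨u, hu, c, hc, hr, H⟩
  · rintro ⟨u, hu, c, hc, hr, H⟩
    have := (hv u hu).numAtoms_lt
    have hh : disjAddr w u < B := by omega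
    refine ⟨u, by omega, _, hh, _, hS, c, hc, hu, ⟨by omega, rfl⟩, ⟨by omega, rfl⟩,
      ⟨by omega, hr⟩, ?_⟩
    rw [forall_atomState hB (hv u hu) hh hc (P := fun _ _ q => q = 0)]
    exact H

end Defines

end DocSpanners

/-! ### From the tabulated relations to the answers of the query. -/

namespace DocSpanners

open RegexFormula Relation

/-! ### Reachability -/

namespace Path

variable {S : ℕ → List RefSym → ℕ → Prop} {q q' : ℕ}

theorem exists_iff_reflTransGen :
    (∃ u, Path S q u q') ↔ ReflTransGen (fun q q' => ∃ u, S q u q') q q' := by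
  constructor
  · rintro ⟨u, h⟩
    induction h with
    | nil => exact .refl
    | cons h _ ih => exact .head ⟨_, h⟩ ih
  · intro h
    induction h using ReflTransGen.head_induction_on with
    | refl => exact ⟨_, .nil _⟩
    | head h _ ih =>
      obtain ⟨u, h⟩ := h
      obtain ⟨v, ih⟩ := ih
      exact ⟨_, .cons h ih⟩

end Path

/-- An occurrence of the symbol sits on one edge, so plain reachability before and after this edge
is all that a table must know. -/
theorem passed_iff {S : ℕ → List RefSym → ℕ → Prop} {q₀ q : ℕ} {o : RefSym} :
    Passed S q₀ q o ↔ ∃ q₁ v q₂, S q₁ v q₂ ∧ o ∈ v ∧ (∃ u, Path S q₀ u q₁) ∧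
      ∃ u, Path S q₂ u q := by
  constructor
  · rintro ⟨u, h, ho⟩
    induction h with
    | nil => simp at ho
    | cons h1 h2 ih =>
      rcases List.mem_append.1 ho with ho | ho
      · exact ⟨_, _, _, h1, ho, ⟨_, .nil _⟩, _, h2⟩
      · obtain ⟨q₁, v, q₂, k1, k2, ⟨u, k3⟩, k4⟩ := ih ho
        exact ⟨q₁, v, q₂, k1, k2, ⟨_, .cons h1 k3⟩, k4⟩
  · rintro ⟨q₁, v, q₂, h1, h2, ⟨u, h3⟩, u', h4⟩
    exact ⟨_, h3.append (.cons h1 h4), by simp [h2]⟩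

section Reach

variable {w : ℕ → ℕ} {n a z : ℕ}

theorem ReachBelow.sound {t q q' : ℕ} (h : ReachBelow w n a z t q q') :
    ReflTransGen (fun q q' => ∃ kd ad, EdgeAt w n a q kd ad q' ∧ (z = 0 ∨ kd ≠ 1)) q q' := by
  induction t generalizing q q' with
  | zero =>
    rcases h with rfl | h
    · exact .refl
    · exact .single h
  | succ t ih =>
    rcases h with h | ⟨h, h'⟩
    · exact ih h
    · exact (ih h).trans (ih h')

theorem ReachBelow.of_zero {q q' : ℕ} (h : ReachBelow w n a z 0 q q') :
    ∀ t, ReachBelow w n a z t q q'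
  | 0 => h
  | t + 1 => .inl (ReachBelow.of_zero h t)

/-- The correctness of Warshall's recursion, by induction on the bound: the intermediate state is
either the largest one allowed or is treated one level below. -/
theorem ReachBelow.trans : ∀ {t q m q' : ℕ}, m < t → ReachBelow w n a z t q m →
    ReachBelow w n a z t m q' → ReachBelow w n a z t q q'
  | 0, _, _, _, hm, _, _ => absurd hm (Nat.not_lt_zero _)
  | t + 1, q, m, q', hm, h, h' => by
    obtain rfl | hm : m = t ∨ m < t := by omega
    · refine .inr ⟨?_, ?_⟩
      · rcases h with h | h
        · exact h
        · exact h.1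
      · rcases h' with h' | h'
        · exact h'
        · exact h'.2
    · rcases h with h | ⟨h1, h2⟩ <;> rcases h' with h' | ⟨h1', h2'⟩
      · exact .inl (trans hm h h')
      · exact .inr ⟨trans hm h h1', h2'⟩
      · exact .inr ⟨h1, trans hm h2 h'⟩
      -- Both parts visit `t`; the detour through `m` between the two visits is cut out.
      · exact .inr ⟨h1, h2'⟩

/-- An inner state of a path is the target of an edge and hence below `2 * n + 2`, so at this bound
the restriction on inner states is void. -/
theorem reachAt_iff_reflTransGen {q q' : ℕ} : ReachAt w n a z q q' ↔
    ReflTransGen (fun q q' => ∃ kd ad, EdgeAt w n a q kd ad q' ∧ (z = 0 ∨ kd ≠ 1)) q q' := by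
  refine ⟨ReachBelow.sound, fun h => ?_⟩
  induction h using ReflTransGen.head_induction_on with
  | refl => exact ReachBelow.of_zero (.inl rfl) _
  | head h _ ih =>
    obtain ⟨kd, ad, h1, -⟩ := id h
    exact ReachBelow.trans h1.bounds.2.2.2.2 (ReachBelow.of_zero (.inr h) _) ih

theorem ReachAt.lt {q q' : ℕ} (h : ReachAt w n a z q q') (hq : q < 2 * n + 2) : q' < 2 * n + 2 := by
  rw [reachAt_iff_reflTransGen] at h
  induction h with
  | refl => exact hq
  | tail _ h _ =>
    obtain ⟨kd, ad, h1, -⟩ := h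
    exact h1.bounds.2.2.2.2

end Reach

/-! ### Atoms -/

theorem label_eq_letter {w : ℕ → ℕ} {kd ad b : ℕ} :
    [RefSym.letter b] = label w kd ad ↔ kd = 1 ∧ w ad = b := by
  unfold label
  split_ifs with h1 h2 h3 <;> simp [h1, eq_comm]

theorem clean_label_eq_nil {w : ℕ → ℕ} {kd ad : ℕ} : clean (label w kd ad) = [] ↔ kd ≠ 1 := by
  unfold label
  split_ifs with h1 h2 h3 <;> simp [h1, clean]

theorem varOp_mem_label {w : ℕ → ℕ} {kd ad z x : ℕ} (hz : z = 2 ∨ z = 3) :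
    varOp z x ∈ label w kd ad ↔ kd = z ∧ w ad = x := by
  unfold label varOp
  rcases hz with rfl | rfl <;> split_ifs with h1 h2 h3 h4 <;> simp_all [eq_comm]

/-- The formula `α` stands at the address `a`, preceded by its size. -/
def AtomAt (w : ℕ → ℕ) (n a : ℕ) (α : RegexFormula) : Prop :=
  w a = α.code.length ∧ CodeAt w (a + 1) α ∧ a + 1 + α.code.length ≤ n

namespace AtomAt

variable {w : ℕ → ℕ} {n a : ℕ} {α : RegexFormula}

theorem edgeAt_iff (h : AtomAt w n a α) {q kd ad q' : ℕ} :
    EdgeAt w n a q kd ad q' ↔ α.Edge (a + 1) 0 q kd ad q' := by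
  obtain ⟨h1, h2, h3⟩ := h
  constructor
  · rintro ⟨-, β, e, hβ, h⟩
    rwa [hβ.eq_of_length h2 (by omega)] at h
  · exact fun h => ⟨by omega, α, h1.symm, h2, h⟩

theorem reachAt_zero_iff (h : AtomAt w n a α) {q q' : ℕ} :
    ReachAt w n a 0 q q' ↔ ∃ u, Path (α.Step w (a + 1) 0) q u q' := by
  simp only [reachAt_iff_reflTransGen, Path.exists_iff_reflTransGen, h.edgeAt_iff, true_or,
    and_true, Step]
  refine iff_of_eq (congrArg (fun r => ReflTransGen r q q') ?_)
  ext q q'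
  exact ⟨fun ⟨kd, ad, h⟩ => ⟨_, kd, ad, h, rfl⟩, fun ⟨_, kd, ad, h, _⟩ => ⟨kd, ad, h⟩⟩

theorem reachAt_one_iff (h : AtomAt w n a α) {q q' : ℕ} :
    ReachAt w n a 1 q q' ↔ OpReach (α.Step w (a + 1) 0) q q' := by
  simp only [OpReach, reachAt_iff_reflTransGen, Path.exists_iff_reflTransGen, h.edgeAt_iff,
    one_ne_zero, false_or, Step]
  refine iff_of_eq (congrArg (fun r => ReflTransGen r q q') ?_)
  ext q q'
  constructor
  · rintro ⟨kd, ad, h, hk⟩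
    exact ⟨_, ⟨kd, ad, h, rfl⟩, clean_label_eq_nil.2 hk⟩
  · rintro ⟨_, ⟨kd, ad, h, rfl⟩, hk⟩
    exact ⟨kd, ad, h, clean_label_eq_nil.1 hk⟩

theorem hasVar_iff (h : AtomAt w n a α) {y : ℕ} : HasVar w n a y ↔ w y ∈ α.vars := by
  simp only [HasVar, h.edgeAt_iff, mem_vars_iff α h.2.1 (nx := 0)]

theorem passedAt_iff (h : AtomAt w n a α) {z q y : ℕ} (hz : z = 2 ∨ z = 3) :
    PassedAt w n a z q y ↔ Passed (α.Step w (a + 1) 0) (2 * (a + 1 + α.code.length)) q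
      (varOp z (w y)) := by
  simp only [PassedAt, h.edgeAt_iff, h.reachAt_zero_iff, passed_iff, h.1]
  constructor
  · rintro ⟨q₁, ad, q₂, h1, h2, h3, h4⟩
    exact ⟨q₁, _, q₂, ⟨z, ad, h1, rfl⟩, (varOp_mem_label hz).2 ⟨rfl, h2⟩, h3, h4⟩
  · rintro ⟨q₁, _, q₂, ⟨kd, ad, h1, rfl⟩, h2, h3, h4⟩
    obtain ⟨rfl, h5⟩ := (varOp_mem_label hz).1 h2
    exact ⟨q₁, ad, q₂, h1, h5, h3, h4⟩

theorem exists_addr_of_mem_vars (h : AtomAt w n a α) {x : Var} (hx : x ∈ α.vars) :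
    ∃ y < n, w y = x := by
  obtain ⟨q, ad, q', h1, h2⟩ := (mem_vars_iff α h.2.1 (nx := 0)).1 hx
  exact ⟨ad, (h.edgeAt_iff.2 h1).bounds.2.2.2.1, h2⟩

end AtomAt

/-! ### Tuples of states -/

/-- Expansion in base `2 * n + 2`. -/
theorem exists_stateOf (n : ℕ) : ∀ (m : ℕ) (st : ℕ → ℕ), (∀ i < m, st i < 2 * n + 2) →
    ∃ c < (2 * n + 2) ^ m, ∀ i < m, stateOf n c i = st i
  | 0, _, _ => ⟨0, by simp, by simp⟩
  | m + 1, st, h => by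
    obtain ⟨c, hc, hc'⟩ := exists_stateOf n m (fun i => st (i + 1)) fun i hi => h (i + 1) (by omega)
    have h0 := h 0 (by omega)
    refine ⟨st 0 + (2 * n + 2) * c, ?_, fun i hi => ?_⟩
    · rw [pow_succ']
      nlinarith
    · rcases i with _ | i
      · simp [stateOf, Nat.mod_eq_of_lt h0]
      · rw [← hc' i (by omega), stateOf, pow_succ', ← Nat.div_div_eq_div_mul,
          Nat.add_mul_div_left _ _ (by omega), Nat.div_eq_of_lt h0, Nat.zero_add, stateOf]

/-! ### Disjuncts -/

/-- The regex CQ `c` stands at the address `h`. -/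
structure DisjunctAt (w : ℕ → ℕ) (n h : ℕ) (c : RegexCQ) : Prop where
  size_head : w h = c.head.card
  head : ∀ y < c.head.card, w (h + 1 + y) = (c.head.sort (· ≤ ·)).getD y 0
  numAtoms : numAtoms w h = c.atoms.length
  atom : ∀ i < c.atoms.length, AtomAt w n (atomAddr w h i) (c.atoms.getD i .empty)
  valid : ValidHeader w n h

namespace DisjunctAt

variable {w : ℕ → ℕ} {n h d B : ℕ} {c : RegexCQ}

theorem consistentAt_iff (hc : DisjunctAt w n h c) (hd : d ≤ 2 * c.head.card) {p t : ℕ} :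
    ConsistentAt w n d p h t ↔ Consistent (fun i => c.atoms.getD i .empty)
      (fun i => atomAddr w h i + 1) c.atoms.length w (c.head.sort (· ≤ ·)) (fun e => w (n + e)) d p
      (stateOf n t) := by
  unfold ConsistentAt Consistent
  rw [and_iff_right hc.valid, hc.size_head, and_iff_right hd, hc.numAtoms]
  refine and_congr (forall₂_congr fun i hi => forall₂_congr fun i' hi' => ?_)
    (forall₂_congr fun e he => forall₂_congr fun i hi => ?_)
  · have hi := hc.atom i hi
    have hi' := hc.atom i' hi'
    simp only [hi.hasVar_iff, hi'.hasVar_iff]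
    constructor
    · intro H x hx hx' z hz
      -- Every variable of an atom is written somewhere in the input, so quantifying over addresses
      -- reaches all variables, whatever their names.
      obtain ⟨y, hy, rfl⟩ := hi.exists_addr_of_mem_vars hx
      rw [← hi.passedAt_iff hz, ← hi'.passedAt_iff hz]
      exact H y hy hx hx' z hz
    · intro H y _ hx hx' z hz
      rw [hi.passedAt_iff hz, hi'.passedAt_iff hz]
      exact H _ hx hx' z hz
  · have hi := hc.atom i hi
    rw [hi.hasVar_iff, hi.passedAt_iff (by omega), hc.head _ (by omega)]

/-- One direction unwinds the recursion into a sequence of state tuples. For the other, the states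
of the given runs are coded position by position; `hB` says that every code is in the range of the
quantifiers. -/
theorem runAt_iff (hc : DisjunctAt w n h c) (hd : d ≤ 2 * c.head.card) {s : List Letter}
    (hs : ∀ p < s.length, w (disjAddr w (w 0) + (p + 1)) = s.getD p 0)
    (hB : (2 * n + 2) ^ c.atoms.length ≤ B) :
    (∃ t < B, RunAt w n d B h s.length t ∧ ∀ i < c.atoms.length, stateOf n t i = 0) ↔
      ∃ qs : ℕ → ℕ → ℕ,
        (∀ i < c.atoms.length, IsRun ((c.atoms.getD i .empty).Step w (atomAddr w h i + 1) 0)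
          (2 * (atomAddr w h i + 1 + (c.atoms.getD i .empty).code.length)) s fun p => qs p i) ∧
        ∀ p ≤ s.length, Consistent (fun i => c.atoms.getD i .empty)
          (fun i => atomAddr w h i + 1) c.atoms.length w (c.head.sort (· ≤ ·))
          (fun e => w (n + e)) d p (qs p) := by
  constructor
  · rintro ⟨t, ht, hrun, hfin⟩
    have key : ∀ p ≤ s.length, ∀ t, RunAt w n d B h p t → ∃ qs : ℕ → ℕ → ℕ, qs p = stateOf n t ∧
        (∀ i < c.atoms.length,
          OpReach ((c.atoms.getD i .empty).Step w (atomAddr w h i + 1) 0)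
            (2 * (atomAddr w h i + 1 + (c.atoms.getD i .empty).code.length)) (qs 0 i) ∧
          ∀ p' < p, ∃ r, (c.atoms.getD i .empty).Step w (atomAddr w h i + 1) 0 (qs p' i)
            [.letter (s.getD p' 0)] r ∧
            OpReach ((c.atoms.getD i .empty).Step w (atomAddr w h i + 1) 0) r (qs (p' + 1) i)) ∧
        ∀ p' ≤ p, Consistent (fun i => c.atoms.getD i .empty)
          (fun i => atomAddr w h i + 1) c.atoms.length w (c.head.sort (· ≤ ·))
          (fun e => w (n + e)) d p' (qs p') := by
      intro p
      induction p with
      | zero =>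
        rintro - t ⟨h1, h2⟩
        refine ⟨fun _ => stateOf n t, rfl, fun i hi => ⟨?_, fun p' hp' => absurd hp' (by omega)⟩, ?_⟩
        · rw [← (hc.atom i hi).reachAt_one_iff, ← (hc.atom i hi).1]
          exact h2 i (hc.numAtoms ▸ hi)
        · intro p' hp'
          obtain rfl : p' = 0 := by omega
          exact (hc.consistentAt_iff hd).1 h1
      | succ p ih =>
        rintro hp t ⟨h1, t₀, -, h2, h3⟩
        obtain ⟨qs, k1, k2, k3⟩ := ih (by omega) t₀ h2
        -- Only position `p + 1` changes, so everything known up to `p` persists.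
        refine ⟨Function.update qs (p + 1) (stateOf n t), by simp, fun i hi => ⟨?_, ?_⟩, ?_⟩
        · rw [Function.update_of_ne (by omega)]
          exact (k2 i hi).1
        · intro p' hp'
          rw [Function.update_of_ne (show p' ≠ p + 1 by omega)]
          obtain rfl | hp' : p' = p ∨ p' < p := by omega
          · rw [Function.update_self, k1]
            obtain ⟨ad, r, l1, l2, l3⟩ := h3 i (hc.numAtoms ▸ hi)
            rw [hs _ (by omega)] at l2
            exact ⟨r, ⟨1, ad, (hc.atom i hi).edgeAt_iff.1 l1, label_eq_letter.2 ⟨rfl, l2⟩⟩,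
              (hc.atom i hi).reachAt_one_iff.1 l3⟩
          · rw [Function.update_of_ne (by omega)]
            exact (k2 i hi).2 p' hp'
        · intro p' hp'
          obtain rfl | hp' : p' = p + 1 ∨ p' ≤ p := by omega
          · rw [Function.update_self]
            exact (hc.consistentAt_iff hd).1 h1
          · rw [Function.update_of_ne (by omega)]
            exact k3 p' hp'
    obtain ⟨qs, k1, k2, k3⟩ := key s.length le_rfl t hrun
    exact ⟨qs, fun i hi => ⟨(k2 i hi).1, (k2 i hi).2, by simp only [k1, hfin i hi]⟩, k3⟩
  · rintro ⟨qs, hrun, hcons⟩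
    -- Only numbers below `2 * n + 2` can be components of a coded tuple. States of a run qualify:
    -- they are reachable from the initial state or from the target of an edge.
    have hlt : ∀ p ≤ s.length, ∀ i < c.atoms.length, qs p i < 2 * n + 2 := by
      intro p hp i hi
      have ha := hc.atom i hi
      obtain ⟨h1, h2, -⟩ := hrun i hi
      rcases p with _ | p
      · exact (ha.reachAt_one_iff.2 h1).lt (by have := ha.2.2; omega)
      · obtain ⟨r, ⟨kd, ad, l1, -⟩, l2⟩ := h2 p (by omega)
        exact (ha.reachAt_one_iff.2 l2).lt (ha.edgeAt_iff.2 l1).bounds.2.2.2.2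
    have hcongr : ∀ p ≤ s.length, ∀ t, (∀ i < c.atoms.length, stateOf n t i = qs p i) →
        ConsistentAt w n d p h t := by
      intro p hp t ht
      rw [hc.consistentAt_iff hd]
      obtain ⟨h1, h2⟩ := hcons p hp
      refine ⟨fun i hi i' hi' => ?_, fun e he i hi => ?_⟩
      · rw [ht i hi, ht i' hi']
        exact h1 i hi i' hi'
      · rw [ht i hi]
        exact h2 e he i hi
    have key : ∀ p ≤ s.length, ∀ t, (∀ i < c.atoms.length, stateOf n t i = qs p i) →
        RunAt w n d B h p t := by
      intro p
      induction p with
      | zero =>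
        intro hp t ht
        refine ⟨hcongr 0 hp t ht, fun i hi => ?_⟩
        rw [hc.numAtoms] at hi
        rw [(hc.atom i hi).reachAt_one_iff, ht i hi, (hc.atom i hi).1]
        exact (hrun i hi).1
      | succ p ih =>
        intro hp t ht
        obtain ⟨t₀, k1, k2⟩ := exists_stateOf n _ (qs p) (hlt p (by omega))
        refine ⟨hcongr _ hp t ht, t₀, by omega, ih (by omega) t₀ k2, fun i hi => ?_⟩
        rw [hc.numAtoms] at hi
        obtain ⟨r, ⟨kd, ad, l1, l2⟩, l3⟩ := (hrun i hi).2.1 p (by omega)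
        obtain ⟨rfl, l4⟩ := label_eq_letter.1 l2
        rw [k2 i hi, ht i hi, hs p (by omega)]
        exact ⟨ad, r, (hc.atom i hi).edgeAt_iff.2 l1, l4, (hc.atom i hi).reachAt_one_iff.2 l3⟩
    obtain ⟨t, k1, k2⟩ := exists_stateOf n _ (qs s.length) (hlt _ le_rfl)
    exact ⟨t, by omega, key _ le_rfl t k2, fun i hi => (k2 i hi).trans (hrun i hi).2.2⟩

end DisjunctAt

/-! ### Inputs -/

theorem slice_append_iff {w : ℕ → ℕ} {i : ℕ} {u v : List ℕ} :
    slice w i (u ++ v).length = u ++ v ↔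
      slice w i u.length = u ∧ slice w (i + u.length) v.length = v := by
  rw [List.length_append, slice_eq_append_iff]

theorem slice_cons_iff {w : ℕ → ℕ} {i x : ℕ} {v : List ℕ} :
    slice w i (x :: v).length = x :: v ↔ w i = x ∧ slice w (i + 1) v.length = v := by
  rw [← List.singleton_append, slice_append_iff]
  simp [slice_one]

theorem slice_getD {w : ℕ → ℕ} {i : ℕ} {u : List ℕ} (h : slice w i u.length = u) {t : ℕ}
    (ht : t < u.length) : w (i + t) = u.getD t 0 := by
  conv_rhs => rw [← h]
  simp [slice, ht]

/-- The size in front of each atom leads to the next one. The offset `j` lets the induction continue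
with the tail of the list. -/
theorem atoms_at {w f : ℕ → ℕ} (hf : ∀ i, f (i + 1) = f i + w (f i) + 1) :
    ∀ (L : List RegexFormula) (j : ℕ),
      slice w (f j) (L.flatMap fun α => sized α.code).length = (L.flatMap fun α => sized α.code) →
      f (j + L.length) = f j + (L.flatMap fun α => sized α.code).length ∧
      ∀ i < L.length, w (f (j + i)) = (L.getD i .empty).code.length ∧
        CodeAt w (f (j + i) + 1) (L.getD i .empty)
  | [], j, _ => by simp
  | α :: L, j, h => by
    rw [List.flatMap_cons, slice_append_iff, sized, slice_cons_iff] at h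
    have hj : f (j + 1) = f j + (α.code.length + 1) := by rw [hf, h.1.1]; omega
    obtain ⟨h1, h2⟩ := atoms_at hf L (j + 1) (by rw [hj]; exact h.2)
    refine ⟨?_, fun i hi => ?_⟩
    · rw [List.length_cons, ← Nat.add_assoc, Nat.add_right_comm, h1, hj]
      simp [sized]
      omega
    · rcases i with _ | i
      · exact h.1
      · have := h2 i (by simpa using hi)
        rwa [Nat.add_assoc, Nat.add_comm 1] at this

theorem disjunctAt_of_slice {w : ℕ → ℕ} {n h : ℕ} {c : RegexCQ}
    (hs : slice w h c.code.length = c.code) (hn : h + c.code.length ≤ n) :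
    DisjunctAt w n h c ∧ atomAddr w h (numAtoms w h) = h + c.code.length := by
  have hlen : c.code.length = c.head.card + 2 +
      (c.atoms.flatMap fun α => sized α.code).length := by
    simp [RegexCQ.code, sized]; omega
  rw [RegexCQ.code, slice_append_iff, slice_append_iff, sized, slice_cons_iff, slice_cons_iff] at hs
  obtain ⟨⟨⟨h1, h2⟩, h3, -⟩, h4⟩ := hs
  simp only [List.length_append, List.length_cons, Finset.length_sort, List.length_nil] at *
  have h3' : numAtoms w h = c.atoms.length := by rw [numAtoms, h1]; exact h3
  have h0 : atomAddr w h 0 = h + c.head.card + 2 := by rw [atomAddr, h1]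
  obtain ⟨k1, k2⟩ := atoms_at (f := atomAddr w h)
    (fun i => by rw [atomAddr]) c.atoms 0 (by rw [h0]; convert h4 using 2; omega)
  rw [Nat.zero_add, h0] at k1
  simp only [Nat.zero_add] at k2
  have hend : atomAddr w h (numAtoms w h) = h + c.code.length := by rw [h3', k1, hlen]; omega
  have hv : ValidHeader w n h := by unfold ValidHeader; omega
  refine ⟨⟨h1, fun y hy => ?_, h3', fun i hi => ?_, hv⟩, hend⟩
  · exact slice_getD (by simpa using h2) (by simpa using hy)
  · have := hv.atomAddr_lt (h3' ▸ hi)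
    obtain ⟨l1, l2⟩ := k2 i hi
    exact ⟨l1, l2, by omega⟩

theorem disjuncts_at {w : ℕ → ℕ} {n : ℕ} :
    ∀ (L : List RegexCQ) (j : ℕ),
      slice w (disjAddr w j) (L.flatMap RegexCQ.code).length = L.flatMap RegexCQ.code →
      disjAddr w j + (L.flatMap RegexCQ.code).length ≤ n →
      disjAddr w (j + L.length) = disjAddr w j + (L.flatMap RegexCQ.code).length ∧
      ∀ i, ∀ hi : i < L.length, DisjunctAt w n (disjAddr w (j + i)) L[i]
  | [], j, _, _ => by simp
  | c :: L, j, h, hn => by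
    rw [List.flatMap_cons, slice_append_iff] at h
    rw [List.flatMap_cons, List.length_append] at hn
    obtain ⟨h1, h2⟩ := disjunctAt_of_slice (n := n) h.1 (by omega)
    have hj : disjAddr w (j + 1) = disjAddr w j + c.code.length := by rw [disjAddr, h2]
    obtain ⟨k1, k2⟩ := disjuncts_at (n := n) L (j + 1) (by rw [hj]; exact h.2) (by omega)
    refine ⟨?_, fun i hi => ?_⟩
    · rw [List.length_cons, ← Nat.add_assoc, Nat.add_right_comm, k1, hj, List.flatMap_cons,
        List.length_append]
      omega
    · rcases i with _ | i
      · exact h1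
      · have := k2 i (by simpa using hi)
        rwa [Nat.add_assoc, Nat.add_comm 1] at this

/-- The query `q` and the string `s` stand in the first `n` cells. -/
structure InputAt (w : ℕ → ℕ) (n : ℕ) (q : RegexUCQ) (s : List Letter) : Prop where
  numDisjuncts : w 0 = q.disjuncts.length
  disjunct : ∀ i, ∀ hi : i < q.disjuncts.length, DisjunctAt w n (disjAddr w i) q.disjuncts[i]
  string_lt : disjAddr w (w 0) + s.length + 1 = n
  size_string : w (disjAddr w (w 0)) = s.length
  string : ∀ p < s.length, w (disjAddr w (w 0) + (p + 1)) = s.getD p 0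

theorem inputAt_of_slice {w : ℕ → ℕ} {q : RegexUCQ} {s : List Letter}
    (h : slice w 0 (q.code ++ sized s).length = q.code ++ sized s) :
    InputAt w (q.code ++ sized s).length q s := by
  have hlen : q.code.length = 1 + (q.disjuncts.flatMap RegexCQ.code).length := by
    simp [RegexUCQ.code]; omega
  rw [slice_append_iff, Nat.zero_add] at h
  obtain ⟨h, hs⟩ := h
  rw [sized, slice_cons_iff] at hs
  rw [RegexUCQ.code, List.singleton_append, slice_cons_iff] at h
  have hn : (q.code ++ sized s).length = q.code.length + (s.length + 1) := by simp [sized]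
  rw [hn]
  obtain ⟨h1, h2⟩ := disjuncts_at (w := w) (n := q.code.length + (s.length + 1)) q.disjuncts 0 h.2
    (by rw [disjAddr]; omega)
  rw [Nat.zero_add, disjAddr, ← hlen] at h1
  simp only [Nat.zero_add] at h2
  have h1' : disjAddr w (w 0) = q.code.length := by rw [h.1, h1]
  refine ⟨h.1, h2, by omega, by rw [h1']; exact hs.1, fun p hp => ?_⟩
  rw [h1', ← Nat.add_assoc, Nat.add_right_comm]
  exact slice_getD hs.2 hp

theorem InputAt.extendable_iff {w : ℕ → ℕ} {n k d B : ℕ} {q : RegexUCQ} {s : List Letter}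
    (h : InputAt w n q s) (hq : q.IsKUCQ k) (hd : d ≤ 2 * q.vars.card)
    (hB : (2 * n + 2) ^ k ≤ B) :
    Extendable w n d B ↔
      ∃ ν ∈ q.spanner.rel s, ∀ e < d, digit (q.vars.sort (· ≤ ·)) ν e = w (n + e) := by
  have key : ∀ i, ∀ hi : i < q.disjuncts.length,
      ((∃ c < B, RunAt w n d B (disjAddr w i) (w (disjAddr w (w 0))) c ∧
        ∀ j < numAtoms w (disjAddr w i), stateOf n c j = 0) ↔
      ∃ ν ∈ q.disjuncts[i].spanner.rel s,
        ∀ e < d, digit (q.vars.sort (· ≤ ·)) ν e = w (n + e)) := by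
    intro i hi
    have hc := h.disjunct i hi
    have hmem := List.getElem_mem hi
    have hhead := q.same_vars _ hmem
    -- The disjunct has at most `k` atoms, so `(2 * n + 2) ^ k ≤ B` leaves room for all tuples of
    -- their states. This is the place where `k` has to be fixed.
    rw [h.size_string, hc.numAtoms, hc.runAt_iff (hhead ▸ hd) h.string
      ((Nat.pow_le_pow_right (by omega) (hq _ hmem)).trans hB), ← hhead,
      RegexCQ.exists_answer_iff q.disjuncts[i] (fun _ => rfl) (fun j hj => (hc.atom j hj).2.1)
        (hhead ▸ hd)]
  unfold Extendable
  rw [h.numDisjuncts]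
  rw [h.numDisjuncts] at key
  constructor
  · rintro ⟨i, hi, H⟩
    obtain ⟨ν, h1, h2⟩ := (key i hi).1 H
    exact ⟨ν, ⟨_, List.mem_map_of_mem (List.getElem_mem hi), h1⟩, h2⟩
  · rintro ⟨ν, ⟨P, hP, h1⟩, h2⟩
    obtain ⟨c, hc, rfl⟩ := List.mem_map.1 hP
    obtain ⟨i, hi, rfl⟩ := List.getElem_of_mem hc
    exact ⟨i, hi, (key i hi).2 ⟨ν, h1, h2⟩⟩

end DocSpanners

/-! ### Depth-first search with bounded delay. -/

namespace DocSpanners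

/-! ### Emission of answers with bounded gaps -/

/-- After a time `g` without answer, the events `t` output the answers `out`, with gaps of at most
`D`, and at most the time `g'` has passed since the last answer when they end. -/
inductive Emits (D : ℕ) : ℕ → List Event → List (List ℕ) → ℕ → Prop
  | quiet {g g' : ℕ} {t : List Event} : Quiet t → g + t.length ≤ g' → Emits D g t [] g'
  | answer {g g' : ℕ} {u t : List Event} {out : List (List ℕ)} :
    Event.endAnswer ∉ u → g + u.length + 1 ≤ D → Emits D 0 t out g' →
      Emits D g (u ++ [Event.endAnswer] ++ t) (printed u :: out) g'

theorem Quiet.printed_eq {t : List Event} (h : Quiet t) : printed t = [] := by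
  simp only [printed, List.filterMap_eq_nil_iff]
  intro e he
  rw [h e he]

theorem Quiet.endAnswer_notMem {t : List Event} (h : Quiet t) : Event.endAnswer ∉ t :=
  fun he => by simpa using h _ he

theorem printed_append (t u : List Event) : printed (t ++ u) = printed t ++ printed u :=
  List.filterMap_append

namespace Emits

variable {D g g' g'' : ℕ} {t u : List Event} {out out' : List (List ℕ)}

theorem mono_right (h : Emits D g t out g') (hg : g' ≤ g'') : Emits D g t out g'' := by
  induction h with
  | quiet h h' => exact .quiet h (by omega)
  | answer h h' _ ih => exact .answer h h' (ih hg)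

theorem quiet_append (hu : Quiet u) (h : Emits D g' t out g'') (hg : g + u.length ≤ g') :
    Emits D g (u ++ t) out g'' := by
  cases h with
  | quiet h h' => exact .quiet (hu.append h) (by rw [List.length_append]; omega)
  | @answer _ _ v t out h h' h'' =>
    have := Emits.answer (g := g) (u := u ++ v)
      (by rw [List.mem_append, not_or]; exact ⟨hu.endAnswer_notMem, h⟩)
      (by rw [List.length_append]; omega) h''
    rwa [printed_append, hu.printed_eq, List.nil_append, List.append_assoc, List.append_assoc,
      ← List.append_assoc v] at this

theorem append (h : Emits D g t out g') (h' : Emits D g' u out' g'') :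
    Emits D g (t ++ u) (out ++ out') g'' := by
  induction h with
  | quiet h1 h2 => exact h'.quiet_append h1 h2
  | answer h1 h2 _ ih =>
    rw [List.append_assoc, List.cons_append]
    exact .answer h1 h2 (ih h')

theorem outputsWithDelay (h : Emits D g t out g') (hg : g' ≤ D) : OutputsWithDelay D t out := by
  induction h with
  | quiet h1 h2 => exact ⟨[], _, rfl, rfl, h1.printed_eq, by simp, h1.endAnswer_notMem, by omega⟩
  | @answer g g' u t out h1 h2 _ ih =>
    obtain ⟨segs, last, rfl, rfl, k3, k4, k5⟩ := ih hg
    refine ⟨u :: segs, last, by simp, rfl, k3, ?_, k5⟩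
    rw [List.forall_mem_cons]
    exact ⟨⟨h1, by omega⟩, k4⟩

end Emits

/-! ### Iterations of a loop -/

/-- Some iterations of the loop with test `e` and body `c`. -/
inductive Iterates (W : ℕ) (e : Expr) (c : Program) : State → List Event → State → Prop
  | nil (σ : State) : Iterates W e c σ [] σ
  | cons {σ₁ σ₂ σ₃ : State} {t₁ t₂ : List Event} : e.eval σ₁ ≠ 0 → Exec W c σ₁ t₁ σ₂ →
    Iterates W e c σ₂ t₂ σ₃ → Iterates W e c σ₁ (ticks (e.cost + 1) ++ t₁ ++ t₂) σ₃

namespace Iterates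

variable {W : ℕ} {e : Expr} {c : Program} {σ₁ σ₂ σ₃ : State} {t₁ t₂ : List Event}

theorem append (h : Iterates W e c σ₁ t₁ σ₂) (h' : Iterates W e c σ₂ t₂ σ₃) :
    Iterates W e c σ₁ (t₁ ++ t₂) σ₃ := by
  induction h with
  | nil => exact h'
  | cons k1 k2 _ ih =>
    rw [List.append_assoc]
    exact .cons k1 k2 (ih h')

theorem exec (h : Iterates W e c σ₁ t₁ σ₂) (he : e.eval σ₂ = 0) :
    Exec W (.loop e c) σ₁ (t₁ ++ ticks (e.cost + 1)) σ₂ := by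
  induction h with
  | nil => exact .loopFalse _ _ _ he
  | cons k1 k2 _ ih =>
    rw [List.append_assoc]
    exact .loopTrue _ _ _ _ _ _ _ k1 k2 (ih he)

end Iterates

/-! ### Enumeration by depth-first search -/

section Search

variable {P : List ℕ → Prop} [DecidablePred P] {B : ℕ}

variable (P B) in
/-- The extensions of `u` by `m` digits below `B`, all of whose prefixes that are longer than `u`
satisfy `P`. -/
def search : ℕ → List ℕ → List (List ℕ)
  | 0, u => [u]
  | m + 1, u => (List.range' 0 B).flatMap fun v =>
    if P (u ++ [v]) then search m (u ++ [v]) else []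

/-- Since `P u` says that an answer extends `u`, pruning loses none; and a list of full length that
passes is itself an answer, because all answers have this length. -/
theorem mem_search {A : Set (List ℕ)} {D : ℕ} (hA : ∀ a ∈ A, a.length = D ∧ ∀ x ∈ a, x < B)
    (hP : ∀ u, P u ↔ ∃ a ∈ A, u <+: a) {a : List ℕ} : ∀ {m : ℕ} {u : List ℕ},
      u.length + m = D → P u → (a ∈ search P B m u ↔ a ∈ A ∧ u <+: a)
  | 0, u, hu, h => by
    obtain ⟨b, hb, hub⟩ := (hP u).1 h
    obtain rfl := hub.eq_of_length (by rw [(hA b hb).1]; omega)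
    rw [search, List.mem_singleton]
    constructor
    · rintro rfl
      exact ⟨hb, List.prefix_rfl⟩
    · rintro ⟨ha, hua⟩
      exact (hua.eq_of_length (by rw [(hA a ha).1]; omega)).symm
  | m + 1, u, hu, h => by
    simp only [search, List.mem_flatMap, List.mem_range'_1]
    constructor
    · rintro ⟨v, -, hv⟩
      split_ifs at hv with hPv
      · obtain ⟨h1, h2⟩ := (mem_search hA hP (by simp; omega) hPv).1 hv
        exact ⟨h1, (List.prefix_append u [v]).trans h2⟩
      · simp at hv
    · rintro ⟨ha, r, rfl⟩
      have hl := (hA _ ha).1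
      rcases r with _ | ⟨v, r⟩
      · simp at hl; omega
      · have hpre : u ++ [v] <+: u ++ v :: r := ⟨r, by simp⟩
        have hPv : P (u ++ [v]) := (hP _).2 ⟨_, ha, hpre⟩
        refine ⟨v, ⟨by omega, by simpa using (hA _ ha).2 v (by simp)⟩, ?_⟩
        rw [if_pos hPv]
        exact (mem_search hA hP (by simp; omega) hPv).2 ⟨ha, hpre⟩

theorem prefix_of_mem_search {a : List ℕ} : ∀ {m : ℕ} {u : List ℕ}, a ∈ search P B m u → u <+: a
  | 0, u, h => by
    rw [search, List.mem_singleton] at h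
    rw [h]
  | m + 1, u, h => by
    simp only [search, List.mem_flatMap] at h
    obtain ⟨v, -, hv⟩ := h
    split_ifs at hv
    · exact (List.prefix_append u [v]).trans (prefix_of_mem_search hv)
    · simp at hv

/-- Leaves below different children differ in the digit chosen at the node. -/
theorem nodup_search : ∀ (m : ℕ) (u : List ℕ), (search P B m u).Nodup
  | 0, u => List.nodup_singleton u
  | m + 1, u => by
    rw [search, List.nodup_flatMap]
    refine ⟨fun v _ => ?_, (List.nodup_range' (s := 0) (n := B)).imp ?_⟩
    · split_ifs
      · exact nodup_search m _
      · exact List.nodup_nil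
    · intro v v' hne a h h'
      beta_reduce at h h'
      split_ifs at h h' <;> try simp at h h'
      have h1 := prefix_of_mem_search h
      have h2 := prefix_of_mem_search h'
      have h3 := (List.prefix_of_prefix_length_le h1 h2 (by simp)).eq_of_length (by simp)
      simp at h3
      exact hne h3

variable {W D T : ℕ} {e : Expr} {c : Program} {At : List ℕ → ℕ → State → Prop}
  {Popped : List ℕ → State → Prop} {pr : List ℕ → List ℕ}

/-- A loop that traverses the tree of all `u` with `P u` emits the leaves of this tree. -/
theorem iterates_search (hB : 0 < B)
    (hguard : ∀ u v σ, At u v σ → e.eval σ ≠ 0)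
    (hpopped : ∀ u v σ, Popped (u ++ [v]) σ → At u (v + 1) σ)
    (htry : ∀ u v σ, At u v σ → u.length < D → v < B → ∃ σ', Runs W c σ T σ' ∧
      if P (u ++ [v]) then At (u ++ [v]) 0 σ' else At u (v + 1) σ')
    (hpop : ∀ u σ, At u B σ → u.length < D → ∃ σ', Runs W c σ T σ' ∧ Popped u σ')
    (hprint : ∀ u v σ, At u v σ → u.length = D → ∃ σ' t t',
      Exec W c σ (t ++ [Event.endAnswer] ++ t') σ' ∧ Event.endAnswer ∉ t ∧ printed t = pr u ∧
      t.length ≤ T ∧ Quiet t' ∧ t'.length ≤ T ∧ Popped u σ')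
    (hne : ∀ m u, u.length + m = D → P u → search P B m u ≠ []) {T' C : ℕ}
    (hT' : e.cost + 1 + T ≤ T') (hC : (D + 1) * ((B + 1) * T') ≤ C) :
    ∀ m u σ g, u.length + m = D → P u → At u 0 σ → g ≤ C + u.length * ((B + 1) * T') →
      ∃ σ' t, Iterates W e c σ t σ' ∧ Popped u σ' ∧
        Emits (C + (D + 1) * ((B + 1) * T')) g t ((search P B m u).map pr)
          ((m + 1) * ((B + 1) * T')) := by
  -- The `+ 1` pays for the event that completes an answer.
  have hBT : T' + 1 ≤ (B + 1) * T' := by nlinarith [Nat.mul_le_mul hB (show 1 ≤ T' by omega)]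
  generalize hX : (B + 1) * T' = X at *
  have quietStep : ∀ {σ σ'}, e.eval σ ≠ 0 → Runs W c σ T σ' →
      ∃ t, Iterates W e c σ t σ' ∧ Quiet t ∧ t.length ≤ T' := by
    rintro σ σ' he ⟨t, h1, h2, h3⟩
    refine ⟨_, .cons he h1 (.nil _), ?_, ?_⟩
    · rw [List.append_nil]
      exact (quiet_ticks _).append h3
    · simp only [List.append_nil, List.length_append, length_ticks]
      omega
  -- `X` is the time for a full round of tests at one node. On arrival at `u` the time since the
  -- last answer is at most `C` plus one round for each level above; on departure it is at most one
  -- round for each level from `u` down. `C` absorbs the latter when the search turns to a sibling.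
  intro m
  induction m with
  | zero =>
    intro u σ g hu hPu hAt hg
    obtain ⟨σ', t, t', h1, h2, h3, h4, h5, h6, h7⟩ := hprint u 0 σ hAt (by omega)
    have hlen : u.length = D := by omega
    refine ⟨σ', _, .cons (hguard _ _ _ hAt) h1 (.nil _), h7, ?_⟩
    have hem : Emits (C + (D + 1) * X) (g + (e.cost + 1)) (t ++ [Event.endAnswer] ++ t')
        [printed t] ((0 + 1) * X) := by
      refine .answer h2 ?_ (.quiet h5 (by omega))
      rw [hlen] at hg
      have : (D + 1) * X = D * X + X := Nat.succ_mul _ _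
      omega
    rw [h3] at hem
    rw [List.append_nil]
    exact hem.quiet_append (quiet_ticks _) (by rw [length_ticks])
  | succ m ih =>
    intro u σ g hu hPu hAt hg
    have e1 : (m + 1 + 1) * X = (m + 1) * X + X := Nat.succ_mul _ _
    have e2 : (u.length + 1) * X = u.length * X + X := Nat.succ_mul _ _
    have e3 : (m + 1) * X ≤ D * X := Nat.mul_le_mul_right _ (by omega)
    have e4 : (D + 1) * X = D * X + X := Nat.succ_mul _ _
    -- The values below `v` have been treated at `u`, and `r` values remain. Either an answer comes
    -- out of these, and the departure bound holds; or none does, and only `r + 1` iterations pass,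
    -- the last one for backtracking.
    have inner : ∀ r v σ g, v + r = B → At u v σ → g ≤ C + u.length * X + v * T' →
        ∃ σ' t g', Iterates W e c σ t σ' ∧ Popped u σ' ∧
          Emits (C + (D + 1) * X) g t
            (((List.range' v r).flatMap fun v =>
              if P (u ++ [v]) then search P B m (u ++ [v]) else []).map pr) g' ∧
          (g' ≤ (m + 1 + 1) * X ∨ g' ≤ g + (r + 1) * T' ∧
            (List.range' v r).flatMap (fun v =>
              if P (u ++ [v]) then search P B m (u ++ [v]) else []) = []) := by
      intro r
      induction r with
      | zero =>
        intro v σ g hv hAt hg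
        obtain rfl : v = B := by omega
        obtain ⟨σ', h1, h2⟩ := hpop u σ hAt (by omega)
        obtain ⟨t, h3, h4, h5⟩ := quietStep (hguard _ _ _ hAt) h1
        exact ⟨σ', t, _, h3, h2, .quiet h4 le_rfl, .inr ⟨by omega, by simp⟩⟩
      | succ r ihr =>
        intro v σ g hv hAt hg
        have f1 : (v + 1) * T' = v * T' + T' := Nat.succ_mul _ _
        have f2 : (r + 1 + 1) * T' = (r + 1) * T' + T' := Nat.succ_mul _ _
        have f3 : (r + 1) * T' + (v + 1) * T' = X := by rw [← Nat.add_mul, ← hX]; congr 1; omega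
        obtain ⟨σ', h1, h2⟩ := htry u v σ hAt (by omega) (by omega)
        obtain ⟨t, h3, h4, h5⟩ := quietStep (hguard _ _ _ hAt) h1
        rw [List.range'_succ, List.flatMap_cons]
        split_ifs at h2 ⊢ with hPv
        · obtain ⟨σ₂, t₂, k1, k2, k3⟩ := ih (u ++ [v]) σ' (g + t.length) (by simp; omega) hPv h2
            (by rw [List.length_append, List.length_singleton, e2]; omega)
          obtain ⟨σ₃, t₃, g', l1, l2, l3, l4⟩ := ihr (v + 1) σ₂ ((m + 1) * X) (by omega)
            (hpopped _ _ _ k2) (by omega)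
          refine ⟨σ₃, _, g', h3.append (k1.append l1), l2, ?_, .inl ?_⟩
          · rw [List.map_append]
            exact (k3.append l3).quiet_append h4 le_rfl
          · omega
        · obtain ⟨σ₃, t₃, g', l1, l2, l3, l4⟩ := ihr (v + 1) σ' (g + t.length) (by omega) h2
            (by omega)
          refine ⟨σ₃, _, g', h3.append l1, l2, l3.quiet_append h4 le_rfl, ?_⟩
          exact l4.imp_right fun h => ⟨by omega, h.2⟩
    obtain ⟨σ', t, g', h1, h2, h3, h4⟩ := inner B 0 σ g (by omega) hAt (by omega)
    refine ⟨σ', t, h1, h2, h3.mono_right ?_⟩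
    rcases h4 with h4 | ⟨-, h4⟩
    · exact h4
    -- A node is entered only if an answer lies below it, so a complete traversal cannot remain
    -- without output.
    · exact absurd h4 (hne (m + 1) u hu hPu)

end Search

end DocSpanners

/-! ### The concrete program and its test for extendability. -/

namespace DocSpanners

/-! ### The program -/

namespace Driver

/-- The `j`-th power of `2 * n + 10`, for the length `n` of the input. -/
def powExpr : ℕ → Expr
  | 0 => .const 1
  | j + 1 => .op .mul (powExpr j) (.op .add (.op .mul (.const 2) (.reg 0)) (.const 10))

/-- Decide whether some answer has the digits that stand behind the input; register `3` holds their
number. -/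
def decideExt : Program := .seq (fills arity tableF 10) ((extendableF 10).prog 10)

/-- Append the value of register `5` to the digits. -/
def tryValue : Program :=
  .seq (.store (.op .add (.reg 0) (.reg 4)) (.reg 5))
  (.seq (.assign 3 (.op .add (.reg 4) (.const 1)))
  (.seq decideExt
  (.ite (.reg 2) (.seq (.assign 4 (.op .add (.reg 4) (.const 1))) (.assign 5 (.const 0)))
    (.assign 5 (.op .add (.reg 5) (.const 1))))))

/-- Remove the last digit. -/
def backtrack : Program :=
  .ite (.reg 4)
    (.seq (.assign 4 (.op .sub (.reg 4) (.const 1)))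
      (.assign 5 (.op .add (.load (.op .add (.reg 0) (.reg 4))) (.const 1))))
    (.assign 7 (.const 0))

def digitExpr (b : ℕ) : Expr :=
  .op .add (.load (.op .add (.reg 0) (.op .add (.op .mul (.const 2) (.reg 8)) (.const b))))
    (.const 1)

def printVar : Program :=
  .seq (.print (.load (.op .add (.const 2) (.reg 8))))
  (.seq (.print (digitExpr 0))
  (.seq (.print (digitExpr 1)) (.assign 8 (.op .add (.reg 8) (.const 1)))))

def printLoop : Program := .loop (.op .lt (.reg 8) (.load (.const 1))) printVar

/-- Register `4` holds the depth, `5` the value to be tried next, `6` the full depth, `7` whether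
the search goes on, and `8` the index of the variable being printed. The digits stand in memory
directly behind the input. -/
def step : Program :=
  .ite (.op .lt (.reg 4) (.reg 6)) (.ite (.op .lt (.reg 5) (.reg 1)) tryValue backtrack)
    (.seq (.seq (.assign 8 (.const 0)) (.seq printLoop .endAnswer)) backtrack)

/-- Cell `1` is the beginning of the first disjunct and contains the number of its head variables,
which is the same for all disjuncts. -/
def setup (k : ℕ) : Program :=
  .seq (.assign 1 (powExpr (k + 2)))
  (.seq (.assign 6 (.op .mul (.const 2) (.load (.const 1))))
  (.seq decideExt (.assign 7 (.reg 2))))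

def program (k : ℕ) : Program := .seq (setup k) (.loop (.reg 7) step)

theorem powExpr_eval (σ : State) (j : ℕ) : (powExpr j).eval σ = (2 * σ.reg 0 + 10) ^ j := by
  induction j with
  | zero => rfl
  | succ j ih => simp only [powExpr, Expr.eval, BinOp.eval, ih, pow_succ]

end Driver

/-- The lists of digits of the answers. -/
def digitAnswers (q : RegexUCQ) (s : List Letter) : Set (List ℕ) :=
  {a | ∃ ν ∈ q.spanner.rel s,
    a = (List.range (2 * q.vars.card)).map (digit (q.vars.sort (· ≤ ·)) ν)}

/-- Some answer has the first digits `u`. -/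
def HasAnswer (q : RegexUCQ) (s : List Letter) (u : List ℕ) : Prop :=
  ∃ a ∈ digitAnswers q s, u <+: a

theorem prefix_map_range_iff {f : ℕ → ℕ} {D : ℕ} {u : List ℕ} (hu : u.length ≤ D) :
    u <+: (List.range D).map f ↔ ∀ e < u.length, f e = u.getD e 0 := by
  rw [List.prefix_iff_eq_take]
  constructor
  · intro h e he
    rw [List.getD_eq_getElem _ _ he]
    conv_rhs => rw [List.getElem_of_eq h]
    simp
  · intro h
    refine List.ext_getElem (by simpa) fun e he _ => ?_
    have := h e he
    rw [List.getD_eq_getElem _ _ he] at this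
    simp [this]

theorem hasAnswer_iff {q : RegexUCQ} {s : List Letter} {u : List ℕ}
    (hu : u.length ≤ 2 * q.vars.card) : HasAnswer q s u ↔
      ∃ ν ∈ q.spanner.rel s, ∀ e < u.length, digit (q.vars.sort (· ≤ ·)) ν e = u.getD e 0 := by
  constructor
  · rintro ⟨_, ⟨ν, hν, rfl⟩, h⟩
    exact ⟨ν, hν, (prefix_map_range_iff hu).1 h⟩
  · rintro ⟨ν, hν, h⟩
    exact ⟨_, ⟨ν, hν, rfl⟩, (prefix_map_range_iff hu).2 h⟩

theorem lt_disjAddr (w : ℕ → ℕ) (u : ℕ) : u < disjAddr w u := by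
  induction u with
  | zero => rw [disjAddr]; omega
  | succ u ih =>
    have := add_le_atomAddr w (disjAddr w u) (numAtoms w (disjAddr w u))
    rw [disjAddr]
    omega

/-- The bound for quantifiers. -/
def quantBound (k n : ℕ) : ℕ := (2 * n + 10) ^ (k + 2)

theorem quantBound_mono (k : ℕ) : Monotone (quantBound k) :=
  fun _ _ h => Nat.pow_le_pow_left (by omega) _

/-- The exponent `k + 2` serves two purposes: the power `k` makes room for the tuples of states, the
square for the input with the digits behind it and for various constants. -/
theorem sq_le_quantBound (k n : ℕ) : (2 * n + 10) * (2 * n + 10) ≤ quantBound k n := by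
  rw [← sq]
  exact Nat.pow_le_pow_right (by omega) (by omega)

theorem pow_le_quantBound (k n : ℕ) : (2 * n + 2) ^ k ≤ quantBound k n :=
  (Nat.pow_le_pow_left (by omega) k).trans (Nat.pow_le_pow_right (by omega) (by omega))

/-- The state `σ` holds the input `l`, the bound `B` and the digits `u`. -/
structure Holds (l : List ℕ) (B : ℕ) (u : List ℕ) (σ : State) : Prop where
  size : σ.reg 0 = l.length
  bound : σ.reg 1 = B
  input : ∀ a < l.length, σ.mem a = l.getD a 0
  digits : ∀ e < u.length, σ.mem (l.length + e) = u.getD e 0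
  lt : ∀ x ∈ u, x < B

theorem Holds.congr {l : List ℕ} {B : ℕ} {u : List ℕ} {σ σ' : State} (h : Holds l B u σ)
    (h0 : σ'.reg 0 = σ.reg 0) (h1 : σ'.reg 1 = σ.reg 1) (hB : l.length + u.length ≤ B)
    (hm : ∀ a < B, σ'.mem a = σ.mem a) : Holds l B u σ' where
  size := h0.trans h.size
  bound := h1.trans h.bound
  input a ha := (hm a (by omega)).trans (h.input a ha)
  digits e he := (hm _ (by omega)).trans (h.digits e he)
  lt := h.lt

theorem inputAt_code (q : RegexUCQ) (s : List Letter) {w : ℕ → ℕ}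
    (hw : ∀ a < (q.code ++ sized s).length, w a = (q.code ++ sized s).getD a 0) :
    InputAt w (q.code ++ sized s).length q s := by
  refine inputAt_of_slice (List.ext_getElem (by simp) fun e he he' => ?_)
  rw [← List.getD_eq_getElem _ 0 he', ← hw e he']
  simp [slice]

/-- There is a first disjunct, its address is `1`, and its head is the common one; so the names of
the variables to be printed are in the cells from `2` on. -/
theorem InputAt.card_lt {w : ℕ → ℕ} {n : ℕ} {q : RegexUCQ} {s : List Letter}
    (h : InputAt w n q s) : w 1 = q.vars.card ∧ q.vars.card + 2 ≤ n ∧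
      ∀ y < q.vars.card, w (2 + y) = (q.vars.sort (· ≤ ·)).getD y 0 := by
  have hpos : 0 < q.disjuncts.length := List.length_pos_of_ne_nil q.disjuncts_ne
  have hc := h.disjunct 0 hpos
  have hhead := q.same_vars _ (List.getElem_mem hpos)
  have h1 := hc.size_head
  have h2 := hc.valid.numAtoms_lt
  have h3 := hc.head
  rw [disjAddr] at h1 h2 h3
  rw [hhead] at h1 h3
  exact ⟨h1, by omega, h3⟩

open Driver

/-- The eighth power bounds all addresses: a table has at most `7` arguments, and its number is one
more digit in base `B`. -/
theorem exists_runs_decideExt (k : ℕ) : ∃ T : ℕ → ℕ, PolyBd T ∧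
    ∀ (q : RegexUCQ) (s : List Letter) (W : ℕ) (u : List ℕ) (σ : State), q.IsKUCQ k →
      quantBound k (q.code ++ sized s).length < W →
      quantBound k (q.code ++ sized s).length ^ 8 ≤ W →
      Holds (q.code ++ sized s) (quantBound k (q.code ++ sized s).length) u σ →
      σ.reg 3 = u.length → u.length ≤ 2 * q.vars.card →
      ∃ σ', Runs W decideExt σ (T (quantBound k (q.code ++ sized s).length)) σ' ∧
        Agree 10 σ'.reg σ.reg ∧
        (∀ a < quantBound k (q.code ++ sized s).length, σ'.mem a = σ.mem a) ∧
        Flag σ' (HasAnswer q s u) := by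
  obtain ⟨T, hT, H⟩ := runs_decide arity_pos 10 tableF_wf extendableF_wf
  refine ⟨T, hT, fun q s W u σ hq hW hW' hσ h3 hu => ?_⟩
  have hB1 := sq_le_quantBound k (q.code ++ sized s).length
  have hB2 := pow_le_quantBound k (q.code ++ sized s).length
  obtain ⟨h0, h1, hin, hdig, -⟩ := hσ
  set l := q.code ++ sized s with hl
  set n := l.length with hn
  set B := quantBound k n with hB
  have hB3 : 2 * n + 10 ≤ B ∧ 3 * n + 10 ≤ B ∧ 100 ≤ B := by
    refine ⟨?_, ?_, ?_⟩ <;> nlinarith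
  -- Formulas see the required digits too: there are fewer than `2 * n` of them behind the input, so
  -- their cells are below `B`.
  have hw : ∀ a < B, inputOf B σ.mem a = σ.mem a := fun a ha => by simp [inputOf, ha]
  have hI : InputAt (inputOf B σ.mem) n q s := inputAt_code q s fun a ha => by
    have ha' : a < n := ha
    rw [hw a (by omega), hin a ha]
  have hlt := lt_disjAddr (inputOf B σ.mem) (inputOf B σ.mem 0)
  have hstr := hI.string_lt
  have hsize := hI.size_string
  have hnum := hI.numDisjuncts
  have hcard := hI.card_lt.2.1
  refine H B W (tableRel (inputOf B σ.mem) n u.length B) _ σ (by omega) hW hW' h1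
    (fun j hj => tableF_defines h0 h3 hB3.1 (by omega) (by omega) j hj) fun I hI' => ?_
  rw [sat_extendableF h0 hB3.1 (by omega) (by omega) (by omega)
    (fun i hi => (hI.disjunct i (hnum ▸ hi)).valid) hI', hI.extendable_iff hq hu hB2,
    hasAnswer_iff hu]
  refine exists_congr fun ν => and_congr_right fun _ => forall₂_congr fun e he => ?_
  rw [hw _ (by omega), hdig e he]

/-! ### Printing -/

theorem printed_word_cons (v : ℕ) (t : List Event) : printed (.word v :: t) = v :: printed t := rfl

/-- The output for the digits `u`. -/
def printedAnswer (w : ℕ → ℕ) (u : List ℕ) (y r : ℕ) : List ℕ :=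
  (List.range' y r).flatMap fun y =>
    [w (2 + y), u.getD (2 * y + 0) 0 + 1, u.getD (2 * y + 1) 0 + 1]

theorem exec_printLoop {W B : ℕ} {l u : List ℕ} (hBW : B < W) (hl : ∀ x ∈ l, x < W) {D : ℕ}
    (hD : u.length = 2 * D) (h1 : l.getD 1 0 = D) (hDl : D + 2 ≤ l.length)
    (hB : l.length + u.length ≤ B) :
    ∀ (r y : ℕ) (σ : State), y + r = D → Holds l B u σ → σ.reg 8 = y →
      ∃ v t, Exec W printLoop σ t ⟨Function.update σ.reg 8 v, σ.mem⟩ ∧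
        Event.endAnswer ∉ t ∧ t.length ≤ 5 + r * 40 ∧
        printed t = printedAnswer (fun a => l.getD a 0) u y r := by
  intro r
  induction r with
  | zero =>
    intro y σ hy hσ h8
    have hfalse : (Expr.op .lt (.reg 8) (.load (.const 1))).eval σ = 0 := by
      have := hσ.input 1 (by omega)
      simp only [Expr.eval, BinOp.eval, this, h1, h8]
      exact if_neg (by omega)
    -- No round is left, so the update writes the value that register `8` already has.
    have he : (⟨Function.update σ.reg 8 y, σ.mem⟩ : State) = σ := by rw [← h8]; simp
    refine ⟨y, ticks 5, ?_, (quiet_ticks _).endAnswer_notMem, by simp [length_ticks],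
      (quiet_ticks _).printed_eq⟩
    rw [he]
    exact .loopFalse _ _ _ hfalse
  | succ r ih =>
    intro y σ hy hσ h8
    obtain ⟨v, t, k1, k2, k3, k4⟩ := ih (y + 1) ⟨Function.update σ.reg 8 (y + 1), σ.mem⟩ (by omega)
      (hσ.congr (by simp) (by simp) hB fun _ _ => rfl) (by simp)
    have hdig : ∀ b < 2, (digitExpr b).eval σ = u.getD (2 * y + b) 0 + 1 := by
      intro b hb
      simp only [digitExpr, Expr.eval, BinOp.eval, hσ.size, h8, hσ.digits (2 * y + b) (by omega)]
    have hvar : (Expr.load (.op .add (.const 2) (.reg 8))).eval σ = l.getD (2 + y) 0 := by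
      simp only [Expr.eval, BinOp.eval, h8, hσ.input (2 + y) (by omega)]
    have hdW : ∀ b < 2, (digitExpr b).eval σ < W := by
      intro b hb
      rw [hdig b hb, List.getD_eq_getElem _ _ (by omega)]
      have := hσ.lt _ (List.getElem_mem (show 2 * y + b < u.length by omega))
      omega
    have hvW : (Expr.load (.op .add (.const 2) (.reg 8))).eval σ < W := by
      rw [hvar, List.getD_eq_getElem _ _ (by omega)]
      exact hl _ (List.getElem_mem _)
    have h8' : (Expr.op .add (.reg 8) (.const 1)).eval σ = y + 1 := by
      simp only [Expr.eval, BinOp.eval, h8]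
    have hbody := Exec.seq _ _ _ _ _ _ _ (Exec.print _ σ hvW)
      (.seq _ _ _ _ _ _ _ (.print _ σ (hdW 0 (by omega)))
        (.seq _ _ _ _ _ _ _ (.print _ σ (hdW 1 (by omega)))
          (.assign 8 (.op .add (.reg 8) (.const 1)) σ (by rw [h8']; omega))))
    rw [h8'] at hbody
    rw [show (⟨Function.update (Function.update σ.reg 8 (y + 1)) 8 v, σ.mem⟩ : State) =
      ⟨Function.update σ.reg 8 v, σ.mem⟩ by simp] at k1
    refine ⟨v, _, .loopTrue _ _ _ _ _ _ _ ?_ hbody k1, ?_, ?_, ?_⟩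
    · have := hσ.input 1 (by omega)
      simp only [Expr.eval, BinOp.eval, this, h1, h8]
      rw [if_pos (by omega)]
      exact one_ne_zero
    · simp [ticks, k2]
    · simp only [List.length_append, length_ticks, List.length_singleton, Expr.cost, digitExpr]
      omega
    · simp only [printed_append, (quiet_ticks _).printed_eq, List.nil_append, k4, hvar,
        hdig 0 (by omega), hdig 1 (by omega), printedAnswer, List.range'_succ, List.flatMap_cons,
        printed_word_cons, List.cons_append, List.append_assoc]

end DocSpanners

/-! ### The three kinds of search steps on the machine. -/

namespace DocSpanners

open Driver

/-! ### The steps of the search -/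

/-- The search is about to try the value `v` after the digits `u`; complete lists of digits have
length `D`. -/
structure SearchAt (l : List ℕ) (B D : ℕ) (u : List ℕ) (v : ℕ) (σ : State) : Prop
    extends Holds l B u σ where
  depth : σ.reg 4 = u.length
  value : σ.reg 5 = v
  maxDepth : σ.reg 6 = D
  alive : σ.reg 7 = 1
  depth_le : u.length ≤ D

/-- The subtree of `u` has been left. -/
def Popped (l : List ℕ) (B D : ℕ) (u : List ℕ) (σ : State) : Prop :=
  (u = [] ∧ σ.reg 7 = 0) ∨ ∃ u' x, u = u' ++ [x] ∧ SearchAt l B D u' (x + 1) σ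

section Steps

variable {W B D v : ℕ} {l u : List ℕ} {σ : State}

theorem Popped.searchAt (h : Popped l B D (u ++ [v]) σ) : SearchAt l B D u (v + 1) σ := by
  rcases h with ⟨h, -⟩ | ⟨u', x, h, h'⟩
  · simp at h
  · obtain ⟨rfl, h⟩ := List.append_inj' h rfl
    obtain rfl : v = x := by simpa using h
    exact h'

theorem SearchAt.runs_backtrack (h : SearchAt l B D u v σ) (hBW : B < W)
    (hB : l.length + D ≤ B) : ∃ σ', Runs W backtrack σ 20 σ' ∧ Popped l B D u σ' := by
  -- At the root, backtracking ends the search. Elsewhere the last digit is read back from memory,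
  -- and its successor is tried next.
  rcases List.eq_nil_or_concat' u with rfl | ⟨u, x, rfl⟩
  · exact ⟨_, (Runs.ite_false (by simp [Expr.eval, h.depth])
      (Runs.assign 7 (.const 0) σ (by simp only [Expr.eval]; omega))).mono (by simp [Expr.cost]),
      .inl ⟨rfl, by simp [Expr.eval]⟩⟩
  · have hx : σ.mem (l.length + u.length) = x := by
      rw [h.digits u.length (by simp)]
      simp
    have hxB := h.lt x (by simp)
    have h4 := h.depth
    have hD := h.depth_le
    rw [List.length_append, List.length_singleton] at h4 hD
    have e1 : (Expr.op .sub (.reg 4) (.const 1)).eval σ = u.length := by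
      simp only [Expr.eval, BinOp.eval, h4]
      omega
    have e2 : (Expr.op .add (.load (.op .add (.reg 0) (.reg 4))) (.const 1)).eval
        ⟨Function.update σ.reg 4 u.length, σ.mem⟩ = x + 1 := by
      simp [Expr.eval, BinOp.eval, h.size, hx]
    have r1 := Runs.assign (W := W) 4 (.op .sub (.reg 4) (.const 1)) σ (by rw [e1]; omega)
    rw [e1] at r1
    have r2 := Runs.assign (W := W) 5 (.op .add (.load (.op .add (.reg 0) (.reg 4))) (.const 1))
      ⟨Function.update σ.reg 4 u.length, σ.mem⟩ (by rw [e2]; omega)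
    rw [e2] at r2
    refine ⟨_, (Runs.ite_true (by simp only [Expr.eval, h4]; omega) (r1.seq r2)).mono
      (by simp [Expr.cost]), .inr ⟨u, x, rfl, ⟨⟨?_, ?_, h.input, ?_, ?_⟩, ?_, ?_, ?_, ?_, ?_⟩⟩⟩
    · simp [h.size]
    · simp [h.bound]
    · intro e he
      rw [h.digits e (by simp; omega), List.getD_append _ _ _ _ he]
    · exact fun y hy => h.lt y (by simp [hy])
    · simp
    · simp
    · simp [h.maxDepth]
    · simp [h.alive]
    · omega

theorem SearchAt.runs_step_backtrack (h : SearchAt l B D u B σ) (hu : u.length < D) (hBW : B < W)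
    (hB : l.length + D ≤ B) : ∃ σ', Runs W step σ 30 σ' ∧ Popped l B D u σ' := by
  obtain ⟨σ', h1, h2⟩ := h.runs_backtrack hBW hB
  refine ⟨σ', (Runs.ite_true ?_ (Runs.ite_false ?_ h1)).mono (by simp [Expr.cost]), h2⟩
  · simp [Expr.eval, BinOp.eval, h.depth, h.maxDepth, hu]
  · simp [Expr.eval, BinOp.eval, h.value, h.bound]

theorem SearchAt.exec_step_print {C : ℕ} (h : SearchAt l B D u v σ) (hu : u.length = D)
    (hBW : B < W) (hB : l.length + D ≤ B) (hD : D = 2 * C) (hC : l.getD 1 0 = C)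
    (hCl : C + 2 ≤ l.length) (hl : ∀ x ∈ l, x < W) :
    ∃ σ' t t', Exec W step σ (t ++ [Event.endAnswer] ++ t') σ' ∧ Event.endAnswer ∉ t ∧
      printed t = printedAnswer (fun a => l.getD a 0) u 0 C ∧ t.length ≤ 20 + C * 40 ∧
      Quiet t' ∧ t'.length ≤ 20 ∧ Popped l B D u σ' := by
  have hlt : (Expr.op .lt (.reg 4) (.reg 6)).eval σ = 0 := by
    simp [Expr.eval, BinOp.eval, h.depth, h.maxDepth, hu]
  obtain ⟨v', t, k1, k2, k3, k4⟩ := exec_printLoop hBW hl (hu.trans hD) hC hCl (by omega) C 0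
    ⟨Function.update σ.reg 8 0, σ.mem⟩ (by omega)
    (h.congr (by simp) (by simp) (by omega) fun _ _ => rfl) (by simp)
  obtain ⟨σ', ⟨t', l1, l2, l3⟩, l4⟩ := SearchAt.runs_backtrack
    (σ := ⟨Function.update (Function.update σ.reg 8 0) 8 v', σ.mem⟩) (v := v)
    ⟨h.congr (by simp) (by simp) (by omega) fun _ _ => rfl, by simp [h.depth], by simp [h.value],
      by simp [h.maxDepth], by simp [h.alive], h.depth_le⟩ hBW hB
  have key := Exec.iteFalse _ (.ite (.op .lt (.reg 5) (.reg 1)) tryValue backtrack) _ _ _ _ hlt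
    (Exec.seq _ _ _ _ _ _ _
    (Exec.seq _ _ _ _ _ _ _ (Exec.assign (W := W) 8 (.const 0) σ (by simp only [Expr.eval]; omega))
      (Exec.seq _ _ _ _ _ _ _ k1 (.endAnswer _))) l1)
  refine ⟨σ', ticks ((Expr.op .lt (.reg 4) (.reg 6)).cost + 1) ++
    (ticks ((Expr.const 0).cost + 1) ++ t), t', ?_, ?_, ?_, ?_, l3, l2, l4⟩
  · simpa only [step, List.append_assoc] using key
  · simp [ticks, k2]
  · simp only [printed_append, (quiet_ticks _).printed_eq, List.nil_append, k4]
  · simp only [List.length_append, length_ticks, Expr.cost]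
    omega

end Steps

/-- The test leaves the state of the search intact: tables lie beyond the first `B` cells, and
formulas write only to register `2` and to registers from `10` on. -/
theorem exists_runs_step_try (k : ℕ) : ∃ T : ℕ → ℕ, PolyBd T ∧
    ∀ (q : RegexUCQ) (s : List Letter) (W : ℕ) (u : List ℕ) (v : ℕ) (σ : State), q.IsKUCQ k →
      quantBound k (q.code ++ sized s).length < W →
      quantBound k (q.code ++ sized s).length ^ 8 ≤ W →
      (q.code ++ sized s).length + 2 * q.vars.card ≤ quantBound k (q.code ++ sized s).length →
      SearchAt (q.code ++ sized s) (quantBound k (q.code ++ sized s).length) (2 * q.vars.card)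
        u v σ → u.length < 2 * q.vars.card → v < quantBound k (q.code ++ sized s).length →
      ∃ σ', Runs W step σ (T (quantBound k (q.code ++ sized s).length)) σ' ∧
        (HasAnswer q s (u ++ [v]) → SearchAt (q.code ++ sized s)
          (quantBound k (q.code ++ sized s).length) (2 * q.vars.card) (u ++ [v]) 0 σ') ∧
        (¬ HasAnswer q s (u ++ [v]) → SearchAt (q.code ++ sized s)
          (quantBound k (q.code ++ sized s).length) (2 * q.vars.card) u (v + 1) σ') := by
  obtain ⟨T, hT, H⟩ := exists_runs_decideExt k
  refine ⟨fun B => T B + 60, hT.add (.const 60), fun q s W u v σ hq hW hW' hB hσ hu hv => ?_⟩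
  set l := q.code ++ sized s with hl
  set B := quantBound k l.length
  set D := 2 * q.vars.card
  have r1 := Runs.store (W := W) (.op .add (.reg 0) (.reg 4)) (.reg 5) σ
    (by simp only [Expr.eval, BinOp.eval, hσ.size, hσ.depth]; omega)
    (by simp only [Expr.eval, hσ.value]; omega)
  simp only [Expr.eval, BinOp.eval, hσ.size, hσ.depth, hσ.value] at r1
  set mem₁ := Function.update σ.mem (l.length + u.length) v with hmem
  have r2 := Runs.assign (W := W) 3 (.op .add (.reg 4) (.const 1)) ⟨σ.reg, mem₁⟩
    (by simp only [Expr.eval, BinOp.eval, hσ.depth]; omega)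
  simp only [Expr.eval, BinOp.eval, hσ.depth] at r2
  have hholds : Holds l B (u ++ [v]) ⟨Function.update σ.reg 3 (u.length + 1), mem₁⟩ := by
    refine ⟨by simp [hσ.size], by simp [hσ.bound], ?_, ?_, ?_⟩
    · intro a ha
      change mem₁ a = _
      rw [hmem, Function.update_of_ne (by omega), hσ.input a ha]
    · intro e he
      rw [List.length_append, List.length_singleton] at he
      obtain rfl | he : e = u.length ∨ e < u.length := by omega
      · simp [hmem]
      · change mem₁ (l.length + e) = _
        rw [hmem, Function.update_of_ne (by omega), hσ.digits e he, List.getD_append _ _ _ _ he]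
    · intro x hx
      rcases List.mem_append.1 hx with hx | hx
      · exact hσ.lt x hx
      · rw [List.mem_singleton] at hx
        omega
  obtain ⟨σ₂, r3, ha, hm, hf⟩ := H q s W (u ++ [v]) _ hq hW hW' hholds (by simp) (by simp; omega)
  change Runs W decideExt _ (T B) σ₂ at r3
  have hlen : l.length + (u ++ [v]).length ≤ B := by simp; omega
  have hh₂ : Holds l B (u ++ [v]) σ₂ := hholds.congr (ha 0 (by omega) (by omega))
    (ha 1 (by omega) (by omega)) hlen hm
  have h4 : σ₂.reg 4 = u.length := (ha 4 (by omega) (by omega)).trans (by simp [hσ.depth])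
  have h5 : σ₂.reg 5 = v := (ha 5 (by omega) (by omega)).trans (by simp [hσ.value])
  have h6 : σ₂.reg 6 = D := (ha 6 (by omega) (by omega)).trans (by simp [hσ.maxDepth])
  have h7 : σ₂.reg 7 = 1 := (ha 7 (by omega) (by omega)).trans (by simp [hσ.alive])
  have hc1 : (Expr.op .lt (.reg 4) (.reg 6)).eval σ ≠ 0 := by
    simp [Expr.eval, BinOp.eval, hσ.depth, hσ.maxDepth, hu]
  have hc2 : (Expr.op .lt (.reg 5) (.reg 1)).eval σ ≠ 0 := by
    simp [Expr.eval, BinOp.eval, hσ.value, hσ.bound, hv]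
  rcases hf with ⟨h2, hP⟩ | ⟨h2, hP⟩
  · have r4 := Runs.assign (W := W) 4 (.op .add (.reg 4) (.const 1)) σ₂
      (by simp only [Expr.eval, BinOp.eval, h4]; omega)
    simp only [Expr.eval, BinOp.eval, h4] at r4
    have r5 := Runs.assign (W := W) 5 (.const 0) ⟨Function.update σ₂.reg 4 (u.length + 1), σ₂.mem⟩
      (by simp only [Expr.eval]; omega)
    refine ⟨_, (Runs.ite_true hc1 (Runs.ite_true hc2 (r1.seq (r2.seq (r3.seq
      (Runs.ite_true (by simp [Expr.eval, h2]) (r4.seq r5))))))).mono ?_, fun _ => ?_,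
      fun h => absurd hP h⟩
    · simp only [Expr.cost]
      omega
    · exact ⟨hh₂.congr (by simp) (by simp) hlen fun _ _ => rfl,
        by simp, by simp [Expr.eval], by simp [h6], by simp [h7],
        by simp; omega⟩
  · have r4 := Runs.assign (W := W) 5 (.op .add (.reg 5) (.const 1)) σ₂
      (by simp only [Expr.eval, BinOp.eval, h5]; omega)
    refine ⟨_, (Runs.ite_true hc1 (Runs.ite_true hc2 (r1.seq (r2.seq (r3.seq
      (Runs.ite_false (by simp [Expr.eval, h2]) r4)))))).mono ?_, fun h => absurd h hP,
      fun _ => ?_⟩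
    · simp only [Expr.cost]
      omega
    · have hh := hh₂.congr (σ' := ⟨Function.update σ₂.reg 5
        ((Expr.op .add (.reg 5) (.const 1)).eval σ₂), σ₂.mem⟩) (by simp) (by simp) hlen
        fun _ _ => rfl
      refine ⟨⟨hh.size, hh.bound, hh.input, fun e he => ?_, hσ.lt⟩, by simp [h4],
        by simp [Expr.eval, BinOp.eval, h5], by simp [h6], by simp [h7], hσ.depth_le⟩
      -- The rejected value stays in its cell but does not count as a digit, as the depth is
      -- unchanged.
      rw [hh.digits e (by simp; omega), List.getD_append _ _ _ _ he]

theorem exists_runs_setup (k : ℕ) : ∃ T : ℕ → ℕ, PolyBd T ∧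
    ∀ (q : RegexUCQ) (s : List Letter) (W : ℕ), q.IsKUCQ k →
      quantBound k (q.code ++ sized s).length < W →
      quantBound k (q.code ++ sized s).length ^ 8 ≤ W →
      (q.code ++ sized s).length + 2 * q.vars.card ≤ quantBound k (q.code ++ sized s).length →
      ∃ σ', Runs W (setup k) (initialState (q.code ++ sized s))
          (T (quantBound k (q.code ++ sized s).length)) σ' ∧
        (HasAnswer q s [] → SearchAt (q.code ++ sized s)
          (quantBound k (q.code ++ sized s).length) (2 * q.vars.card) [] 0 σ') ∧
        (¬ HasAnswer q s [] → σ'.reg 7 = 0) := by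
  obtain ⟨T, hT, H⟩ := exists_runs_decideExt k
  refine ⟨fun B => T B + ((powExpr (k + 2)).cost + 30), hT.add (.const _),
    fun q s W hq hW hW' hB => ?_⟩
  have hcard := (inputAt_code q s (w := fun a => (q.code ++ sized s).getD a 0)
    fun _ _ => rfl).card_lt.1
  set l := q.code ++ sized s with hl
  set B := quantBound k l.length with hBdef
  set D := 2 * q.vars.card
  have hBpos : 1 ≤ B := Nat.one_le_pow _ _ (by omega)
  have e1 : (powExpr (k + 2)).eval (initialState l) = B := by
    rw [powExpr_eval]
    rfl
  have r1 := Runs.assign (W := W) 1 (powExpr (k + 2)) (initialState l) (by rw [e1]; omega)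
  rw [e1] at r1
  have r2 := Runs.assign (W := W) 6 (.op .mul (.const 2) (.load (.const 1)))
    ⟨Function.update (initialState l).reg 1 B, (initialState l).mem⟩
    (by simp only [Expr.eval, BinOp.eval, initialState, hcard]; omega)
  have e2 : (Expr.op .mul (.const 2) (.load (.const 1))).eval
      ⟨Function.update (initialState l).reg 1 B, (initialState l).mem⟩ = D := by
    simp only [Expr.eval, BinOp.eval, initialState, hcard]
    rfl
  rw [e2] at r2
  have hholds : Holds l B []
      ⟨Function.update (Function.update (initialState l).reg 1 B) 6 D, (initialState l).mem⟩ :=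
    ⟨by simp [initialState], by simp, fun _ _ => rfl, by simp, by simp⟩
  obtain ⟨σ₂, r3, ha, hm, hf⟩ := H q s W [] _ hq hW hW' hholds (by simp [initialState]) (by simp)
  change Runs W decideExt _ (T B) σ₂ at r3
  have hlen : l.length + ([] : List ℕ).length ≤ B := by simp; omega
  have hh₂ : Holds l B [] σ₂ := hholds.congr (ha 0 (by omega) (by omega))
    (ha 1 (by omega) (by omega)) hlen hm
  have h4 : σ₂.reg 4 = 0 := (ha 4 (by omega) (by omega)).trans (by simp [initialState])
  have h5 : σ₂.reg 5 = 0 := (ha 5 (by omega) (by omega)).trans (by simp [initialState])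
  have h6 : σ₂.reg 6 = D := (ha 6 (by omega) (by omega)).trans (by simp)
  have r4 := Runs.assign (W := W) 7 (.reg 2) σ₂ (by
    rcases hf with ⟨h2, -⟩ | ⟨h2, -⟩ <;> simp only [Expr.eval, h2] <;> omega)
  refine ⟨_, (r1.seq (r2.seq (r3.seq r4))).mono ?_, fun hP => ?_, fun hP => ?_⟩
  · simp only [Expr.cost]
    omega
  · rcases hf with ⟨h2, -⟩ | ⟨-, h2⟩
    · exact ⟨hh₂.congr (by simp) (by simp) hlen fun _ _ => rfl, by simp [h4], by simp [h5],
        by simp [h6], by simp [Expr.eval, h2], by simp⟩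
    · exact absurd hP h2
  · rcases hf with ⟨-, h2⟩ | ⟨h2, -⟩
    · exact absurd h2 hP
    · simp [Expr.eval, h2]

end DocSpanners

/-! ### Digits against answers, and the final bounds. -/

namespace DocSpanners

open Driver

/-! ### Answers and their digits -/

/-- The tuple with domain `V` that has the digits `u`. -/
def tupleOf (V : Finset Var) (u : List ℕ) : Assignment := fun x =>
  if x ∈ V then some ⟨u.getD (2 * (V.sort (· ≤ ·)).idxOf x) 0 + 1,
    u.getD (2 * (V.sort (· ≤ ·)).idxOf x + 1) 0 + 1⟩ else none

/-- Span ends are positive, so decreasing them by one loses nothing, and the digits determine the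
tuple. Hence digit lists without repetition give answers without repetition. -/
theorem tupleOf_digits {V : Finset Var} {s : List Letter} {ν : Assignment} (hν : IsTuple V s ν) :
    tupleOf V ((List.range (2 * V.card)).map (digit (V.sort (· ≤ ·)) ν)) = ν := by
  funext x
  unfold tupleOf
  split_ifs with hx
  · obtain ⟨sp, h, h1, h2, h3⟩ := hν.1 x hx
    have hmem : x ∈ V.sort (· ≤ ·) := (Finset.mem_sort _).2 hx
    have hi := List.idxOf_lt_length_of_mem hmem
    have hget : (V.sort (· ≤ ·)).getD ((V.sort (· ≤ ·)).idxOf x) 0 = x := by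
      rw [List.getD_eq_getElem _ _ hi]
      exact List.getElem_idxOf hi
    generalize (V.sort (· ≤ ·)).idxOf x = i at *
    rw [Finset.length_sort] at hi
    have hdig : ∀ b < 2, ((List.range (2 * V.card)).map (digit (V.sort (· ≤ ·)) ν)).getD
        (2 * i + b) 0 + 1 = sp.bound (2 + b) := by
      intro b hb
      have hb1 := Span.IsSpanOf.bound ⟨h1, h2, h3⟩ (2 + b)
      rw [List.getD_eq_getElem _ _ (by simp; omega)]
      simp only [List.getElem_map, List.getElem_range, digit,
        show (2 * i + b) / 2 = i by omega, show (2 * i + b) % 2 = b by omega, hget, h, Option.elim]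
      omega
    rw [h]
    exact congrArg some (Span.ext (hdig 0 (by omega)) (hdig 1 (by omega)))
  · exact (hν.2 x hx).symm

theorem tupleCode_tupleOf {V : Finset Var} {w : ℕ → ℕ}
    (hw : ∀ y < V.card, w (2 + y) = (V.sort (· ≤ ·)).getD y 0) (u : List ℕ) :
    tupleCode V (tupleOf V u) = printedAnswer w u 0 V.card := by
  have hys : V.sort (· ≤ ·) =
      (List.range' 0 V.card).map fun y => (V.sort (· ≤ ·)).getD y 0 := by
    refine List.ext_getElem (by simp) fun i hi _ => ?_
    rw [List.getElem_map, List.getElem_range', List.getD_eq_getElem _ _ (by omega)]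
    simp
  unfold tupleCode printedAnswer
  conv_lhs => rw [hys]
  rw [List.flatMap_map]
  refine List.flatMap_congr fun y hy => ?_
  have hy : y < V.card := by simpa using hy
  have hlen : y < (V.sort (· ≤ ·)).length := by simpa using hy
  have hmem : (V.sort (· ≤ ·)).getD y 0 ∈ V := by
    rw [List.getD_eq_getElem _ _ hlen, ← Finset.mem_sort (· ≤ ·)]
    exact List.getElem_mem hlen
  have hidx : (V.sort (· ≤ ·)).idxOf ((V.sort (· ≤ ·)).getD y 0) = y := by
    rw [List.getD_eq_getElem _ _ hlen]
    exact (V.sort_nodup (· ≤ ·)).idxOf_getElem y hlen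
  simp only [tupleOf, if_pos hmem, hidx, Option.elim, hw y hy, Nat.add_zero]

theorem digitAnswers_bound {q : RegexUCQ} {s : List Letter} {B : ℕ} (hB : s.length < B)
    {a : List ℕ} (ha : a ∈ digitAnswers q s) :
    a.length = 2 * q.vars.card ∧ ∀ x ∈ a, x < B := by
  obtain ⟨ν, hν, rfl⟩ := ha
  refine ⟨by simp, fun x hx => ?_⟩
  obtain ⟨e, he, rfl⟩ := List.mem_map.1 hx
  have hlen : e / 2 < (q.vars.sort (· ≤ ·)).length := by
    have := List.mem_range.1 he
    rw [Finset.length_sort]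
    omega
  have hmem : (q.vars.sort (· ≤ ·)).getD (e / 2) 0 ∈ q.vars := by
    rw [List.getD_eq_getElem _ _ hlen, ← Finset.mem_sort (· ≤ ·)]
    exact List.getElem_mem hlen
  obtain ⟨sp, h, h'⟩ := (q.spanner.isTuple s ν hν).1 _ hmem
  have := h'.bound (2 + e % 2)
  simp only [digit, h, Option.elim]
  omega

theorem OutputsWithDelay.mono {D D' : ℕ} {t : List Event} {out : List (List ℕ)}
    (h : OutputsWithDelay D t out) (hD : D ≤ D') : OutputsWithDelay D' t out := by
  obtain ⟨segs, last, h1, h2, h3, h4, h5, h6⟩ := h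
  exact ⟨segs, last, h1, h2, h3, fun u hu => ⟨(h4 u hu).1, (h4 u hu).2.trans hD⟩, h5, h6.trans hD⟩

/-- The program enumerates the answers, with a delay that is polynomial in the length of the
input. -/
theorem exists_exec_program (k : ℕ) : ∃ F : ℕ → ℕ, PolyBd F ∧
    ∀ (q : RegexUCQ) (s : List Letter) (W : ℕ), q.IsKUCQ k →
      quantBound k (q.code ++ sized s).length < W →
      quantBound k (q.code ++ sized s).length ^ 8 ≤ W →
      (∀ x ∈ q.code ++ sized s, x < W) →
      ∃ (t : List Event) (σ : State) (out : List Assignment),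
        Exec W (program k) (initialState (q.code ++ sized s)) t σ ∧ out.Nodup ∧
        (∀ a, a ∈ out ↔ a ∈ q.spanner.rel s) ∧
        OutputsWithDelay (F (q.code ++ sized s).length) t (out.map (tupleCode q.vars)) := by
  classical
  obtain ⟨T₁, hT₁, H₁⟩ := exists_runs_step_try k
  obtain ⟨T₂, hT₂, H₂⟩ := exists_runs_setup k
  have hQ : PolyBd (quantBound k) := (((PolyBd.const 2).mul .id).add (.const 10)).pow (k + 2)
  -- An iteration is a try, in time `T₁`, or takes at most `n * 40 + 50` for printing and
  -- backtracking; the loop test adds `2`.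
  let T' : ℕ → ℕ := fun n => T₁ (quantBound k n) + (n * 40 + 52)
  let X : ℕ → ℕ := fun n => (quantBound k n + 1) * T' n
  -- The first summand dominates the `(D + 1) * X` that the search requires, as `D ≤ B`. The second
  -- covers the setup, which precedes the first answer, and the failing loop test if there is no
  -- answer.
  let C : ℕ → ℕ := fun n => (quantBound k n + 1) * X n + (T₂ (quantBound k n) + 2)
  have hT' : PolyBd T' := (hT₁.comp hQ).add ((PolyBd.id.mul (.const 40)).add (.const 52))
  have hX : PolyBd X := (hQ.add (.const 1)).mul hT'
  have hC : PolyBd C := ((hQ.add (.const 1)).mul hX).add ((hT₂.comp hQ).add (.const 2))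
  refine ⟨fun n => C n + (quantBound k n + 1) * X n, hC.add ((hQ.add (.const 1)).mul hX),
    fun q s W hq hW hW' hlW => ?_⟩
  have hin := inputAt_code q s (w := fun a => (q.code ++ sized s).getD a 0) fun _ _ => rfl
  obtain ⟨hc1, hc2, hc3⟩ := hin.card_lt
  have hstr := hin.string_lt
  have hsq := sq_le_quantBound k (q.code ++ sized s).length
  specialize H₁ q s W
  specialize H₂ q s W hq hW hW'
  set l := q.code ++ sized s with hl
  set n := l.length with hn
  set B := quantBound k n with hB
  set D := 2 * q.vars.card with hD
  have hBn : 3 * n + 100 ≤ B := by nlinarith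
  obtain ⟨σ₁, ⟨t₁, x1, x2, x3⟩, h1, h2⟩ := H₂ (by omega)
  have hA : ∀ a ∈ digitAnswers q s, a.length = D ∧ ∀ x ∈ a, x < B :=
    fun a ha => digitAnswers_bound (by omega) ha
  have htup : ∀ ν ∈ q.spanner.rel s, IsTuple q.vars s ν := q.spanner.isTuple s
  have hCn : C n = (B + 1) * X n + (T₂ B + 2) := rfl
  have hTn : T' n = T₁ B + (n * 40 + 52) := rfl
  change t₁.length ≤ T₂ B at x2
  by_cases hP : HasAnswer q s []
  swap
  · refine ⟨_, σ₁, [], .seq _ _ _ _ _ _ _ x1 (.loopFalse _ _ _ (h2 hP)), List.nodup_nil, ?_, ?_⟩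
    · intro ν
      refine ⟨fun h => by simp at h, fun h => absurd ?_ hP⟩
      exact ⟨_, ⟨ν, h, rfl⟩, List.nil_prefix⟩
    · refine (Emits.quiet (D := C n) (g := 0) (x3.append (quiet_ticks _))
        le_rfl).outputsWithDelay ?_ |>.mono (Nat.le_add_right _ _)
      simp only [List.length_append, length_ticks, Expr.cost]
      omega
  have hDB : (D + 1) * X n ≤ (B + 1) * X n := Nat.mul_le_mul_right _ (by omega)
  obtain ⟨σ₂, t₂, y1, y2, y3⟩ := iterates_search (P := HasAnswer q s) (B := B) (W := W) (D := D)
    (T := T₁ B + (n * 40 + 50)) (e := .reg 7) (c := step) (At := SearchAt l B D)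
    (Popped := Popped l B D) (pr := fun u => printedAnswer (fun a => l.getD a 0) u 0 q.vars.card)
    (by omega) (fun u v σ h => by simp [Expr.eval, h.alive]) (fun u v σ h => h.searchAt)
    (fun u v σ h hu hv => by
      obtain ⟨σ', k1, k2, k3⟩ := H₁ u v σ hq hW hW' (by omega) h hu hv
      refine ⟨σ', k1.mono (Nat.le_add_right _ _), ?_⟩
      split_ifs with hPv
      · exact k2 hPv
      · exact k3 hPv)
    (fun u σ h hu => by
      obtain ⟨σ', k1, k2⟩ := h.runs_step_backtrack hu hW (by omega)
      exact ⟨σ', k1.mono (by omega), k2⟩)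
    (fun u v σ h hu => by
      obtain ⟨σ', t, t', k1, k2, k3, k4, k5, k6, k7⟩ :=
        h.exec_step_print hu hW (by omega) hD hc1 (by omega) hlW
      exact ⟨σ', t, t', k1, k2, k3, by omega, k5, by omega, k7⟩)
    (fun m u hm hPu => by
      obtain ⟨a, ha, hua⟩ := id hPu
      exact List.ne_nil_of_mem ((mem_search hA (fun _ => Iff.rfl) hm hPu).2 ⟨ha, hua⟩))
    (T' := T' n) (C := C n) (by simp only [Expr.cost]; omega)
    (hDB.trans (Nat.le_add_right _ _)) D [] σ₁ t₁.length (by simp) hP (h1 hP)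
    (by omega)
  have hfin : σ₂.reg 7 = 0 := by
    rcases y2 with ⟨-, h⟩ | ⟨u', x, h, -⟩
    · exact h
    · simp at h
  have hmem : ∀ a, a ∈ search (HasAnswer q s) B D [] ↔ a ∈ digitAnswers q s := by
    intro a
    rw [mem_search (P := HasAnswer q s) (m := D) (u := []) hA (fun _ => Iff.rfl) (by simp) hP]
    simp
  refine ⟨_, σ₂, (search (HasAnswer q s) B D []).map (tupleOf q.vars),
    .seq _ _ _ _ _ _ _ x1 (y1.exec hfin), ?_, fun ν => ?_, ?_⟩
  · refine (List.nodup_map_iff_inj_on (nodup_search D [])).2 fun a ha b hb hab => ?_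
    obtain ⟨ν, hν, rfl⟩ := (hmem a).1 ha
    obtain ⟨ν', hν', rfl⟩ := (hmem b).1 hb
    rw [tupleOf_digits (htup ν hν), tupleOf_digits (htup ν' hν')] at hab
    rw [hab]
  · rw [List.mem_map]
    constructor
    · rintro ⟨a, ha, rfl⟩
      obtain ⟨ν, hν, rfl⟩ := (hmem a).1 ha
      rwa [tupleOf_digits (htup ν hν)]
    · intro hν
      exact ⟨_, (hmem _).2 ⟨ν, hν, rfl⟩, tupleOf_digits (htup ν hν)⟩
  · have hem := (y3.append (.quiet (quiet_ticks ((Expr.reg 7).cost + 1)) le_rfl)).quiet_append x3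
      (g := 0) (by omega)
    rw [List.append_nil] at hem
    rw [List.map_map, show tupleCode q.vars ∘ tupleOf q.vars =
      fun u => printedAnswer (fun a => l.getD a 0) u 0 q.vars.card from
      funext fun u => tupleCode_tupleOf hc3 u]
    refine (hem.outputsWithDelay ?_).mono (Nat.add_le_add_left hDB _)
    simp only [length_ticks, Expr.cost]
    change (D + 1) * X n + 2 ≤ C n + (D + 1) * X n
    omega

theorem le_foldr_max {l : List ℕ} {x : ℕ} (hx : x ∈ l) : x ≤ l.foldr max 0 := by
  induction l with
  | nil => simp at hx
  | cons a l ih =>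
    rcases List.mem_cons.1 hx with rfl | hx
    · exact le_max_left _ _
    · exact (ih hx).trans (le_max_right _ _)

end DocSpanners

/-- For every fixed `k`, regex `k`-UCQs can be evaluated with polynomial delay. -/
theorem mainTheorem2 (k : ℕ) : (DocSpanners.kUCQEvaluation k).HasPolynomialDelay := by
  obtain ⟨F, hF, H⟩ := DocSpanners.exists_exec_program k
  have hQ : DocSpanners.PolyBd (DocSpanners.quantBound k) :=
    (((DocSpanners.PolyBd.const 2).mul .id).add (.const 10)).pow (k + 2)
  obtain ⟨p₁, hp₁⟩ := hF
  -- `p₁` bounds the delay. `p₂` is for the word bound, which must exceed the quantifier bound and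
  -- every input word and be at least the eighth power of the quantifier bound.
  obtain ⟨p₂, hp₂⟩ := (hQ.add (hQ.pow 8)).add (DocSpanners.PolyBd.id.add (.const 1))
  refine ⟨DocSpanners.Driver.program k, p₁ + p₂, fun x => ?_⟩
  set l := (DocSpanners.kUCQEvaluation k).inputCode x with hl
  set M := l.foldr max 0 with hM
  have hW : DocSpanners.quantBound k (l.length + M) + DocSpanners.quantBound k (l.length + M) ^ 8 +
    (l.length + M + 1) ≤ _ := hp₂ (l.length + M)
  have hmono : DocSpanners.quantBound k l.length ≤ DocSpanners.quantBound k (l.length + M) :=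
    DocSpanners.quantBound_mono k (Nat.le_add_right _ _)
  have hmono' := Nat.pow_le_pow_left hmono 8
  have heval : ∀ n, (p₁ + p₂).eval n = p₁.eval n + p₂.eval n := fun n => Polynomial.eval_add
  obtain ⟨t, σ, out, h1, h2, h3, h4⟩ := H x.1.1 x.2 ((p₁ + p₂).eval (l.length + M)) x.1.2
    (by rw [heval]; change DocSpanners.quantBound k l.length < _; omega)
    (by rw [heval]; change DocSpanners.quantBound k l.length ^ 8 ≤ _; omega)
    (fun y hy => by
      have : y ≤ M := DocSpanners.le_foldr_max hy
      rw [heval]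
      omega)
  refine ⟨t, σ, out, h1, h2, h3, h4.mono ?_⟩
  rw [heval]
  exact (hp₁ l.length).trans (Nat.le_add_right _ _)
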